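/- **Theorem 6.6.** Let $d,n,m\ge 1$ be integers and $\delta>0$. Then there is a constant $N=N(d,n,m,\delta)$ such that the following holds. Let $T\in(-\infty,\infty]$ and $$\mathcal O_T^+=(-\infty,T)\times\{x=(x_1,x')\in\mathbb R^d:\ x_1>0\}.$$ For multi-indices $\alpha,\beta$ with $|\alpha|=|\beta|=m$, let $A^{\alpha\beta}=A^{\alpha\beta}(t)$ be measurable functions of $t\in\mathbb R$ only, with values in the complex $n\times n$ matrices, such that $|A^{\alpha\beta}|\le\delta^{-1}$ and the Legendre–Hadamard ellipticity condition $$\operatorname{Re}\Big(\sum_{|\alpha|=|\beta|=m}\theta^{\mathrm{tr}}\,\xi^\alpha\xi^\beta A^{\alpha\beta}(t)\,\bar\theta\Big)\ \ge\ \delta\,|\xi|^{2m}|\theta|^2\qquad (t\in\mathbb R,\ \xi\in\mathbb R^d,\ \theta\in\mathbb C^n)$$ holds. Put $\mathcal L_0u=\sum_{|\alpha|=|\beta|=m}A^{\alpha\beta}(t)D^\alpha D^\beta u$, where $D^\alpha$ denotes spatial derivatives. Let $u\in W_2^{1,2m}(\mathcal O_T^+)$, that is, $u:\mathcal O_T^+\to\mathbb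 C^n$ and the weak derivatives $u_t$ and $D^\alpha u$, $0\le|\alpha|\le 2m$, belong to $L_2(\mathcal O_T^+)$, and suppose that, in the sense of traces, $$u(t,0,x')=D_1u(t,0,x')=\cdots=D_1^{m-1}u(t,0,x')=0\quad\text{on }(-\infty,T)\times\mathbb R^{d-1}.$$ Then for all $\lambda\ge 0$ $$\|u_t\|_{L_2(\mathcal O_T^+)}+\sum_{|\alpha|\le 2m}\lambda^{1-\frac{|\alpha|}{2m}}\|D^\alpha u\|_{L_2(\mathcal O_T^+)}\ \le\ N\,\|u_t+(-1)^m\mathcal L_0u+\lambda u\|_{L_2(\mathcal O_T^+)},$$ where $\lambda^0=1$ also for $\lambda=0$. -/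

import Mathlib

open MeasureTheory Filter Topology
open scoped NNReal ENNReal ContDiff Matrix

noncomputable section

/-- Space-time points `(t, x)` with `t ∈ ℝ` and `x ∈ ℝᵈ`. -/
abbrev SpaceTime (d : ℕ) : Type := ℝ × EuclideanSpace ℝ (Fin d)

/-- The values `ℂⁿ`, with the Euclidean norm. -/
abbrev Cvec (n : ℕ) : Type := EuclideanSpace ℂ (Fin n)

/-- Multi-indices in `d` variables. -/
abbrev MultiIdx (d : ℕ) : Type := Fin d → ℕ

/-- The finite set of multi-indices `α` with `|α| = k`. -/
def multiIdx (d k : ℕ) : Finset (MultiIdx d) := Finset.piAntidiag Finset.univ k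

/-- The half-space cylinder `(-∞, T) × {x ∈ ℝᵈ : x₁ > 0}` for `T ∈ (-∞, ∞]`; the first coordinate
of `x` has index `0`. -/
def halfCyl (d : ℕ) [NeZero d] (T : WithTop ℝ) : Set (SpaceTime d) :=
  {p | (p.1 : WithTop ℝ) < T ∧ 0 < p.2 0}

/-- The classical time derivative of a scalar function of `(t, x)`. -/
def classDt {d : ℕ} (φ : SpaceTime d → ℝ) : SpaceTime d → ℝ :=
  fun p => fderiv ℝ φ p (1, 0)

/-- The classical derivative in the direction of the `i`-th space coordinate. -/
def classDi {d : ℕ} (i : Fin d) (φ : SpaceTime d → ℝ) : SpaceTime d → ℝ :=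
  fun p => fderiv ℝ φ p (0, EuclideanSpace.single i 1)

/-- The classical space derivative `D^α φ = D₁^{α₁} ⋯ D_d^{α_d} φ`. -/
def classDx {d : ℕ} (α : MultiIdx d) (φ : SpaceTime d → ℝ) : SpaceTime d → ℝ :=
  (List.finRange d).foldr (fun i g => (classDi i)^[α i] g) φ

/-- Test functions: smooth functions with compact support contained in `Ω`. -/
structure IsTest {d : ℕ} (Ω : Set (SpaceTime d)) (φ : SpaceTime d → ℝ) : Prop where
  contDiff : ContDiff ℝ ∞ φ
  hasCompactSupport : HasCompactSupport φ
  tsupport_subset : tsupport φ ⊆ Ω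

/-- `v` is a weak time derivative of `u` in the open set `Ω`. -/
structure HasWeakDt {d n : ℕ} (Ω : Set (SpaceTime d)) (u v : SpaceTime d → Cvec n) : Prop where
  left_locInt : LocallyIntegrableOn u Ω
  right_locInt : LocallyIntegrableOn v Ω
  integral_eq : ∀ φ : SpaceTime d → ℝ, IsTest Ω φ →
    ∫ p in Ω, classDt φ p • u p = -∫ p in Ω, φ p • v p

/-- `v` is a weak space derivative `D^α u` in the open set `Ω`. -/
structure HasWeakDx {d n : ℕ} (Ω : Set (SpaceTime d)) (α : MultiIdx d)
    (u v : SpaceTime d → Cvec n) : Prop where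
  left_locInt : LocallyIntegrableOn u Ω
  right_locInt : LocallyIntegrableOn v Ω
  integral_eq : ∀ φ : SpaceTime d → ℝ, IsTest Ω φ →
    ∫ p in Ω, classDx α φ p • u p = (-1 : ℝ) ^ (∑ i, α i) • ∫ p in Ω, φ p • v p

open Classical in
/-- The weak time derivative `u_t` in `Ω` (a representative; zero if there is none). -/
def weakDt {d n : ℕ} (Ω : Set (SpaceTime d)) (u : SpaceTime d → Cvec n) : SpaceTime d → Cvec n :=
  if h : ∃ v, HasWeakDt Ω u v then h.choose else 0

open Classical in
/-- The weak space derivative `D^α u` in `Ω` (a representative; zero if there is none). -/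
def weakDx {d n : ℕ} (Ω : Set (SpaceTime d)) (α : MultiIdx d) (u : SpaceTime d → Cvec n) :
    SpaceTime d → Cvec n :=
  if h : ∃ v, HasWeakDx Ω α u v then h.choose else 0

/-- The `L₂(Ω)` norm with respect to Lebesgue measure, as an element of `[0, ∞]`. -/
def normL2 {d n : ℕ} (Ω : Set (SpaceTime d)) (u : SpaceTime d → Cvec n) : ℝ≥0∞ :=
  eLpNorm u 2 (volume.restrict Ω)

/-- `u ∈ W₂^{1,k}(Ω)`: the weak derivatives `u_t` and `D^α u`, `|α| ≤ k`, exist in `Ω` and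
belong to `L₂(Ω)`. -/
structure MemW12 {d n : ℕ} (k : ℕ) (Ω : Set (SpaceTime d)) (u : SpaceTime d → Cvec n) : Prop where
  memLp : MemLp u 2 (volume.restrict Ω)
  exists_dt : ∃ v, HasWeakDt Ω u v
  memLp_dt : MemLp (weakDt Ω u) 2 (volume.restrict Ω)
  exists_dx : ∀ α : MultiIdx d, ∑ i, α i ≤ k → ∃ v, HasWeakDx Ω α u v
  memLp_dx : ∀ α : MultiIdx d, ∑ i, α i ≤ k → MemLp (weakDx Ω α u) 2 (volume.restrict Ω)

/-- The trace of `v` on `(-∞, T) × {x₁ = 0}` vanishes, as an `L₂` limit of the slices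
`v(·, x₁, ·)`: the mean over `x₁ ∈ (0, ε)` of `∫ |v(t, x₁, x')|² dx' dt` tends to `0` as `ε ↓ 0`.
If `v` and `D₁ v` are in `L₂`, the slices depend continuously on `x₁ ∈ [0, ∞)` with values in
`L₂` and this limit is the squared `L₂` norm of the trace of `v`. -/
def HasZeroTrace {d n : ℕ} [NeZero d] (T : WithTop ℝ) (v : SpaceTime d → Cvec n) : Prop :=
  Tendsto (fun ε : ℝ =>
      (∫⁻ p in {p ∈ halfCyl d T | p.2 0 < ε}, ‖v p‖ₑ ^ 2) / ENNReal.ofReal ε)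
    (𝓝[>] 0) (𝓝 0)

/-- The boundary condition `u = D₁ u = ⋯ = D₁^{m-1} u = 0` on `(-∞, T) × {x₁ = 0}`. -/
def ZeroDirichlet {d n : ℕ} [NeZero d] (m : ℕ) (T : WithTop ℝ) (u : SpaceTime d → Cvec n) : Prop :=
  ∀ j < m, HasZeroTrace T (weakDx (halfCyl d T) (Pi.single 0 j) u)

/-- The coefficients `A^{αβ}(t)`, complex `n × n` matrices depending on `t` only. Only the values
for `|α| = |β| = m` are used. -/
abbrev Coeff (d n : ℕ) : Type := MultiIdx d → MultiIdx d → ℝ → Matrix (Fin n) (Fin n) ℂ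

/-- The leading coefficients are Lebesgue measurable, bounded by `δ⁻¹` and satisfy the
Legendre-Hadamard ellipticity condition with constant `δ`. The bound is asked entrywise, which
follows from the same bound in any of the usual matrix norms. -/
structure LegendreHadamard {d n : ℕ} (m : ℕ) (δ : ℝ) (A : Coeff d n) : Prop where
  measurable : ∀ α ∈ multiIdx d m, ∀ β ∈ multiIdx d m, ∀ i j,
    AEMeasurable (fun t => A α β t i j) volume
  bounded : ∀ α ∈ multiIdx d m, ∀ β ∈ multiIdx d m, ∀ t i j, ‖A α β t i j‖ ≤ δ⁻¹
  elliptic : ∀ (t : ℝ) (ξ : EuclideanSpace ℝ (Fin d)) (θ : Cvec n),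
    δ * ‖ξ‖ ^ (2 * m) * ‖θ‖ ^ 2 ≤
      (∑ α ∈ multiIdx d m, ∑ β ∈ multiIdx d m,
        (((∏ i, ξ i ^ α i) * (∏ i, ξ i ^ β i) : ℝ) : ℂ) *
          (θ.ofLp ⬝ᵥ (A α β t *ᵥ star θ.ofLp))).re

/-- `𝓛₀ u = ∑_{|α|=|β|=m} A^{αβ}(t) D^α D^β u`, where `D^α D^β u = D^{α+β} u`. -/
def opL0 {d n : ℕ} (m : ℕ) (A : Coeff d n) (Ω : Set (SpaceTime d)) (u : SpaceTime d → Cvec n) :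
    SpaceTime d → Cvec n :=
  fun p => ∑ α ∈ multiIdx d m, ∑ β ∈ multiIdx d m,
    WithLp.toLp 2 (A α β p.1 *ᵥ (weakDx Ω (α + β) u p).ofLp)

/-- `u_t + (-1)^m 𝓛₀ u + λ u`, with weak derivatives in `Ω`. -/
def opP {d n : ℕ} (m : ℕ) (A : Coeff d n) (lam : ℝ) (Ω : Set (SpaceTime d))
    (u : SpaceTime d → Cvec n) : SpaceTime d → Cvec n :=
  fun p => weakDt Ω u p + (-1 : ℝ) ^ m • opL0 m A Ω u p + lam • u p

end

/-! Write f = u_t + (-1)^m 𝓛₀u + λu. The proof is an energy argument: f is paired in L₂ with u and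
with (-1)^m D_j^{2m}u, for every coordinate direction j.

Two extensions to the whole space justify the integrations by parts. Because of the Dirichlet
condition, extension by zero preserves D^αu as long as α contains at most m normal derivatives
(`WeakJet.hasWeakDx_zeroExt`). A higher-order reflection preserves all derivatives of order up to
2m, and controls each of them by the derivative of the same index (`exists_reflection_jet`). In a
pairing one factor is extended by zero, which confines the integral to the half space, and the other
by reflection. Both families are L₂ limits of derivatives of smooth compactly supported functions
(`isLimitJet_of_hasWeakDx`). As the coefficients depend on t only, Plancherel in x at fixed t then
gives integration by parts (`IsLimitJet.inner_op_eq`), Gårding's inequality (`IsLimitJet.garding`)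
and interpolation inequalities (`IsLimitJet.norm_sq_le`).

The time derivative contributes with a good sign. Backward difference quotients of the zero
extension converge weakly to u_t inside the cylinder, and Re⟨v, v - τv⟩ ≥ 0 since the translation τ
is an isometry. Hence Re⟨u, u_t⟩ ≥ 0 and, after moving m derivatives across, Re⟨(-1)^m D_j^{2m}u,
u_t⟩ ≥ 0. Nothing is required of u at t = T. The term λu has a good sign in the same pairings.

Testing with u therefore gives λ‖u‖ ≤ ‖f‖, and the second test gives Re⟨D_j^{2m}u, 𝓛₀u⟩ ≤
‖D_j^{2m}u‖ ‖f‖. For tangential j, moving D_j^m across and applying Gårding to D_j^m u bounds the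
left side below by δ‖D_j^{2m}u‖². In the normal direction D_1^m u need not satisfy the boundary
condition, so 𝓛₀u is split instead: its D_1^{2m}u term is elliptic pointwise (take ξ = e₁), and all
other terms contain a tangential derivative, hence are at most ε‖D_1^{2m}u‖ plus a multiple of the
tangential norms. A small ε is absorbed (`exists_normal_bound`). Interpolation between u and the
pure derivatives D_j^{2m}u yields the remaining derivatives with their powers of λ, and the equation
yields u_t (`exists_main_bound`). -/

/-! ### Calculus of classical space derivatives indexed by multi-indices. -/

section ClassicalDerivatives

variable {d : ℕ} {F G : Type*} [NormedAddCommGroup F] [NormedSpace ℝ F]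
  [NormedAddCommGroup G] [NormedSpace ℝ G]

/-- The `i`-th space direction in space-time. -/
noncomputable def spaceDir (i : Fin d) : SpaceTime d := (0, EuclideanSpace.single i 1)

/-- The derivative in the `i`-th space direction of a vector-valued function. -/
noncomputable def dirDeriv (i : Fin d) (φ : SpaceTime d → F) : SpaceTime d → F :=
  fun p => fderiv ℝ φ p (spaceDir i)

/-- The classical space derivative `D^α` of a vector-valued function. -/
noncomputable def multiDeriv (α : MultiIdx d) (φ : SpaceTime d → F) : SpaceTime d → F :=
  (List.finRange d).foldr (fun i g => (dirDeriv i)^[α i] g) φ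

theorem classDx_eq_multiDeriv (α : MultiIdx d) (φ : SpaceTime d → ℝ) :
    classDx α φ = multiDeriv α φ := rfl

/-- Smooth compactly supported functions on space-time. -/
structure IsBump (φ : SpaceTime d → F) : Prop where
  contDiff : ContDiff ℝ ∞ φ
  hasCompactSupport : HasCompactSupport φ

theorem MultiIdx.induction_add_single {P : MultiIdx d → Prop} (h0 : P 0)
    (hs : ∀ α i, P α → P (α + Pi.single i 1)) (α : MultiIdx d) : P α := by
  induction hk : ∑ i, α i generalizing α with
  | zero =>
    have : α = 0 := by
      funext i
      exact (Finset.sum_eq_zero_iff.mp hk) i (Finset.mem_univ i)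
    exact this ▸ h0
  | succ k ih =>
    obtain ⟨i, -, hi⟩ : ∃ i ∈ Finset.univ, α i ≠ 0 := by
      apply Finset.exists_ne_zero_of_sum_ne_zero
      omega
    have he : α - Pi.single i 1 + Pi.single i 1 = α := by
      funext j
      by_cases hj : j = i
      · subst hj; simp; omega
      · simp [hj]
    rw [← he]
    apply hs
    apply ih
    have := congrArg (fun a : MultiIdx d => ∑ i, a i) he
    simp only [Pi.add_apply, Finset.sum_add_distrib, Finset.sum_pi_single', Finset.mem_univ,
      if_true, hk] at this
    have h1 : ∑ j, (Pi.single i 1 : MultiIdx d) j = 1 := by simp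
    omega

theorem contDiff_dirDeriv {φ : SpaceTime d → F} (h : ContDiff ℝ ∞ φ) (i : Fin d) :
    ContDiff ℝ ∞ (dirDeriv i φ) := by
  have : ContDiff ℝ ∞ (fderiv ℝ φ) := h.fderiv_right (by norm_cast)
  exact this.clm_apply contDiff_const

theorem hasCompactSupport_dirDeriv {φ : SpaceTime d → F} (h : HasCompactSupport φ) (i : Fin d) :
    HasCompactSupport (dirDeriv i φ) :=
  h.fderiv_apply ℝ (spaceDir i)

theorem tsupport_dirDeriv_subset (φ : SpaceTime d → F) (i : Fin d) :
    tsupport (dirDeriv i φ) ⊆ tsupport φ := by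
  exact tsupport_fderiv_apply_subset ℝ (spaceDir i)

theorem IsBump.dir {φ : SpaceTime d → F} (h : IsBump φ) (i : Fin d) :
    IsBump (dirDeriv i φ) :=
  ⟨contDiff_dirDeriv h.1 i, hasCompactSupport_dirDeriv h.2 i⟩

theorem dirDeriv_comm {φ : SpaceTime d → F} (h : ContDiff ℝ ∞ φ) (i j : Fin d) :
    dirDeriv i (dirDeriv j φ) = dirDeriv j (dirDeriv i φ) := by
  funext p
  have h1 : ContDiff ℝ ∞ (fderiv ℝ φ) := h.fderiv_right (by norm_cast)
  have h2 : DifferentiableAt ℝ (fderiv ℝ φ) p := (h1.differentiable (by simp)) p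
  have hs : IsSymmSndFDerivAt ℝ φ p :=
    h.contDiffAt.isSymmSndFDerivAt (by simpa using (show ((2 : ℕ∞) : WithTop ℕ∞) ≤ ((⊤ : ℕ∞) : WithTop ℕ∞) from
      WithTop.coe_le_coe.2 le_top))
  have key : ∀ v w : SpaceTime d, fderiv ℝ (fun q => fderiv ℝ φ q v) p w =
      fderiv ℝ (fderiv ℝ φ) p w v := by
    intro v w
    rw [fderiv_clm_apply h2 (differentiableAt_const _)]
    simp
  unfold dirDeriv
  rw [key, key]
  exact hs _ _

/-- An induction principle for properties stable under space derivatives. -/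
theorem multiDeriv_induction {P : (SpaceTime d → F) → Prop}
    (hP : ∀ i φ, P φ → P (dirDeriv i φ)) (α : MultiIdx d) {φ : SpaceTime d → F} (h : P φ) :
    P (multiDeriv α φ) := by
  unfold multiDeriv
  induction List.finRange d with
  | nil => exact h
  | cons i l ih =>
    simp only [List.foldr_cons]
    induction α i with
    | zero => exact ih
    | succ k ihk => rw [Function.iterate_succ_apply']; exact hP _ _ ihk

theorem contDiff_multiDeriv {φ : SpaceTime d → F} (h : ContDiff ℝ ∞ φ) (α : MultiIdx d) :
    ContDiff ℝ ∞ (multiDeriv α φ) :=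
  multiDeriv_induction (P := fun φ => ContDiff ℝ ∞ φ) (fun i _ h => contDiff_dirDeriv h i) α h

theorem IsBump.multi {φ : SpaceTime d → F} (h : IsBump φ) (α : MultiIdx d) :
    IsBump (multiDeriv α φ) :=
  multiDeriv_induction (P := fun φ => IsBump φ) (fun i _ h => h.dir i) α h

theorem IsTest.isBump {Ω : Set (SpaceTime d)} {φ : SpaceTime d → ℝ} (h : IsTest Ω φ) : IsBump φ :=
  ⟨h.1, h.2⟩

theorem IsTest.dir {Ω : Set (SpaceTime d)} {φ : SpaceTime d → ℝ} (h : IsTest Ω φ)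
    (i : Fin d) : IsTest Ω (dirDeriv i φ) :=
  ⟨contDiff_dirDeriv h.1 i, hasCompactSupport_dirDeriv h.2 i,
    (tsupport_dirDeriv_subset φ i).trans h.3⟩

theorem IsTest.multi {Ω : Set (SpaceTime d)} {φ : SpaceTime d → ℝ} (h : IsTest Ω φ)
    (α : MultiIdx d) : IsTest Ω (multiDeriv α φ) :=
  multiDeriv_induction (P := fun φ => IsTest Ω φ) (fun i _ h => h.dir i) α h

theorem iterate_dirDeriv_comm {φ : SpaceTime d → F} (h : ContDiff ℝ ∞ φ) (i j : Fin d) (k : ℕ) :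
    (dirDeriv j)^[k] (dirDeriv i φ) = dirDeriv i ((dirDeriv j)^[k] φ) := by
  induction k generalizing φ with
  | zero => rfl
  | succ k ih =>
    rw [Function.iterate_succ_apply, Function.iterate_succ_apply, dirDeriv_comm h,
      ih (contDiff_dirDeriv h j)]

theorem contDiff_iterate_dirDeriv {φ : SpaceTime d → F} (h : ContDiff ℝ ∞ φ) (i : Fin d) (k : ℕ) :
    ContDiff ℝ ∞ ((dirDeriv i)^[k] φ) := by
  induction k with
  | zero => exact h
  | succ k ih => rw [Function.iterate_succ_apply']; exact contDiff_dirDeriv ih i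

theorem contDiff_foldr_dirDeriv {φ : SpaceTime d → F} (h : ContDiff ℝ ∞ φ) (α : MultiIdx d)
    (l : List (Fin d)) :
    ContDiff ℝ ∞ (l.foldr (fun i g => (dirDeriv i)^[α i] g) φ) := by
  induction l with
  | nil => exact h
  | cons i l ih => exact contDiff_iterate_dirDeriv ih i _

theorem foldr_dirDeriv_comm {φ : SpaceTime d → F} (h : ContDiff ℝ ∞ φ) (α : MultiIdx d)
    (l : List (Fin d)) (i : Fin d) :
    l.foldr (fun i g => (dirDeriv i)^[α i] g) (dirDeriv i φ) =
      dirDeriv i (l.foldr (fun i g => (dirDeriv i)^[α i] g) φ) := by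
  induction l with
  | nil => rfl
  | cons j l ih =>
    simp only [List.foldr_cons]
    rw [ih, iterate_dirDeriv_comm (contDiff_foldr_dirDeriv h α l)]

theorem multiDeriv_dirDeriv {φ : SpaceTime d → F} (h : ContDiff ℝ ∞ φ) (α : MultiIdx d)
    (i : Fin d) : multiDeriv α (dirDeriv i φ) = dirDeriv i (multiDeriv α φ) :=
  foldr_dirDeriv_comm h α _ i

theorem multiDeriv_add_single {φ : SpaceTime d → F} (h : ContDiff ℝ ∞ φ) (α : MultiIdx d)
    (i : Fin d) : multiDeriv (α + Pi.single i 1) φ = multiDeriv α (dirDeriv i φ) := by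
  rw [multiDeriv_dirDeriv h]
  -- Without repetitions in the list, the additional derivative enters exactly once, at the position
  -- of `i`, and commutes outwards from there.
  have key : ∀ l : List (Fin d), l.Nodup →
      l.foldr (fun j g => (dirDeriv j)^[(α + Pi.single i 1 : MultiIdx d) j] g) φ =
        if i ∈ l then dirDeriv i (l.foldr (fun j g => (dirDeriv j)^[α j] g) φ)
        else l.foldr (fun j g => (dirDeriv j)^[α j] g) φ := by
    intro l hl
    induction l with
    | nil => simp
    | cons j l ih =>
      rw [List.nodup_cons] at hl
      simp only [List.foldr_cons]
      rw [ih hl.2]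
      by_cases hij : i = j
      · subst hij
        simp [hl.1, Function.iterate_succ_apply']
      · have : (α + Pi.single i 1 : MultiIdx d) j = α j := by
          simp [Ne.symm hij]
        rw [this]
        by_cases hil : i ∈ l
        · simp only [hil, List.mem_cons, or_true, if_true]
          rw [iterate_dirDeriv_comm (contDiff_foldr_dirDeriv h α l)]
        · simp [hil, hij]
  have := key _ (List.nodup_finRange d)
  simpa [multiDeriv] using this

@[simp] theorem multiDeriv_zero (φ : SpaceTime d → F) : multiDeriv 0 φ = φ := by
  unfold multiDeriv
  induction List.finRange d with
  | nil => rfl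
  | cons i l _ => simp

theorem multiDeriv_add {φ : SpaceTime d → F} (h : ContDiff ℝ ∞ φ) (α β : MultiIdx d) :
    multiDeriv (α + β) φ = multiDeriv α (multiDeriv β φ) := by
  induction β using MultiIdx.induction_add_single generalizing φ with
  | h0 => simp
  | hs β i ih =>
    rw [← add_assoc, multiDeriv_add_single h, ih (contDiff_dirDeriv h i),
      multiDeriv_add_single h]

theorem multiDeriv_single_one {φ : SpaceTime d → F} (h : ContDiff ℝ ∞ φ) (i : Fin d) :
    multiDeriv (Pi.single i 1) φ = dirDeriv i φ := by
  rw [← zero_add (Pi.single i 1 : MultiIdx d), multiDeriv_add_single h, multiDeriv_zero]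

theorem dirDeriv_add {φ ψ : SpaceTime d → F} (hφ : ContDiff ℝ ∞ φ) (hψ : ContDiff ℝ ∞ ψ)
    (i : Fin d) : dirDeriv i (φ + ψ) = dirDeriv i φ + dirDeriv i ψ := by
  funext p
  unfold dirDeriv
  rw [fderiv_add ((hφ.differentiable (by simp)) p) ((hψ.differentiable (by simp)) p)]
  rfl

theorem dirDeriv_const_smul {φ : SpaceTime d → F} (hφ : ContDiff ℝ ∞ φ) (c : ℝ)
    (i : Fin d) : dirDeriv i (c • φ) = c • dirDeriv i φ := by
  funext p
  unfold dirDeriv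
  rw [fderiv_const_smul ((hφ.differentiable (by simp)) p)]
  rfl

theorem multiDeriv_add_fun {φ ψ : SpaceTime d → F} (hφ : ContDiff ℝ ∞ φ) (hψ : ContDiff ℝ ∞ ψ)
    (α : MultiIdx d) : multiDeriv α (φ + ψ) = multiDeriv α φ + multiDeriv α ψ := by
  induction α using MultiIdx.induction_add_single generalizing φ ψ with
  | h0 => simp
  | hs α i ih =>
    rw [multiDeriv_add_single (φ := φ + ψ) (hφ.add hψ), dirDeriv_add hφ hψ,
      ih (contDiff_dirDeriv hφ i) (contDiff_dirDeriv hψ i), multiDeriv_add_single hφ,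
      multiDeriv_add_single hψ]

theorem multiDeriv_const_smul {φ : SpaceTime d → F} (hφ : ContDiff ℝ ∞ φ) (c : ℝ)
    (α : MultiIdx d) : multiDeriv α (c • φ) = c • multiDeriv α φ := by
  induction α using MultiIdx.induction_add_single generalizing φ with
  | h0 => simp
  | hs α i ih =>
    rw [multiDeriv_add_single (φ := c • φ) (contDiff_const.smul hφ), dirDeriv_const_smul hφ,
      ih (contDiff_dirDeriv hφ i), multiDeriv_add_single hφ]

theorem dirDeriv_smul {ζ : SpaceTime d → ℝ} {φ : SpaceTime d → F} (hζ : ContDiff ℝ ∞ ζ)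
    (hφ : ContDiff ℝ ∞ φ) (i : Fin d) :
    dirDeriv i (fun p => ζ p • φ p) = (fun p => ζ p • dirDeriv i φ p) +
      fun p => dirDeriv i ζ p • φ p := by
  funext p
  unfold dirDeriv
  rw [fderiv_fun_smul ((hζ.differentiable (by simp)) p) ((hφ.differentiable (by simp)) p)]
  simp

theorem dirDeriv_comp_sub (φ : SpaceTime d → F) (q : SpaceTime d) (i : Fin d) :
    dirDeriv i (fun p => φ (p - q)) = fun p => dirDeriv i φ (p - q) := by
  funext p
  unfold dirDeriv
  rw [fderiv_comp_sub]

theorem multiDeriv_comp_sub {φ : SpaceTime d → F} (hφ : ContDiff ℝ ∞ φ) (q : SpaceTime d)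
    (α : MultiIdx d) :
    multiDeriv α (fun p => φ (p - q)) = fun p => multiDeriv α φ (p - q) := by
  induction α using MultiIdx.induction_add_single generalizing φ with
  | h0 => simp
  | hs α i ih =>
    rw [multiDeriv_add_single (φ := fun p => φ (p - q))
      (hφ.comp (contDiff_id.sub contDiff_const)), dirDeriv_comp_sub,
      ih (contDiff_dirDeriv hφ i), multiDeriv_add_single hφ]

theorem dirDeriv_comp_const_sub {φ : SpaceTime d → F} (hφ : ContDiff ℝ ∞ φ) (q : SpaceTime d)
    (i : Fin d) :
    dirDeriv i (fun p => φ (q - p)) = (-1 : ℝ) • fun p => dirDeriv i φ (q - p) := by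
  funext p
  unfold dirDeriv
  have h1 : HasFDerivAt (fun p : SpaceTime d => q - p) (-ContinuousLinearMap.id ℝ (SpaceTime d)) p :=
    (hasFDerivAt_id p).const_sub q
  have h2 := ((hφ.differentiable (by simp)) (q - p)).hasFDerivAt.comp p h1
  have h3 := h2.fderiv
  simp only [Function.comp_def] at h3
  rw [h3]
  simp

theorem multiDeriv_comp_const_sub {φ : SpaceTime d → F} (hφ : ContDiff ℝ ∞ φ) (q : SpaceTime d)
    (α : MultiIdx d) :
    multiDeriv α (fun p => φ (q - p)) =
      (-1 : ℝ) ^ (∑ i, α i) • fun p => multiDeriv α φ (q - p) := by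
  induction α using MultiIdx.induction_add_single generalizing φ with
  | h0 => simp
  | hs α i ih =>
    have hc : ∀ {ψ : SpaceTime d → F}, ContDiff ℝ ∞ ψ → ContDiff ℝ ∞ fun p => ψ (q - p) :=
      fun h => h.comp (contDiff_const.sub contDiff_id)
    rw [multiDeriv_add_single (φ := fun p => φ (q - p)) (hc hφ), dirDeriv_comp_const_sub hφ,
      multiDeriv_const_smul (hc (contDiff_dirDeriv hφ i)),
      ih (contDiff_dirDeriv hφ i), multiDeriv_add_single hφ, smul_smul]
    congr 1
    simp [Finset.sum_add_distrib, pow_succ]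

theorem dirDeriv_comp_smul {φ : SpaceTime d → F} (c : ℝ) (i : Fin d) :
    dirDeriv i (fun p => φ (c • p)) = c • fun p => dirDeriv i φ (c • p) := by
  funext p
  unfold dirDeriv
  rw [fderiv_comp_smul]
  rfl

end ClassicalDerivatives

/-! ### Plancherel in the space variables at fixed time. -/

section SliceFourier

open scoped FourierTransform InnerProductSpace

variable {d n : ℕ}

theorem integrable_inner_of_memLp_two {α E : Type*} [NormedAddCommGroup E] [InnerProductSpace ℂ E]
    [MeasurableSpace α] {μ : Measure α} {f g : α → E} (hf : MemLp f 2 μ) (hg : MemLp g 2 μ) :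
    Integrable (fun x => ⟪f x, g x⟫_ℂ) μ := by
  refine (L2.integrable_inner (𝕜 := ℂ) (hf.toLp f) (hg.toLp g)).congr ?_
  filter_upwards [hf.coeFn_toLp, hg.coeFn_toLp] with x h1 h2
  rw [h1, h2]

theorem IsBump.slice {F : Type*} [NormedAddCommGroup F] [NormedSpace ℝ F]
    {φ : SpaceTime d → F} (h : IsBump φ) (t : ℝ) :
    ContDiff ℝ ∞ (fun x => φ (t, x)) ∧ HasCompactSupport (fun x => φ (t, x)) := by
  refine ⟨h.1.comp (contDiff_const.prodMk contDiff_id), ?_⟩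
  apply h.2.comp_isClosedEmbedding (g := fun x : EuclideanSpace ℝ (Fin d) => (t, x))
  exact (Topology.IsClosedEmbedding.of_continuous_injective_isClosedMap (by fun_prop)
    (fun x y hxy => (Prod.mk.inj hxy).2) (isClosedMap_prodMk_left t))

/-- The space slice of a smooth compactly supported function as a Schwartz function. -/
noncomputable def IsBump.sliceS {φ : SpaceTime d → Cvec n} (h : IsBump φ) (t : ℝ) :
    SchwartzMap (EuclideanSpace ℝ (Fin d)) (Cvec n) :=
  (h.slice t).2.toSchwartzMap (h.slice t).1

theorem IsBump.sliceS_apply {φ : SpaceTime d → Cvec n} (h : IsBump φ) (t : ℝ)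
    (x : EuclideanSpace ℝ (Fin d)) : h.sliceS t x = φ (t, x) := rfl

/-- The Fourier symbol of `D^α`. -/
noncomputable def fourierSymbol (α : MultiIdx d) (ξ : EuclideanSpace ℝ (Fin d)) : ℂ :=
  ∏ i, (2 * Real.pi * Complex.I * (ξ i : ℂ)) ^ α i

theorem fourierSymbol_add (α β : MultiIdx d) (ξ : EuclideanSpace ℝ (Fin d)) :
    fourierSymbol (α + β) ξ = fourierSymbol α ξ * fourierSymbol β ξ := by
  simp [fourierSymbol, pow_add, Finset.prod_mul_distrib]

theorem fourierSymbol_single (i : Fin d) (k : ℕ) (ξ : EuclideanSpace ℝ (Fin d)) :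
    fourierSymbol (Pi.single i k) ξ = (2 * Real.pi * Complex.I * (ξ i : ℂ)) ^ k := by
  unfold fourierSymbol
  rw [Finset.prod_eq_single i]
  · simp
  · intro j _ hj; simp [hj]
  · simp

/-- Each of the |α| factors is purely imaginary. This is the source of all signs in the integrations
by parts. -/
theorem conj_fourierSymbol (α : MultiIdx d) (ξ : EuclideanSpace ℝ (Fin d)) :
    (starRingEnd ℂ) (fourierSymbol α ξ) = (-1) ^ (∑ i, α i) * fourierSymbol α ξ := by
  unfold fourierSymbol
  rw [map_prod, ← Finset.prod_pow_eq_pow_sum, ← Finset.prod_mul_distrib]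
  refine Finset.prod_congr rfl fun i _ => ?_
  rw [← mul_pow]
  simp [Complex.conj_ofNat]

theorem fourier_slice_dirDeriv {φ : SpaceTime d → Cvec n} (h : IsBump φ) (t : ℝ) (i : Fin d)
    (ξ : EuclideanSpace ℝ (Fin d)) :
    𝓕 ((h.dir i).sliceS t) ξ =
      (2 * Real.pi * Complex.I * (ξ i : ℂ)) • 𝓕 (h.sliceS t) ξ := by
  have h1 : (h.dir i).sliceS t =
      LineDeriv.lineDerivOp (EuclideanSpace.single i (1 : ℝ)) (h.sliceS t) := by
    ext1 x
    rw [SchwartzMap.lineDerivOp_apply_eq_fderiv]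
    have hd : HasFDerivAt φ (fderiv ℝ φ (t, x)) (t, x) :=
      ((h.1.differentiable (by simp)) (t, x)).hasFDerivAt
    have h2 : HasFDerivAt (fun y : EuclideanSpace ℝ (Fin d) => (t, y))
        ((0 : EuclideanSpace ℝ (Fin d) →L[ℝ] ℝ).prod (ContinuousLinearMap.id ℝ _)) x :=
      (hasFDerivAt_const t x).prodMk (hasFDerivAt_id x)
    have h3 := (hd.comp x h2).fderiv
    have h4 : (⇑(h.sliceS t)) = (φ ∘ fun y : EuclideanSpace ℝ (Fin d) => (t, y)) := rfl
    rw [h4, h3]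
    rfl
  rw [h1, SchwartzMap.fourier_lineDerivOp_eq]
  have : (inner ℝ · (EuclideanSpace.single i (1 : ℝ)) :
      EuclideanSpace ℝ (Fin d) → ℝ).HasTemperateGrowth :=
    ((innerSL ℝ).flip (EuclideanSpace.single i (1 : ℝ))).hasTemperateGrowth
  rw [smul_apply, SchwartzMap.smulLeftCLM_apply_apply this]
  rw [mul_smul _ (ξ i : ℂ)]
  simp [EuclideanSpace.inner_single_right]

theorem fourier_slice_multiDeriv {φ : SpaceTime d → Cvec n} (h : IsBump φ) (t : ℝ)
    (α : MultiIdx d) (ξ : EuclideanSpace ℝ (Fin d)) :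
    𝓕 ((h.multi α).sliceS t) ξ = fourierSymbol α ξ • 𝓕 (h.sliceS t) ξ := by
  induction α using MultiIdx.induction_add_single generalizing φ with
  | h0 =>
    have : ((h.multi 0).sliceS t) = h.sliceS t := by
      ext1 x; simp [IsBump.sliceS_apply]
    rw [this]
    simp [fourierSymbol]
  | hs α i ih =>
    have : ((h.multi (α + Pi.single i 1)).sliceS t) =
        (((h.dir i).multi α).sliceS t) := by
      ext1 x; simp only [IsBump.sliceS_apply, multiDeriv_add_single h.1]
    rw [this, ih (h.dir i), fourier_slice_dirDeriv h, smul_smul, fourierSymbol_add, fourierSymbol_single,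
      pow_one]

/-- Plancherel's theorem on space slices. -/
theorem integral_slice_inner {φ ψ : SpaceTime d → Cvec n} (hφ : IsBump φ) (hψ : IsBump ψ)
    (M : Cvec n →L[ℂ] Cvec n) (α β : MultiIdx d) (t : ℝ) :
    ∫ x, ⟪multiDeriv α φ (t, x), M (multiDeriv β ψ (t, x))⟫_ℂ =
      ∫ ξ, (-1) ^ (∑ i, α i) * fourierSymbol (α + β) ξ *
        ⟪𝓕 (hφ.sliceS t) ξ, M (𝓕 (hψ.sliceS t) ξ)⟫_ℂ := by
  let B : Cvec n →L⋆[ℂ] Cvec n →L[ℂ] ℂ :=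
    ((ContinuousLinearMap.compL ℂ (Cvec n) (Cvec n) ℂ).flip M).comp (innerSL ℂ)
  have hB : ∀ x y, B x y = ⟪x, M y⟫_ℂ := fun x y => rfl
  have := SchwartzMap.integral_sesq_fourier_fourier ((hφ.multi α).sliceS t)
    ((hψ.multi β).sliceS t) B
  simp only [hB] at this
  rw [show (∫ x, ⟪multiDeriv α φ (t, x), M (multiDeriv β ψ (t, x))⟫_ℂ) =
    ∫ x, ⟪(hφ.multi α).sliceS t x, M ((hψ.multi β).sliceS t x)⟫_ℂ from rfl, ← this]
  congr 1
  funext ξ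
  rw [fourier_slice_multiDeriv hφ, fourier_slice_multiDeriv hψ, inner_smul_left, map_smul,
    inner_smul_right, conj_fourierSymbol, fourierSymbol_add]
  ring

theorem integral_slice_norm_sq {φ : SpaceTime d → Cvec n} (hφ : IsBump φ) (α : MultiIdx d) (t : ℝ) :
    ∫ x, ‖multiDeriv α φ (t, x)‖ ^ 2 =
      ∫ ξ, ‖fourierSymbol α ξ‖ ^ 2 * ‖𝓕 (hφ.sliceS t) ξ‖ ^ 2 := by
  have := SchwartzMap.integral_norm_sq_fourier ((hφ.multi α).sliceS t)
  rw [show (∫ x, ‖multiDeriv α φ (t, x)‖ ^ 2) =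
    ∫ x, ‖(hφ.multi α).sliceS t x‖ ^ 2 from rfl, ← this]
  congr 1
  funext ξ
  rw [fourier_slice_multiDeriv hφ, norm_smul, mul_pow]

theorem integrable_slice_symbol_norm_sq {φ : SpaceTime d → Cvec n} (hφ : IsBump φ)
    (α : MultiIdx d) (t : ℝ) :
    Integrable fun ξ => ‖fourierSymbol α ξ‖ ^ 2 * ‖𝓕 (hφ.sliceS t) ξ‖ ^ 2 := by
  have h := SchwartzMap.memLp (𝓕 ((hφ.multi α).sliceS t)) 2 volume
  have := h.integrable_norm_pow (by norm_num)
  simpa [fourier_slice_multiDeriv hφ, norm_smul, mul_pow] using this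

theorem integrable_slice_symbol_inner {φ ψ : SpaceTime d → Cvec n} (hφ : IsBump φ)
    (hψ : IsBump ψ) (M : Cvec n →L[ℂ] Cvec n) (α β : MultiIdx d) (t : ℝ) :
    Integrable fun ξ => (-1) ^ (∑ i, α i) * fourierSymbol (α + β) ξ *
        ⟪𝓕 (hφ.sliceS t) ξ, M (𝓕 (hψ.sliceS t) ξ)⟫_ℂ := by
  have h1 := SchwartzMap.memLp (𝓕 ((hφ.multi α).sliceS t)) 2 volume
  have h2 := SchwartzMap.memLp (𝓕 ((hψ.multi β).sliceS t)) 2 volume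
  have h3 := integrable_inner_of_memLp_two h1 (M.comp_memLp' h2)
  refine h3.congr (Eventually.of_forall fun ξ => ?_)
  simp only [Function.comp_apply]
  rw [fourier_slice_multiDeriv hφ, fourier_slice_multiDeriv hψ, inner_smul_left, map_smul,
    inner_smul_right, conj_fourierSymbol, fourierSymbol_add]
  ring

end SliceFourier

/-! ### L₂ limits of smooth jets: integration by parts, symbol inequalities, Gårding. -/

section LimitJets

open scoped FourierTransform InnerProductSpace

variable {d n : ℕ}

/-- The space `L₂` of vector-valued functions on the whole space-time. -/
abbrev L2X (d n : ℕ) : Type := Lp (Cvec n) 2 (volume : Measure (SpaceTime d))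

theorem IsBump.memLp {φ : SpaceTime d → Cvec n} (h : IsBump φ) (p : ℝ≥0∞) :
    MemLp φ p volume :=
  h.1.continuous.memLp_of_hasCompactSupport h.2

/-- The `L₂` class of `D^α φ` for a smooth compactly supported `φ`. -/
noncomputable def IsBump.jet {φ : SpaceTime d → Cvec n} (h : IsBump φ) (α : MultiIdx d) :
    L2X d n :=
  ((h.multi α).memLp 2).toLp _

/-- Bounded measurable operator-valued functions of time. -/
structure BddCoeff (M : ℝ → Cvec n →L[ℂ] Cvec n) : Prop where
  meas : AEStronglyMeasurable M volume
  bdd : ∃ C : ℝ, ∀ t, ‖M t‖ ≤ C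

theorem BddCoeff.memLp {M : ℝ → Cvec n →L[ℂ] Cvec n} (hM : BddCoeff M) :
    MemLp (fun p : SpaceTime d => M p.1) ∞ volume := by
  obtain ⟨C, hC⟩ := hM.bdd
  exact memLp_top_of_bound (AEStronglyMeasurable.comp_fst hM.meas) C
    (Eventually.of_forall fun p => hC p.1)

/-- Multiplication by a bounded measurable function of time, as an operator on `L₂`. -/
noncomputable def BddCoeff.op (d : ℕ) {M : ℝ → Cvec n →L[ℂ] Cvec n} (hM : BddCoeff M) :
    L2X d n →L[ℂ] L2X d n :=
  (ContinuousLinearMap.id ℂ (Cvec n →L[ℂ] Cvec n)).holderL volume ∞ 2 2 (hM.memLp.toLp _)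

theorem BddCoeff.coeFn_op {M : ℝ → Cvec n →L[ℂ] Cvec n} (hM : BddCoeff M) (f : L2X d n) :
    hM.op d f =ᵐ[volume] fun p => M p.1 (f p) := by
  have h1 := ContinuousLinearMap.coeFn_holder (r := 2)
    (ContinuousLinearMap.id ℂ (Cvec n →L[ℂ] Cvec n)) (hM.memLp (d := d).toLp _) f
  have h2 := (hM.memLp (d := d)).coeFn_toLp
  have h3 : hM.op d f = (ContinuousLinearMap.id ℂ (Cvec n →L[ℂ] Cvec n)).holder 2
    ((hM.memLp (d := d)).toLp _) f := rfl
  rw [h3]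
  filter_upwards [h1, h2] with p h1 h2
  rw [h1, h2]
  rfl

theorem BddCoeff.norm_op_le {M : ℝ → Cvec n →L[ℂ] Cvec n} (hM : BddCoeff M) {C : ℝ}
    (hC : ∀ t, ‖M t‖ ≤ C) (f : L2X d n) : ‖hM.op d f‖ ≤ C * ‖f‖ := by
  apply Lp.norm_le_mul_norm_of_ae_le_mul
  filter_upwards [hM.coeFn_op f] with p hp
  rw [hp]
  exact ((M p.1).le_opNorm _).trans (by gcongr; exact hC _)

theorem IsBump.inner_op_jet {φ ψ : SpaceTime d → Cvec n} (hφ : IsBump φ) (hψ : IsBump ψ)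
    {M : ℝ → Cvec n →L[ℂ] Cvec n} (hM : BddCoeff M) (α β : MultiIdx d) :
    Integrable (fun p : SpaceTime d =>
      ⟪multiDeriv α φ p, M p.1 (multiDeriv β ψ p)⟫_ℂ) volume ∧
    ⟪hφ.jet α, hM.op d (hψ.jet β)⟫_ℂ =
      ∫ p : SpaceTime d, ⟪multiDeriv α φ p, M p.1 (multiDeriv β ψ p)⟫_ℂ := by
  have h : (fun p => ⟪hφ.jet α p, hM.op d (hψ.jet β) p⟫_ℂ) =ᵐ[volume] fun p : SpaceTime d =>
      ⟪multiDeriv α φ p, M p.1 (multiDeriv β ψ p)⟫_ℂ := by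
    filter_upwards [hM.coeFn_op (hψ.jet β), ((hφ.multi α).memLp 2).coeFn_toLp,
      ((hψ.multi β).memLp 2).coeFn_toLp] with p h1 h2 h3
    rw [h1, IsBump.jet, IsBump.jet, h2, h3]
  exact ⟨(L2.integrable_inner (𝕜 := ℂ) _ _).congr h, by rw [L2.inner_def, integral_congr_ae h]⟩

theorem IsBump.inner_op_jet_slice {φ ψ : SpaceTime d → Cvec n} (hφ : IsBump φ) (hψ : IsBump ψ)
    {M : ℝ → Cvec n →L[ℂ] Cvec n} (hM : BddCoeff M) (α β : MultiIdx d) :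
    Integrable (fun t : ℝ => ∫ x, ⟪multiDeriv α φ (t, x), M t (multiDeriv β ψ (t, x))⟫_ℂ) ∧
    ⟪hφ.jet α, hM.op d (hψ.jet β)⟫_ℂ =
      ∫ t, ∫ x, ⟪multiDeriv α φ (t, x), M t (multiDeriv β ψ (t, x))⟫_ℂ := by
  obtain ⟨h1, h2⟩ := hφ.inner_op_jet hψ hM α β
  exact ⟨h1.integral_prod_left, by rw [h2]; exact integral_prod _ h1⟩

theorem IsBump.norm_jet_sq {φ : SpaceTime d → Cvec n} (hφ : IsBump φ) (α : MultiIdx d) :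
    Integrable (fun t : ℝ => ∫ x, ‖multiDeriv α φ (t, x)‖ ^ 2) ∧
    ‖hφ.jet α‖ ^ 2 = ∫ t, ∫ x, ‖multiDeriv α φ (t, x)‖ ^ 2 := by
  have h1 : Integrable (fun p : SpaceTime d => ‖multiDeriv α φ p‖ ^ 2) volume :=
    ((hφ.multi α).memLp 2).integrable_norm_pow (by norm_num)
  refine ⟨h1.integral_prod_left, ?_⟩
  rw [← integral_prod (fun p : SpaceTime d => ‖multiDeriv α φ p‖ ^ 2) h1]
  have h2 := L2.inner_def (𝕜 := ℂ) (hφ.jet α) (hφ.jet α)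
  rw [inner_self_eq_norm_sq_to_K] at h2
  have h3 : (∫ p, ⟪hφ.jet α p, hφ.jet α p⟫_ℂ) =
      ((∫ p : SpaceTime d, ‖multiDeriv α φ p‖ ^ 2 : ℝ) : ℂ) := by
    rw [← integral_complex_ofReal]
    refine integral_congr_ae ?_
    filter_upwards [((hφ.multi α).memLp 2).coeFn_toLp] with p h
    rw [IsBump.jet, h, inner_self_eq_norm_sq_to_K]
    simp
  rw [h3] at h2
  change _ = ∫ p : SpaceTime d, ‖multiDeriv α φ p‖ ^ 2
  apply Complex.ofReal_injective
  rw [Complex.ofReal_pow]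
  exact h2

/-- Families of `L₂` functions which are limits of the derivatives of smooth compactly supported
functions. -/
def IsLimitJet (I : Set (MultiIdx d)) (a : MultiIdx d → L2X d n) : Prop :=
  ∃ φ : ℕ → SpaceTime d → Cvec n, ∃ h : ∀ k, IsBump (φ k),
    ∀ α ∈ I, Tendsto (fun k => (h k).jet α) atTop (𝓝 (a α))

theorem IsLimitJet.of_approx {I : Set (MultiIdx d)} {a : MultiIdx d → L2X d n}
    (h : ∀ ε > 0, ∃ φ : SpaceTime d → Cvec n, ∃ hφ : IsBump φ, ∀ α ∈ I, dist (hφ.jet α) (a α) < ε) :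
    IsLimitJet I a := by
  choose φ hφ hl using fun k : ℕ => h (1 / ((k : ℝ) + 1)) Nat.one_div_pos_of_nat
  refine ⟨φ, hφ, fun α hα => ?_⟩
  rw [tendsto_iff_dist_tendsto_zero]
  exact squeeze_zero (fun _ => dist_nonneg) (fun k => (hl k α hα).le)
    tendsto_one_div_add_atTop_nhds_zero_nat

/-- Integration by parts in space, in the presence of a coefficient depending on time only. -/
theorem IsLimitJet.inner_op_eq {I J : Set (MultiIdx d)} {a b : MultiIdx d → L2X d n}
    (ha : IsLimitJet I a) (hb : IsLimitJet J b) {M : ℝ → Cvec n →L[ℂ] Cvec n} (hM : BddCoeff M)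
    {α β γ κ : MultiIdx d} (hα : α ∈ I) (hγ : γ ∈ I) (hβ : β ∈ J) (hκ : κ ∈ J)
    (he : α + β = γ + κ) :
    ⟪a α, hM.op d (b β)⟫_ℂ = (-1) ^ (∑ i, α i + ∑ i, γ i) * ⟪a γ, hM.op d (b κ)⟫_ℂ := by
  obtain ⟨φ, hφ, hlφ⟩ := ha
  obtain ⟨ψ, hψ, hlψ⟩ := hb
  have h1 := (hlφ α hα).inner (𝕜 := ℂ) (((hM.op d).continuous.tendsto _).comp (hlψ β hβ))
  have h2 := ((hlφ γ hγ).inner (𝕜 := ℂ)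
    (((hM.op d).continuous.tendsto _).comp (hlψ κ hκ))).const_mul
      ((-1 : ℂ) ^ (∑ i, α i + ∑ i, γ i))
  refine tendsto_nhds_unique h1 (h2.congr fun k => ?_)
  simp only [Function.comp_apply]
  rw [((hφ k).inner_op_jet_slice (hψ k) hM α β).2, ((hφ k).inner_op_jet_slice (hψ k) hM γ κ).2,
    ← integral_const_mul]
  congr 1
  funext t
  -- After Plancherel only the sum of the two indices enters the symbol, so both sides agree up to
  -- the sign from conjugation; the coefficient is constant in x and stays inside.
  rw [integral_slice_inner (hφ k) (hψ k), integral_slice_inner (hφ k) (hψ k), he,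
    ← integral_const_mul]
  congr 1
  funext ξ
  have : (-1 : ℂ) ^ (∑ i, γ i) * (-1) ^ (∑ i, γ i) = 1 := by
    rw [← mul_pow]; simp
  rw [pow_add]
  linear_combination ((-1) ^ ∑ i, α i) * fourierSymbol (γ + κ) ξ *
    ⟪(𝓕 ((hφ k).sliceS t)) ξ, (M t) ((𝓕 ((hψ k).sliceS t)) ξ)⟫_ℂ * this

/-- A pointwise inequality between Fourier symbols gives an inequality between `L₂` norms. -/
theorem IsLimitJet.norm_sq_le {I : Set (MultiIdx d)} {a : MultiIdx d → L2X d n}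
    (ha : IsLimitJet I a) {α : MultiIdx d} (hα : α ∈ I) {ι : Type*} (s : Finset ι)
    (c : ι → ℝ) (β : ι → MultiIdx d) (hβ : ∀ i ∈ s, β i ∈ I)
    (h : ∀ ξ, ‖fourierSymbol α ξ‖ ^ 2 ≤ ∑ i ∈ s, c i * ‖fourierSymbol (β i) ξ‖ ^ 2) :
    ‖a α‖ ^ 2 ≤ ∑ i ∈ s, c i * ‖a (β i)‖ ^ 2 := by
  obtain ⟨φ, hφ, hl⟩ := ha
  refine le_of_tendsto_of_tendsto' ((hl α hα).norm.pow 2)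
    (tendsto_finsetSum s fun i hi => ((hl (β i) (hβ i hi)).norm.pow 2).const_mul (c i))
    fun k => ?_
  have hR : ∑ i ∈ s, c i * ‖(hφ k).jet (β i)‖ ^ 2 =
      ∫ t, ∑ i ∈ s, c i * ∫ x, ‖multiDeriv (β i) (φ k) (t, x)‖ ^ 2 := by
    rw [integral_finsetSum _ fun i _ => ((hφ k).norm_jet_sq _).1.const_mul _]
    refine Finset.sum_congr rfl fun i _ => ?_
    rw [integral_const_mul, ((hφ k).norm_jet_sq _).2]
  rw [((hφ k).norm_jet_sq α).2, hR]
  refine integral_mono ((hφ k).norm_jet_sq α).1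
    (integrable_finsetSum _ fun i _ => ((hφ k).norm_jet_sq _).1.const_mul _) fun t => ?_
  simp only [integral_slice_norm_sq (hφ k), ← integral_const_mul]
  rw [← integral_finsetSum _ fun i _ => (integrable_slice_symbol_norm_sq (hφ k) _ t).const_mul _]
  refine integral_mono (integrable_slice_symbol_norm_sq (hφ k) _ t)
    (integrable_finsetSum _ fun i _ =>
      (integrable_slice_symbol_norm_sq (hφ k) _ t).const_mul _) fun ξ => ?_
  have := mul_le_mul_of_nonneg_right (h ξ) (sq_nonneg ‖𝓕 ((hφ k).sliceS t) ξ‖)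
  rw [Finset.sum_mul] at this
  simpa only [mul_assoc] using this

theorem mem_multiIdx {k : ℕ} {α : MultiIdx d} : α ∈ multiIdx d k ↔ ∑ i, α i = k := by
  simp [multiIdx]

theorem fourierSymbol_eq (α : MultiIdx d) (ξ : EuclideanSpace ℝ (Fin d)) :
    fourierSymbol α ξ = (2 * Real.pi * Complex.I) ^ (∑ i, α i) * ((∏ i, ξ i ^ α i : ℝ) : ℂ) := by
  unfold fourierSymbol
  rw [← Finset.prod_pow_eq_pow_sum]
  push_cast
  rw [← Finset.prod_mul_distrib]
  simp_rw [mul_pow]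

/-- Gårding's inequality for coefficients depending on time only. -/
theorem IsLimitJet.garding {I : Set (MultiIdx d)} {a : MultiIdx d → L2X d n}
    (ha : IsLimitJet I a) {m : ℕ} {δ : ℝ} (hδ : 0 ≤ δ)
    {M : MultiIdx d → MultiIdx d → ℝ → Cvec n →L[ℂ] Cvec n} (hM : ∀ α β, BddCoeff (M α β))
    (hLH : ∀ (t : ℝ) (ξ : EuclideanSpace ℝ (Fin d)) (θ : Cvec n),
      δ * ‖ξ‖ ^ (2 * m) * ‖θ‖ ^ 2 ≤ (∑ α ∈ multiIdx d m, ∑ β ∈ multiIdx d m,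
        (((∏ i, ξ i ^ α i) * (∏ i, ξ i ^ β i) : ℝ) : ℂ) * ⟪θ, M α β t θ⟫_ℂ).re)
    (hI : ∀ α ∈ multiIdx d m, α ∈ I) (j : Fin d) :
    δ * ‖a (Pi.single j m)‖ ^ 2 ≤
      (∑ α ∈ multiIdx d m, ∑ β ∈ multiIdx d m, ⟪a α, (hM α β).op d (a β)⟫_ℂ).re := by
  obtain ⟨φ, hφ, hl⟩ := ha
  have hj : (Pi.single j m : MultiIdx d) ∈ multiIdx d m := by simp [mem_multiIdx]
  refine le_of_tendsto_of_tendsto' (((hl _ (hI _ hj)).norm.pow 2).const_mul δ)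
    ((Complex.continuous_re.tendsto _).comp (tendsto_finsetSum _ fun α hα =>
      tendsto_finsetSum _ fun β hβ => (hl α (hI α hα)).inner (𝕜 := ℂ)
        ((((hM α β).op d).continuous.tendsto _).comp (hl β (hI β hβ))))) fun k => ?_
  simp only [Function.comp_apply]
  have hint : Integrable (fun t : ℝ => ∑ α ∈ multiIdx d m, ∑ β ∈ multiIdx d m,
      ∫ x, ⟪multiDeriv α (φ k) (t, x), M α β t (multiDeriv β (φ k) (t, x))⟫_ℂ) :=
    integrable_finsetSum _ fun α _ => integrable_finsetSum _ fun β _ =>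
      ((hφ k).inner_op_jet_slice (hφ k) (hM α β) α β).1
  have hR : ∑ α ∈ multiIdx d m, ∑ β ∈ multiIdx d m,
      ⟪(hφ k).jet α, (hM α β).op d ((hφ k).jet β)⟫_ℂ =
      ∫ t, ∑ α ∈ multiIdx d m, ∑ β ∈ multiIdx d m,
        ∫ x, ⟪multiDeriv α (φ k) (t, x), M α β t (multiDeriv β (φ k) (t, x))⟫_ℂ := by
    rw [integral_finsetSum _ fun α _ => integrable_finsetSum _ fun β _ =>
      ((hφ k).inner_op_jet_slice (hφ k) (hM α β) α β).1]
    refine Finset.sum_congr rfl fun α _ => ?_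
    rw [integral_finsetSum _ fun β _ => ((hφ k).inner_op_jet_slice (hφ k) (hM α β) α β).1]
    exact Finset.sum_congr rfl fun β _ => ((hφ k).inner_op_jet_slice (hφ k) (hM α β) α β).2
  have hre : ∀ {X : Type} [MeasurableSpace X] (μ : Measure X) (f : X → ℂ), Integrable f μ →
      (∫ x, f x ∂μ).re = ∫ x, (f x).re ∂μ := fun μ f hf => (integral_re hf).symm
  rw [((hφ k).norm_jet_sq _).2, hR, hre _ _ hint, ← integral_const_mul]
  refine integral_mono (((hφ k).norm_jet_sq _).1.const_mul _) hint.re fun t => ?_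
  have hi : ∀ α β, Integrable fun ξ => (-1) ^ (∑ i, α i) * fourierSymbol (α + β) ξ *
      ⟪𝓕 ((hφ k).sliceS t) ξ, M α β t (𝓕 ((hφ k).sliceS t) ξ)⟫_ℂ := fun α β =>
    integrable_slice_symbol_inner (hφ k) (hφ k) (M α β t) α β t
  simp only [integral_slice_norm_sq (hφ k), integral_slice_inner (hφ k) (hφ k)]
  simp_rw [← integral_finsetSum _ fun β _ => hi _ β]
  rw [← integral_finsetSum _ fun α _ => integrable_finsetSum _ fun β _ => hi α β,
    hre _ _ (integrable_finsetSum _ fun α _ => integrable_finsetSum _ fun β _ => hi α β),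
    ← integral_const_mul]
  refine integral_mono ((integrable_slice_symbol_norm_sq (hφ k) _ t).const_mul _)
    (integrable_finsetSum _ fun α _ => integrable_finsetSum _ fun β _ => hi α β).re fun ξ => ?_
  set F := 𝓕 ((hφ k).sliceS t) ξ with hF
  -- The factor i^{2m} from the two symbols cancels the sign (-1)^m of the conjugation, which leaves
  -- (2π)^{2m} times the Legendre-Hadamard form at ξ.
  have hsum : ∑ α ∈ multiIdx d m, ∑ β ∈ multiIdx d m,
      (-1 : ℂ) ^ (∑ i, α i) * fourierSymbol (α + β) ξ * ⟪F, M α β t F⟫_ℂ =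
      (((2 * Real.pi) ^ (2 * m) : ℝ) : ℂ) * ∑ α ∈ multiIdx d m, ∑ β ∈ multiIdx d m,
        (((∏ i, ξ i ^ α i) * (∏ i, ξ i ^ β i) : ℝ) : ℂ) * ⟪F, M α β t F⟫_ℂ := by
    simp_rw [Finset.mul_sum]
    refine Finset.sum_congr rfl fun α hα => Finset.sum_congr rfl fun β hβ => ?_
    rw [mem_multiIdx] at hα hβ
    rw [fourierSymbol_add, fourierSymbol_eq α, fourierSymbol_eq β, hα, hβ, mul_pow _ Complex.I]
    have hI2 : (-1 : ℂ) ^ m * (Complex.I ^ m * Complex.I ^ m) = 1 := by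
      rw [← mul_pow, ← mul_pow]; simp
    push_cast
    linear_combination ((2 * (Real.pi : ℂ)) ^ (2 * m) * (∏ i, (ξ i : ℂ) ^ α i) *
      (∏ i, (ξ i : ℂ) ^ β i) * ⟪F, M α β t F⟫_ℂ) * hI2
  have h1 := mul_le_mul_of_nonneg_left (hLH t ξ F)
    (show (0 : ℝ) ≤ (2 * Real.pi) ^ (2 * m) by positivity)
  simp only [hsum, Complex.re_ofReal_mul]
  refine le_trans ?_ h1
  rw [fourierSymbol_single]
  -- The full bound contains |ξ|^{2m}; only its part |ξ_j|^{2m} is kept.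
  have h2 : |ξ j| ≤ ‖ξ‖ := by
    have := EuclideanSpace.norm_eq ξ
    simpa using PiLp.norm_apply_le ξ j
  have h3 : ‖(2 * Real.pi * Complex.I * (ξ j : ℂ)) ^ m‖ ^ 2 =
      (2 * Real.pi) ^ (2 * m) * |ξ j| ^ (2 * m) := by
    rw [norm_pow, ← pow_mul, mul_comm m 2]
    simp [abs_of_pos Real.pi_pos, mul_pow]
  rw [h3]
  have h4 := pow_le_pow_left₀ (abs_nonneg _) h2 (2 * m)
  have h5 : 0 ≤ (2 * Real.pi) ^ (2 * m) * δ * ‖F‖ ^ 2 := by positivity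
  nlinarith [mul_le_mul_of_nonneg_left h4 h5]

end LimitJets

/-! ### Mollification in L₂ of space-time. -/

section Mollify

open scoped Convolution

theorem eLpNorm_two_sq {α E : Type*} [NormedAddCommGroup E] [MeasurableSpace α]
    (μ : Measure α) (f : α → E) : eLpNorm f 2 μ ^ 2 = ∫⁻ x, ‖f x‖ₑ ^ 2 ∂μ := by
  have := eLpNorm_nnreal_pow_eq_lintegral (f := f) (μ := μ) (p := 2) (by norm_num)
  simpa using this

theorem tendsto_eLpNorm_two_zero_iff {α E ι : Type*} [NormedAddCommGroup E] [MeasurableSpace α]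
    {μ : Measure α} {f : ι → α → E} {l : Filter ι} :
    Tendsto (fun k => eLpNorm (f k) 2 μ) l (𝓝 0) ↔
      Tendsto (fun k => ∫⁻ x, ‖f k x‖ₑ ^ 2 ∂μ) l (𝓝 0) := by
  simp_rw [← eLpNorm_two_sq]
  constructor
  · intro h
    simpa using ENNReal.Tendsto.pow (n := 2) h
  · intro h
    have h2 := (ENNReal.continuous_rpow_const (y := 1 / 2)).tendsto (0 : ℝ≥0∞) |>.comp h
    simp only [Function.comp_def] at h2
    rw [ENNReal.zero_rpow_of_pos (by norm_num)] at h2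
    refine h2.congr fun k => ?_
    rw [← ENNReal.rpow_natCast, ← ENNReal.rpow_mul]
    norm_num

theorem tendsto_eLpNorm_two_of_dominated {α E : Type*} [NormedAddCommGroup E]
    [MeasurableSpace α] {μ : Measure α} {f : ℕ → α → E} {g : α → E} {C : ℝ≥0}
    (hf : ∀ k, AEStronglyMeasurable (f k) μ) (hg : MemLp g 2 μ)
    (hb : ∀ k, ∀ᵐ x ∂μ, ‖f k x‖ ≤ C * ‖g x‖)
    (hl : ∀ᵐ x ∂μ, Tendsto (fun k => f k x) atTop (𝓝 0)) :
    Tendsto (fun k => eLpNorm (f k) 2 μ) atTop (𝓝 0) := by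
  rw [tendsto_eLpNorm_two_zero_iff]
  have : ∫⁻ x, (C * ‖g x‖ₑ) ^ 2 ∂μ ≠ ⊤ := by
    simp_rw [mul_pow]
    rw [lintegral_const_mul' _ _ (by simp), ← eLpNorm_two_sq]
    exact ENNReal.mul_ne_top (by simp) (ENNReal.pow_ne_top hg.2.ne)
  have h0 : ∫⁻ _x : α, (0 : ℝ≥0∞) ∂μ = 0 := by simp
  rw [← h0]
  refine tendsto_lintegral_of_dominated_convergence' (fun x => (C * ‖g x‖ₑ) ^ 2)
    (fun k => ((hf k).enorm.pow_const 2)) (fun k => ?_) this ?_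
  · filter_upwards [hb k] with x hx
    gcongr
    rw [← ofReal_norm, ← ofReal_norm, ← ENNReal.ofReal_coe_nnreal,
      ← ENNReal.ofReal_mul (by positivity)]
    exact ENNReal.ofReal_le_ofReal hx
  · filter_upwards [hl] with x hx
    simpa using ENNReal.Tendsto.pow (n := 2) hx.enorm

variable {d n : ℕ}

instance : (volume : Measure (SpaceTime d)).IsAddHaarMeasure :=
  Measure.prod.instIsAddHaarMeasure volume volume

/-- The convolution of `f` with the kernel `η`. -/
noncomputable def mollify (η : SpaceTime d → ℝ) (f : SpaceTime d → Cvec n) :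
    SpaceTime d → Cvec n :=
  fun p => ∫ q, η (p - q) • f q

theorem mollify_eq_convolution (η : SpaceTime d → ℝ) (f : SpaceTime d → Cvec n) :
    mollify η f = f ⋆[(ContinuousLinearMap.lsmul ℝ ℝ).flip, volume] η := rfl

theorem mollify_eq_integral_comp_sub (η : SpaceTime d → ℝ) (f : SpaceTime d → Cvec n)
    (p : SpaceTime d) : mollify η f p = ∫ q, η q • f (p - q) := by
  rw [mollify_eq_convolution, convolution_eq_swap]
  rfl

theorem contDiff_mollify {η : SpaceTime d → ℝ} (hη : IsBump η) {f : SpaceTime d → Cvec n}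
    (hf : LocallyIntegrable f volume) : ContDiff ℝ ∞ (mollify η f) := by
  rw [mollify_eq_convolution]
  exact hη.2.contDiff_convolution_right _ hf hη.1

theorem dirDeriv_mollify {η : SpaceTime d → ℝ} (hη : IsBump η) {f : SpaceTime d → Cvec n}
    (hf : LocallyIntegrable f volume) (i : Fin d) :
    dirDeriv i (mollify η f) = mollify (dirDeriv i η) f := by
  funext p
  have h1 : ContDiff ℝ 1 η := hη.1.of_le (by exact_mod_cast le_top)
  have h := hη.2.hasFDerivAt_convolution_right (ContinuousLinearMap.lsmul ℝ ℝ).flip hf h1 p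
  rw [← mollify_eq_convolution] at h
  unfold dirDeriv
  rw [h.fderiv, convolution_precompR_apply _ hf (hη.2.fderiv ℝ) (h1.continuous_fderiv one_ne_zero)]
  rfl

theorem multiDeriv_mollify {η : SpaceTime d → ℝ} (hη : IsBump η) {f : SpaceTime d → Cvec n}
    (hf : LocallyIntegrable f volume) (α : MultiIdx d) :
    multiDeriv α (mollify η f) = mollify (multiDeriv α η) f := by
  induction α using MultiIdx.induction_add_single generalizing η with
  | h0 => simp
  | hs α i ih =>
    rw [multiDeriv_add_single (contDiff_mollify hη hf), dirDeriv_mollify hη hf,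
      ih (hη.dir i), multiDeriv_add_single hη.1]

/-- The function q ↦ η(p - q) is itself admissible in the definition of the weak derivative, and
reversing its argument produces the factor (-1)^{|α|} that cancels the sign there. -/
theorem multiDeriv_mollify_of_weak {η : SpaceTime d → ℝ} (hη : IsBump η) {α : MultiIdx d}
    {f g : SpaceTime d → Cvec n} (h : HasWeakDx Set.univ α f g) :
    multiDeriv α (mollify η f) = mollify η g := by
  rw [multiDeriv_mollify hη (locallyIntegrableOn_univ.1 h.1)]
  funext p
  have ht : IsTest Set.univ fun q => η (p - q) := by
    refine ⟨hη.1.comp (contDiff_const.sub contDiff_id), ?_, Set.subset_univ _⟩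
    exact hη.2.comp_homeomorph (Homeomorph.subLeft p)
  have h2 := h.integral_eq _ ht
  rw [classDx_eq_multiDeriv, multiDeriv_comp_const_sub hη.1] at h2
  simp only [Measure.restrict_univ, Pi.smul_apply, smul_assoc] at h2
  rw [integral_smul] at h2
  have h3 : ((-1 : ℝ) ^ ∑ i, α i) ≠ 0 := pow_ne_zero _ (by norm_num)
  exact smul_right_injective _ h3 h2

/-- Translation of an `L₂` function. -/
noncomputable def translateL2 (q : SpaceTime d) : L2X d n →ₗᵢ[ℂ] L2X d n :=
  Lp.compMeasurePreservingₗᵢ ℂ (fun p => p - q) (measurePreserving_sub_right volume q)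

theorem coeFn_translateL2 (q : SpaceTime d) (f : L2X d n) :
    translateL2 q f =ᵐ[volume] fun p => f (p - q) :=
  Lp.coeFn_compMeasurePreserving f (measurePreserving_sub_right volume q)

theorem continuous_translateL2 (f : L2X d n) : Continuous fun q => translateL2 q f := by
  have hc : Continuous fun q : SpaceTime d =>
      (⟨fun p => p - q, by fun_prop⟩ : C(SpaceTime d, SpaceTime d)) := by
    refine ContinuousMap.continuous_of_continuous_uncurry _ ?_
    exact (continuous_snd.sub continuous_fst)
  exact Continuous.compMeasurePreservingLp (f := fun _ => f) continuous_const hc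
    (fun q => measurePreserving_sub_right volume q) (by norm_num)

/-- Jensen's inequality for the probability measure with density η. -/
theorem enorm_integral_smul_sq_le {α E : Type*} [NormedAddCommGroup E] [NormedSpace ℝ E]
    [MeasurableSpace α] {μ : Measure α} {η : α → ℝ} (hη : Measurable η) (h0 : ∀ x, 0 ≤ η x)
    (h1 : ∫⁻ x, ENNReal.ofReal (η x) ∂μ = 1) {g : α → E} (hg : StronglyMeasurable g) :
    ‖∫ x, η x • g x ∂μ‖ₑ ^ 2 ≤ ∫⁻ x, ENNReal.ofReal (η x) * ‖g x‖ₑ ^ 2 ∂μ := by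
  have hm : Measurable fun x => ENNReal.ofReal (η x) := hη.ennreal_ofReal
  let ν := μ.withDensity fun x => ENNReal.ofReal (η x)
  have hν : IsProbabilityMeasure ν := ⟨by simp [ν, h1]⟩
  have h2 : ‖∫ x, η x • g x ∂μ‖ₑ ≤ eLpNorm g 1 ν := by
    refine (enorm_integral_le_lintegral_enorm _).trans ?_
    rw [eLpNorm_one_eq_lintegral_enorm, lintegral_withDensity_eq_lintegral_mul _ hm hg.enorm]
    refine lintegral_mono fun x => ?_
    simp [enorm_smul, Real.enorm_eq_ofReal (h0 x)]
  have h3 : eLpNorm g 1 ν ≤ eLpNorm g 2 ν :=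
    eLpNorm_le_eLpNorm_of_exponent_le (by norm_num) hg.aestronglyMeasurable
  calc ‖∫ x, η x • g x ∂μ‖ₑ ^ 2 ≤ eLpNorm g 2 ν ^ 2 := by gcongr; exact h2.trans h3
    _ = ∫⁻ x, ENNReal.ofReal (η x) * ‖g x‖ₑ ^ 2 ∂μ := by
      rw [eLpNorm_two_sq, lintegral_withDensity_eq_lintegral_mul _ hm (hg.enorm.pow_const 2)]
      rfl

/-- A mollification is an average of translates. Jensen and Tonelli bound its distance to f by the
largest displacement of f under translations from the support of the kernel. -/
theorem eLpNorm_mollify_sub_le {η : SpaceTime d → ℝ} (hη : IsBump η) (h0 : ∀ p, 0 ≤ η p)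
    (h1 : ∫ p, η p = 1) (f : L2X d n) {ε : ℝ}
    (h : ∀ q, η q ≠ 0 → ‖translateL2 q f - f‖ ≤ ε) :
    eLpNorm (fun p => mollify η f p - f p) 2 volume ≤ ENNReal.ofReal ε := by
  have hi : Integrable η volume := hη.1.continuous.integrable_of_hasCompactSupport hη.2
  have hl : ∫⁻ p, ENNReal.ofReal (η p) = 1 := by
    rw [← ofReal_integral_eq_lintegral_ofReal hi (Eventually.of_forall h0), h1]; simp
  have hf : StronglyMeasurable f := Lp.stronglyMeasurable f
  have hfl : LocallyIntegrable f volume := (Lp.memLp f).locallyIntegrable (by norm_num)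
  have hm : Measurable fun p => ENNReal.ofReal (η p) := hη.1.continuous.measurable.ennreal_ofReal
  have hpt : ∀ p, mollify η f p - f p = ∫ q, η q • (f (p - q) - f p) := by
    intro p
    rw [mollify_eq_integral_comp_sub]
    simp_rw [smul_sub]
    rw [integral_sub _ (hi.smul_const _), integral_smul_const, h1, one_smul]
    have h2 := hη.2.convolutionExists_right (ContinuousLinearMap.lsmul ℝ ℝ).flip hfl
      hη.1.continuous p
    have h3 := h2.integrable_swap
    exact h3
  have hsq : eLpNorm (fun p => mollify η f p - f p) 2 volume ^ 2 ≤ ENNReal.ofReal ε ^ 2 := by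
    rw [eLpNorm_two_sq]
    calc ∫⁻ p, ‖mollify η f p - f p‖ₑ ^ 2
        ≤ ∫⁻ p, ∫⁻ q, ENNReal.ofReal (η q) * ‖f (p - q) - f p‖ₑ ^ 2 := by
          refine lintegral_mono fun p => ?_
          rw [hpt]
          exact enorm_integral_smul_sq_le hη.1.continuous.measurable h0 hl
            ((hf.comp_measurable (measurable_const.sub measurable_id)).sub stronglyMeasurable_const)
      _ = ∫⁻ q, ∫⁻ p, ENNReal.ofReal (η q) * ‖f (p - q) - f p‖ₑ ^ 2 := by
          rw [lintegral_lintegral_swap]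
          refine Measurable.aemeasurable ?_
          refine (hm.comp measurable_snd).mul (Measurable.pow_const ?_ 2)
          exact ((hf.comp_measurable (measurable_fst.sub measurable_snd)).sub
            (hf.comp_measurable measurable_fst)).enorm
      _ ≤ ∫⁻ q, ENNReal.ofReal (η q) * ENNReal.ofReal ε ^ 2 := by
          refine lintegral_mono fun q => ?_
          rw [lintegral_const_mul' _ _ (by simp)]
          by_cases hq : η q = 0
          · simp [hq]
          gcongr
          rw [← eLpNorm_two_sq]
          have h2 : eLpNorm (fun p => f (p - q) - f p) 2 volume =
              eLpNorm (translateL2 q f - f : L2X d n) 2 volume := by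
            refine eLpNorm_congr_ae ?_
            filter_upwards [coeFn_translateL2 q f, Lp.coeFn_sub (translateL2 q f) f] with p h3 h4
            rw [h4, Pi.sub_apply, h3]
          rw [h2, ← Lp.enorm_def, ← ofReal_norm]
          gcongr
          exact h q hq
      _ = ENNReal.ofReal ε ^ 2 := by
          rw [lintegral_mul_const _ hm, hl, one_mul]
  exact le_of_not_gt fun hlt => absurd hsq (not_le.2 (by gcongr))

end Mollify

/-! ### Approximation of weak jets by smooth compactly supported functions. -/

section Density

variable {d n : ℕ}

theorem IsBump.comp_smul {ζ : SpaceTime d → ℝ} (hζ : IsBump ζ) {c : ℝ} (hc : c ≠ 0) :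
    IsBump fun p => ζ (c • p) :=
  ⟨hζ.1.comp (contDiff_const_smul c),
    hζ.2.comp_homeomorph (Homeomorph.smulOfNeZero c hc)⟩

theorem IsBump.exists_bound {F : Type*} [NormedAddCommGroup F] [NormedSpace ℝ F]
    {ζ : SpaceTime d → F} (hζ : IsBump ζ) : ∃ C : ℝ≥0, ∀ p, ‖ζ p‖ ≤ C := by
  obtain ⟨C, hC⟩ := hζ.1.continuous.bounded_above_of_compact_support hζ.2
  exact ⟨C.toNNReal, fun p => (hC p).trans (Real.le_coe_toNNReal C)⟩

theorem tendsto_cutoff_smul_fun {ζ : SpaceTime d → ℝ} (hζ : IsBump ζ) {v : SpaceTime d → Cvec n}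
    (hv : Continuous v) (hm : MemLp v 2 volume) {c : ℕ → ℝ} (hlim : Tendsto c atTop (𝓝 0)) :
    Tendsto (fun k : ℕ => eLpNorm (fun p => ζ (c k • p) • v p - ζ 0 • v p) 2 volume)
      atTop (𝓝 0) := by
  obtain ⟨C, hC⟩ := hζ.exists_bound
  have hζc : Continuous ζ := hζ.1.continuous
  refine tendsto_eLpNorm_two_of_dominated (g := v) (C := C + C) (fun k => ?_) hm (fun k => ?_) ?_
  · have : Continuous fun p => ζ (c k • p) • v p - ζ 0 • v p := by fun_prop
    exact this.aestronglyMeasurable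
  · refine Eventually.of_forall fun p => ?_
    rw [← sub_smul, norm_smul]
    gcongr
    push_cast
    exact (norm_sub_le _ _).trans (add_le_add (hC _) (hC _))
  · refine Eventually.of_forall fun p => ?_
    have h0 : Tendsto (fun k => c k • p) atTop (𝓝 0) := by simpa using hlim.smul_const p
    have h1 : Tendsto (fun k : ℕ => ζ (c k • p)) atTop (𝓝 (ζ 0)) := (hζc.tendsto 0).comp h0
    have h2 := (h1.smul_const (v p)).sub_const (ζ 0 • v p)
    rwa [sub_self] at h2

/-- Every derivative that falls on ζ(c_k p) brings out a factor c_k → 0. The limit is stated with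
ζ(0) in place of 1 so that the induction hypothesis also applies to the derivatives of ζ, whose
value at 0 is arbitrary. -/
theorem tendsto_cutoff_smul {ζ : SpaceTime d → ℝ} (hζ : IsBump ζ) {v : SpaceTime d → Cvec n}
    (hv : ContDiff ℝ ∞ v) {c : ℕ → ℝ} (hc : ∀ k, c k ≠ 0) (hlim : Tendsto c atTop (𝓝 0))
    {α : MultiIdx d} (hm : ∀ β ≤ α, MemLp (multiDeriv β v) 2 volume) :
    Tendsto (fun k : ℕ => eLpNorm (fun p => multiDeriv α
      (fun p => ζ (c k • p) • v p) p - ζ 0 • multiDeriv α v p) 2 volume)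
      atTop (𝓝 0) := by
  induction α using MultiIdx.induction_add_single generalizing ζ v with
  | h0 =>
    simp only [multiDeriv_zero]
    exact tendsto_cutoff_smul_fun hζ hv.continuous (by simpa using hm 0 le_rfl) hlim
  | hs α i ih =>
    have hA := ih hζ (contDiff_dirDeriv hv i) (fun β hβ => by
      rw [← multiDeriv_add_single hv]
      exact hm _ (add_le_add_left hβ _))
    have hle : α ≤ α + Pi.single i 1 := le_self_add
    have hB := ih (hζ.dir i) hv (fun β hβ => hm β (hβ.trans hle))
    have hD : MemLp (fun p => dirDeriv i ζ 0 • multiDeriv α v p) 2 volume :=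
      (hm α hle).const_smul (dirDeriv i ζ 0)
    have hbound : Tendsto (fun k : ℕ => ‖c k‖ₑ * (eLpNorm (fun p => multiDeriv α
        (fun p => dirDeriv i ζ (c k • p) • v p) p -
          dirDeriv i ζ 0 • multiDeriv α v p) 2 volume +
        eLpNorm (fun p => dirDeriv i ζ 0 • multiDeriv α v p) 2 volume)) atTop (𝓝 0) := by
      have h1 := ENNReal.Tendsto.mul hlim.enorm (Or.inr (by simpa using hD.2.ne))
        (hB.add_const (eLpNorm (fun p => dirDeriv i ζ 0 • multiDeriv α v p) 2 volume)) (Or.inr (by simp))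
      simpa using h1
    have hsum := hA.add hbound
    rw [add_zero] at hsum
    refine tendsto_of_tendsto_of_tendsto_of_le_of_le tendsto_const_nhds hsum (fun _ => zero_le)
      fun k => ?_
    have hζk := hζ.comp_smul (hc k)
    have hζ'k := (hζ.dir i).comp_smul (hc k)
    have hcv : ContDiff ℝ ∞ fun p => ζ (c k • p) • v p := hζk.1.smul hv
    have hcA : ContDiff ℝ ∞ fun p => ζ (c k • p) • dirDeriv i v p :=
      hζk.1.smul (contDiff_dirDeriv hv i)
    have hcB : ContDiff ℝ ∞ fun p => dirDeriv i ζ (c k • p) • v p :=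
      hζ'k.1.smul hv
    have he : multiDeriv (α + Pi.single i 1) (fun p => ζ (c k • p) • v p) =
        multiDeriv α (fun p => ζ (c k • p) • dirDeriv i v p) +
        c k •
          multiDeriv α (fun p => dirDeriv i ζ (c k • p) • v p) := by
      rw [multiDeriv_add_single hcv, dirDeriv_smul hζk.1 hv, dirDeriv_comp_smul,
        ← multiDeriv_const_smul hcB, ← multiDeriv_add_fun hcA
          (show ContDiff ℝ ∞ (c k • fun p => dirDeriv i ζ (c k • p) • v p) from
            contDiff_const.smul hcB)]
      congr 2
      funext p
      simp [mul_smul]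
    have hcont : ∀ {f : SpaceTime d → Cvec n}, ContDiff ℝ ∞ f →
        AEStronglyMeasurable (multiDeriv α f) volume := fun h =>
      (contDiff_multiDeriv h α).continuous.aestronglyMeasurable
    have he2 : (fun p => multiDeriv (α + Pi.single i 1)
          (fun p => ζ (c k • p) • v p) p - ζ 0 • multiDeriv (α + Pi.single i 1) v p) =
        (fun p => multiDeriv α (fun p => ζ (c k • p) • dirDeriv i v p) p -
          ζ 0 • multiDeriv α (dirDeriv i v) p) + c k •
          ((fun p => multiDeriv α (fun p => dirDeriv i ζ (c k • p) • v p) p -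
            dirDeriv i ζ 0 • multiDeriv α v p) + fun p => dirDeriv i ζ 0 • multiDeriv α v p) := by
      funext p
      rw [he, multiDeriv_add_single hv]
      simp only [Pi.add_apply, Pi.smul_apply]
      rw [sub_add_cancel]
      abel
    rw [he2]
    have m1 : AEStronglyMeasurable (fun p => multiDeriv α (fun p => ζ (c k • p) • dirDeriv i v p) p -
        ζ 0 • multiDeriv α (dirDeriv i v) p) volume := (hcont hcA).sub ((hcont (contDiff_dirDeriv hv i)).const_smul (ζ 0))
    have m2 : AEStronglyMeasurable (fun p => multiDeriv α
        (fun p => dirDeriv i ζ (c k • p) • v p) p - dirDeriv i ζ 0 • multiDeriv α v p) volume :=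
      (hcont hcB).sub ((hcont hv).const_smul (dirDeriv i ζ 0))
    refine (eLpNorm_add_le m1 ((m2.add hD.1).const_smul _) (by norm_num)).trans ?_
    gcongr
    rw [eLpNorm_const_smul]
    gcongr
    exact eLpNorm_add_le m2 hD.1 (by norm_num)

theorem exists_cutoff (d : ℕ) : ∃ ζ : SpaceTime d → ℝ, IsBump ζ ∧ ζ 0 = 1 := by
  let f : ContDiffBump (0 : SpaceTime d) := ⟨1, 2, by norm_num, by norm_num⟩
  exact ⟨f, ⟨f.contDiff, f.hasCompactSupport⟩,
    f.one_of_mem_closedBall (by simp [f])⟩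

theorem exists_mollifier (d : ℕ) {r : ℝ} (hr : 0 < r) : ∃ η : SpaceTime d → ℝ, IsBump η ∧
    (∀ p, 0 ≤ η p) ∧ ∫ p, η p = 1 ∧ ∀ p, η p ≠ 0 → ‖p‖ < r := by
  let f : ContDiffBump (0 : SpaceTime d) := ⟨r / 2, r, by positivity, by linarith⟩
  refine ⟨f.normed volume, ⟨f.contDiff_normed, f.hasCompactSupport_normed⟩, f.nonneg_normed,
    f.integral_normed, fun p hp => ?_⟩
  have : p ∈ Function.support (f.normed volume) := hp
  rw [f.support_normed_eq] at this
  simpa [f] using this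

/-- Cutting off at infinity suffices. The index set has to be a lower set because the Leibniz rule
involves all derivatives below the given one. -/
theorem isLimitJet_of_smooth {I : Set (MultiIdx d)} (hI : IsLowerSet I)
    {v : SpaceTime d → Cvec n} (hv : ContDiff ℝ ∞ v) {a : MultiIdx d → L2X d n}
    (ha : ∀ α ∈ I, multiDeriv α v =ᵐ[volume] a α) : IsLimitJet I a := by
  obtain ⟨ζ, hζ, hζ0⟩ := exists_cutoff d
  have hm : ∀ α ∈ I, MemLp (multiDeriv α v) 2 volume := fun α hα =>
    (memLp_congr_ae (ha α hα)).2 (Lp.memLp _)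
  let c : ℕ → ℝ := fun k => 1 / ((k : ℝ) + 1)
  have hc : ∀ k, c k ≠ 0 := fun k => by positivity
  have hlim : Tendsto c atTop (𝓝 0) := tendsto_one_div_add_atTop_nhds_zero_nat
  have hb : ∀ k : ℕ, IsBump fun p => ζ (c k • p) • v p := fun k =>
    ⟨(hζ.comp_smul (hc k)).1.smul hv, (hζ.comp_smul (hc k)).2.smul_right⟩
  refine ⟨fun k p => ζ (c k • p) • v p, hb, fun α hα => ?_⟩
  rw [Lp.tendsto_Lp_iff_tendsto_eLpNorm']
  refine (tendsto_cutoff_smul hζ hv hc hlim fun β hβ => hm β (hI hβ hα)).congr fun k => ?_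
  refine eLpNorm_congr_ae ?_
  filter_upwards [((hb k).multi α |>.memLp 2).coeFn_toLp, ha α hα] with p h1 h2
  rw [Pi.sub_apply, IsBump.jet, h1, ← h2, hζ0, one_smul]

/-- Families of weak derivatives in `L₂` are limits of derivatives of smooth compactly supported
functions. -/
theorem isLimitJet_of_hasWeakDx {I : Set (MultiIdx d)} (hI : IsLowerSet I) (hfin : I.Finite) {a : MultiIdx d → L2X d n}
    (ha : ∀ α ∈ I, HasWeakDx Set.univ α (a 0) (a α)) : IsLimitJet I a := by
  refine IsLimitJet.of_approx fun ε hε => ?_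
  -- Finiteness of the index set gives one mollification radius for all derivatives; half of ε is
  -- spent here and half on the cutoff.
  have h1 : ∀ᶠ q in 𝓝 (0 : SpaceTime d), ∀ α ∈ I, ‖translateL2 q (a α) - a α‖ < ε / 2 := by
    rw [hfin.eventually_all]
    intro α hα
    have h2 : Tendsto (fun q => ‖translateL2 q (a α) - a α‖) (𝓝 0) (𝓝 0) := by
      have h3 := ((continuous_translateL2 (a α)).sub (continuous_const (y := a α))).norm.tendsto
        (0 : SpaceTime d)
      have h4 : translateL2 (0 : SpaceTime d) (a α) = a α := by
        refine Lp.ext ?_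
        filter_upwards [coeFn_translateL2 0 (a α)] with p hp
        simpa using hp
      simpa [h4] using h3
    exact h2.eventually (gt_mem_nhds (by positivity))
  obtain ⟨r, hr, hr2⟩ := Metric.eventually_nhds_iff.1 h1
  obtain ⟨η, hη, hη0, hη1, hηs⟩ := exists_mollifier d hr
  have hle : ∀ α ∈ I, eLpNorm (fun p => mollify η (a α) p - a α p) 2 volume ≤
      ENNReal.ofReal (ε / 2) := fun α hα =>
    eLpNorm_mollify_sub_le hη hη0 hη1 (a α) fun q hq =>
      (hr2 (by simpa using hηs q hq) α hα).le
  have hloc : LocallyIntegrable (a 0) volume := (Lp.memLp (a 0)).locallyIntegrable (by norm_num)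
  have hsm := contDiff_mollify hη hloc
  have hmem : ∀ α ∈ I, MemLp (multiDeriv α (mollify η (a 0))) 2 volume := by
    intro α hα
    have h2 : MemLp (fun p => mollify η (a α) p - a α p) 2 volume := by
      refine ⟨?_, (hle α hα).trans_lt (by simp)⟩
      exact (contDiff_mollify hη ((Lp.memLp (a α)).locallyIntegrable
        (by norm_num))).continuous.aestronglyMeasurable.sub (Lp.memLp (a α)).1
    rw [multiDeriv_mollify_of_weak hη (ha α hα)]
    simpa [Pi.add_def] using h2.add (Lp.memLp (a α))
  classical
  let b : MultiIdx d → L2X d n := fun α =>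
    if h : α ∈ I then (hmem α h).toLp _ else 0
  have hb : ∀ α ∈ I, multiDeriv α (mollify η (a 0)) =ᵐ[volume] b α := by
    intro α hα
    simp only [b, dif_pos hα]
    exact (hmem α hα).coeFn_toLp.symm
  obtain ⟨φ, hφ, hl⟩ := isLimitJet_of_smooth hI hsm hb
  have h5 : ∀ᶠ k in atTop, ∀ α ∈ I, dist ((hφ k).jet α) (b α) < ε / 2 := by
    rw [hfin.eventually_all]
    exact fun α hα => (Metric.tendsto_nhds.1 (hl α hα)) _ (by positivity)
  obtain ⟨k, hk⟩ := h5.exists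
  refine ⟨φ k, hφ k, fun α hα => ?_⟩
  have h6 : dist (b α) (a α) ≤ ε / 2 := by
    rw [Lp.dist_def]
    refine ENNReal.toReal_le_of_le_ofReal (by positivity) ?_
    refine le_trans (le_of_eq (eLpNorm_congr_ae ?_)) (hle α hα)
    filter_upwards [hb α hα] with p hp
    rw [Pi.sub_apply, ← hp, multiDeriv_mollify_of_weak hη (ha α hα)]
  calc dist ((hφ k).jet α) (a α) ≤ dist ((hφ k).jet α) (b α) + dist (b α) (a α) :=
        dist_triangle _ _ _
    _ < ε := by linarith [hk α hα]

end Density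

/-! ### Composition of weak derivatives. -/

section WeakDerivatives

variable {d n : ℕ} {Ω : Set (SpaceTime d)} {u v w : SpaceTime d → Cvec n}

/-- Test functions are stable under D^β, so D^βψ can be inserted in the definition of D^αu. The
chosen representatives of the derivatives of u, unrelated by definition, thereby become successive
derivatives of one another. -/
theorem HasWeakDx.of_add {α β : MultiIdx d} (h1 : HasWeakDx Ω α u v)
    (h2 : HasWeakDx Ω (α + β) u w) : HasWeakDx Ω β v w := by
  refine ⟨h1.2, h2.2, fun ψ hψ => ?_⟩
  have e1 := h1.integral_eq _ (hψ.multi β)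
  have e2 := h2.integral_eq _ hψ
  rw [classDx_eq_multiDeriv] at e1 e2 ⊢
  rw [multiDeriv_add hψ.1, e1] at e2
  simp only [Pi.add_apply, Finset.sum_add_distrib, pow_add, mul_smul] at e2
  exact smul_right_injective _ (pow_ne_zero _ (by norm_num : (-1 : ℝ) ≠ 0)) e2

theorem HasWeakDx.trans {α β : MultiIdx d} (h1 : HasWeakDx Ω α u v)
    (h2 : HasWeakDx Ω β v w) : HasWeakDx Ω (α + β) u w := by
  refine ⟨h1.1, h2.2, fun ψ hψ => ?_⟩
  have e1 := h1.integral_eq _ (hψ.multi β)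
  have e2 := h2.integral_eq _ hψ
  rw [classDx_eq_multiDeriv] at e1 e2 ⊢
  rw [multiDeriv_add hψ.1, e1, e2]
  simp only [Pi.add_apply, Finset.sum_add_distrib, pow_add, mul_smul]

theorem HasWeakDx.refl (hu : LocallyIntegrableOn u Ω) : HasWeakDx Ω 0 u u :=
  ⟨hu, hu, fun ψ _ => by simp [classDx_eq_multiDeriv]⟩

theorem HasWeakDx.integral_dirDeriv {i : Fin d} (h : HasWeakDx Ω (Pi.single i 1) u v)
    {ψ : SpaceTime d → ℝ} (hψ : IsTest Ω ψ) :
    ∫ p in Ω, dirDeriv i ψ p • u p = -∫ p in Ω, ψ p • v p := by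
  have := h.integral_eq ψ hψ
  rw [classDx_eq_multiDeriv, multiDeriv_single_one hψ.1] at this
  simpa using this

end WeakDerivatives

/-! ### Smooth cutoffs near the boundary of the cylinder. -/

section Cutoff

theorem deriv_smoothTransition_nonneg (x : ℝ) : 0 ≤ deriv Real.smoothTransition x :=
  Real.smoothTransition.monotone.deriv_nonneg

theorem deriv_smoothTransition_eq_zero {x : ℝ} (hx : x ∉ Set.Icc (0 : ℝ) 1) :
    deriv Real.smoothTransition x = 0 := by
  rw [Set.mem_Icc, not_and_or, not_le, not_le] at hx
  rcases hx with hx | hx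
  · have : Real.smoothTransition =ᶠ[𝓝 x] fun _ => 0 := by
      filter_upwards [gt_mem_nhds hx] with y hy
      exact Real.smoothTransition.zero_of_nonpos (le_of_lt hy)
    rw [this.deriv_eq]; simp
  · have : Real.smoothTransition =ᶠ[𝓝 x] fun _ => 1 := by
      filter_upwards [lt_mem_nhds hx] with y hy
      exact Real.smoothTransition.one_of_one_le (le_of_lt hy)
    rw [this.deriv_eq]; simp

theorem continuous_deriv_smoothTransition : Continuous (deriv Real.smoothTransition) :=
  (Real.smoothTransition.contDiff (n := 1)).continuous_deriv le_rfl

theorem exists_deriv_smoothTransition_le :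
    ∃ C : ℝ, 0 ≤ C ∧ ∀ x, deriv Real.smoothTransition x ≤ C := by
  obtain ⟨C, hC⟩ := (isCompact_Icc (a := (0 : ℝ)) (b := 1)).exists_bound_of_continuousOn
    continuous_deriv_smoothTransition.continuousOn
  have hC0 : 0 ≤ C := (norm_nonneg _).trans (hC 0 (by simp))
  refine ⟨C, hC0, fun x => ?_⟩
  by_cases hx : x ∈ Set.Icc (0 : ℝ) 1
  · exact (le_abs_self _).trans (hC x hx)
  · rw [deriv_smoothTransition_eq_zero hx]; exact hC0

variable {d : ℕ}

/-- A smooth function of `x₁` which vanishes near `x₁ ≤ 0` and tends to `1` for `x₁ > 0`. -/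
noncomputable def spaceCutoff (d : ℕ) [NeZero d] (k : ℕ) (p : SpaceTime d) : ℝ :=
  Real.smoothTransition (k * p.2 0 - 1)

/-- A smooth function of `t` which vanishes near `t ≥ T` and tends to `1` for `t < T`. -/
noncomputable def timeCutoff (d : ℕ) (T : WithTop ℝ) (k : ℕ) (p : SpaceTime d) : ℝ :=
  match T with
  | ⊤ => 1
  | (T : ℝ) => Real.smoothTransition (k * (T - p.1) - 1)

theorem contDiff_coord (i : Fin d) : ContDiff ℝ ∞ fun p : SpaceTime d => p.2 i :=
  (EuclideanSpace.proj (𝕜 := ℝ) i : EuclideanSpace ℝ (Fin d) →L[ℝ] ℝ).contDiff.comp contDiff_snd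

theorem contDiff_spaceCutoff [NeZero d] (k : ℕ) : ContDiff ℝ ∞ (spaceCutoff d k) :=
  Real.smoothTransition.contDiff.comp ((contDiff_const.mul (contDiff_coord 0)).sub contDiff_const)

theorem contDiff_timeCutoff (T : WithTop ℝ) (k : ℕ) : ContDiff ℝ ∞ (timeCutoff d T k) := by
  cases T with
  | top => exact contDiff_const
  | coe T =>
    exact Real.smoothTransition.contDiff.comp
      ((contDiff_const.mul (contDiff_const.sub contDiff_fst)).sub contDiff_const)

theorem smoothTransition_mem (x : ℝ) : ‖Real.smoothTransition x‖ ≤ 1 := by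
  rw [Real.norm_of_nonneg (Real.smoothTransition.nonneg x)]
  exact Real.smoothTransition.le_one x

theorem timeCutoff_nonneg (T : WithTop ℝ) (k : ℕ) (p : SpaceTime d) : 0 ≤ timeCutoff d T k p := by
  cases T with
  | top => exact zero_le_one
  | coe T => exact Real.smoothTransition.nonneg _

theorem timeCutoff_le_one (T : WithTop ℝ) (k : ℕ) (p : SpaceTime d) : timeCutoff d T k p ≤ 1 := by
  cases T with
  | top => exact le_rfl
  | coe T => exact Real.smoothTransition.le_one _

theorem tendsto_smoothTransition_mul {a : ℝ} (ha : 0 < a) :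
    Tendsto (fun k : ℕ => Real.smoothTransition (k * a - 1)) atTop (𝓝 1) := by
  have h : Tendsto (fun k : ℕ => (k : ℝ) * a - 1) atTop atTop :=
    tendsto_atTop_add_const_right _ _ (tendsto_natCast_atTop_atTop.atTop_mul_const ha)
  refine tendsto_const_nhds.congr' ?_
  filter_upwards [h.eventually_ge_atTop 1] with k hk
  rw [Real.smoothTransition.one_of_one_le hk]

/-- This is why no condition at t = T enters: space derivatives do not see the cutoff in time. -/
theorem dirDeriv_timeCutoff (T : WithTop ℝ) (k : ℕ) (i : Fin d) :
    dirDeriv i (timeCutoff d T k) = 0 := by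
  funext p
  have hd := ((contDiff_timeCutoff (d := d) T k).differentiable (by simp) p).hasFDerivAt
  have hl := hd.hasLineDerivAt (spaceDir i)
  have h2 : HasLineDerivAt ℝ (timeCutoff d T k) 0 p (spaceDir i) := by
    have : (fun t : ℝ => timeCutoff d T k (p + t • spaceDir i)) =
        fun _ => timeCutoff d T k p := by
      funext t
      cases T with
      | top => rfl
      | coe T => simp [timeCutoff, spaceDir]
    unfold HasLineDerivAt
    rw [this]
    exact hasDerivAt_const _ _
  exact HasDerivAt.unique hl h2

variable [NeZero d]

theorem tendsto_cutoff {T : WithTop ℝ} {p : SpaceTime d} (hp : p ∈ halfCyl d T) :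
    Tendsto (fun k : ℕ => timeCutoff d T k p * spaceCutoff d k p) atTop (𝓝 1) := by
  have h2 : Tendsto (fun k : ℕ => spaceCutoff d k p) atTop (𝓝 1) :=
    tendsto_smoothTransition_mul hp.2
  have h1 : Tendsto (fun k : ℕ => timeCutoff d T k p) atTop (𝓝 1) := by
    cases T with
    | top => exact tendsto_const_nhds
    | coe T =>
      have : p.1 < T := WithTop.coe_lt_coe.1 hp.1
      exact tendsto_smoothTransition_mul (sub_pos.2 this)
  simpa using h1.mul h2

theorem dirDeriv_spaceCutoff (k : ℕ) (i : Fin d) (p : SpaceTime d) :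
    dirDeriv i (spaceCutoff d k) p =
      if i = 0 then k * deriv Real.smoothTransition (k * p.2 0 - 1) else 0 := by
  have hd := ((contDiff_spaceCutoff (d := d) k).differentiable (by simp) p).hasFDerivAt
  have hl := hd.hasLineDerivAt (spaceDir i)
  refine HasDerivAt.unique hl ?_
  have hcoord : ∀ t : ℝ, (p + t • spaceDir i).2 0 = p.2 0 + t * (if i = 0 then 1 else 0) := by
    intro t
    simp [spaceDir, eq_comm]
  unfold spaceCutoff
  simp_rw [hcoord]
  have h1 : HasDerivAt (fun t : ℝ => (k : ℝ) * (p.2 0 + t * (if i = 0 then 1 else 0)) - 1)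
      (k * (if i = 0 then 1 else 0)) 0 := by
    have := ((((hasDerivAt_id (0 : ℝ)).mul_const (if i = 0 then (1 : ℝ) else 0)).const_add
      (p.2 0)).const_mul (k : ℝ)).sub_const 1
    simpa using this
  have h3 : DifferentiableAt ℝ Real.smoothTransition
      ((k : ℝ) * (p.2 0 + 0 * (if i = 0 then 1 else 0)) - 1) :=
    (Real.smoothTransition.contDiff (n := 1)).differentiable one_ne_zero _
  have h4 := h3.hasDerivAt.comp (0 : ℝ) h1
  convert! h4 using 1
  split_ifs <;> simp [mul_comm]

theorem isOpen_halfCyl (T : WithTop ℝ) : IsOpen (halfCyl d T) := by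
  have h2 : IsOpen {p : SpaceTime d | 0 < p.2 0} :=
    isOpen_lt continuous_const (contDiff_coord 0).continuous
  cases T with
  | top =>
    convert h2 using 1
    ext p
    simp [halfCyl]
  | coe T =>
    convert (isOpen_lt continuous_fst continuous_const : IsOpen {p : SpaceTime d | p.1 < T}).inter h2
      using 1
    ext p
    simp [halfCyl]

theorem measurableSet_halfCyl (T : WithTop ℝ) : MeasurableSet (halfCyl d T) :=
  (isOpen_halfCyl T).measurableSet

theorem isTest_cutoff_mul (T : WithTop ℝ) (k : ℕ) {ψ : SpaceTime d → ℝ} (hψ : IsBump ψ) :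
    IsTest (halfCyl d T) fun p => (timeCutoff d T k p * spaceCutoff d k p) * ψ p := by
  refine ⟨((contDiff_timeCutoff T k).mul (contDiff_spaceCutoff k)).mul hψ.1, hψ.2.mul_left, ?_⟩
  have hs : IsClosed {p : SpaceTime d | 1 ≤ k * p.2 0} :=
    isClosed_le continuous_const (continuous_const.mul (contDiff_coord 0).continuous)
  -- This includes k = 0, where the premise is impossible and the cut-off function vanishes
  -- identically.
  have hpos : ∀ x : ℝ, 1 ≤ k * x → 0 < x := by
    intro x hx
    by_contra! h
    have : (k : ℝ) * x ≤ 0 := mul_nonpos_of_nonneg_of_nonpos (Nat.cast_nonneg k) h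
    linarith
  have hS : Function.support (fun p => (timeCutoff d T k p * spaceCutoff d k p) * ψ p) ⊆
      {p : SpaceTime d | 1 ≤ k * p.2 0} := by
    intro p hp
    by_contra h
    apply hp
    simp only [Set.mem_ofPred_eq, not_le] at h
    simp [spaceCutoff, Real.smoothTransition.zero_of_nonpos (by linarith : (k : ℝ) * p.2 0 - 1 ≤ 0)]
  have h1 := closure_minimal hS hs
  cases T with
  | top =>
    intro p hp
    exact ⟨WithTop.coe_lt_top _, hpos _ (h1 hp)⟩
  | coe T =>
    have ht : IsClosed {p : SpaceTime d | 1 ≤ k * (T - p.1)} :=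
      isClosed_le continuous_const (by fun_prop)
    have hT : Function.support
        (fun p => (timeCutoff d (T : WithTop ℝ) k p * spaceCutoff d k p) * ψ p) ⊆
        {p : SpaceTime d | 1 ≤ k * (T - p.1)} := by
      intro p hp
      by_contra h
      apply hp
      simp only [Set.mem_ofPred_eq, not_le] at h
      simp [timeCutoff,
        Real.smoothTransition.zero_of_nonpos (by linarith : (k : ℝ) * (T - p.1) - 1 ≤ 0)]
    intro p hp
    exact ⟨WithTop.coe_lt_coe.2 (sub_pos.1 (hpos _ (closure_minimal hT ht hp))), hpos _ (h1 hp)⟩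

end Cutoff

/-! ### Weak derivatives tested with functions that do not vanish near the boundary. -/

section BoundaryTests

variable {d n : ℕ} {T : WithTop ℝ} {v w : SpaceTime d → Cvec n}

theorem IsBump.integrable_smul {φ : SpaceTime d → ℝ} (hφ : IsBump φ) {μ : Measure (SpaceTime d)}
    [IsFiniteMeasureOnCompacts μ] (hv : MemLp v 2 μ) : Integrable (fun p => φ p • v p) μ := by
  have : MemLp φ 2 μ := hφ.1.continuous.memLp_of_hasCompactSupport hφ.2
  exact memLp_one_iff_integrable.1 (hv.smul this)

variable [NeZero d]

/-- Passage to the limit in the cut-off test functions. -/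
theorem integral_dirDeriv_of_tendsto {i : Fin d} (hv : MemLp v 2 (volume.restrict (halfCyl d T)))
    (hw : MemLp w 2 (volume.restrict (halfCyl d T)))
    (h : HasWeakDx (halfCyl d T) (Pi.single i 1) v w) {ψ : SpaceTime d → ℝ} (hψ : IsBump ψ)
    (hR : Tendsto (fun k : ℕ => ∫ p in halfCyl d T,
      (timeCutoff d T k p * dirDeriv i (spaceCutoff d k) p * ψ p) • v p) atTop (𝓝 0)) :
    ∫ p in halfCyl d T, dirDeriv i ψ p • v p = -∫ p in halfCyl d T, ψ p • w p := by
  have hlim : ∀ {φ : SpaceTime d → ℝ} {f : SpaceTime d → Cvec n}, IsBump φ →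
      MemLp f 2 (volume.restrict (halfCyl d T)) →
      Tendsto (fun k : ℕ => ∫ p in halfCyl d T,
        ((timeCutoff d T k p * spaceCutoff d k p) * φ p) • f p) atTop
        (𝓝 (∫ p in halfCyl d T, φ p • f p)) := by
    intro φ f hφ hf
    refine tendsto_integral_of_dominated_convergence (fun p => ‖φ p • f p‖) (fun k => ?_)
      (hφ.integrable_smul hf).norm (fun k => ?_) ?_
    · exact ((((contDiff_timeCutoff T k).mul
        (contDiff_spaceCutoff k)).mul hφ.1).continuous.aestronglyMeasurable).smul hf.1
    · refine Eventually.of_forall fun p => ?_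
      rw [mul_smul, norm_smul]
      refine mul_le_of_le_one_left (norm_nonneg _) ?_
      rw [norm_mul, Real.norm_of_nonneg (timeCutoff_nonneg T k p)]
      exact mul_le_one₀ (timeCutoff_le_one T k p) (norm_nonneg _) (smoothTransition_mem _)
    · filter_upwards [ae_restrict_mem (measurableSet_halfCyl T)] with p hp
      have := ((tendsto_cutoff hp).mul_const (φ p)).smul_const (f p)
      simpa using this
  have h1 := hlim (hψ.dir i) hv
  have h2 := (hlim hψ hw).neg
  refine tendsto_nhds_unique h1 ?_
  have h3 := h2.sub hR
  rw [sub_zero] at h3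
  refine h3.congr fun k => ?_
  have ht := isTest_cutoff_mul T k hψ
  have he := h.integral_dirDeriv ht
  have hder : dirDeriv i (fun p => (timeCutoff d T k p * spaceCutoff d k p) * ψ p) =
      (fun p => (timeCutoff d T k p * spaceCutoff d k p) * dirDeriv i ψ p) +
        fun p => timeCutoff d T k p * dirDeriv i (spaceCutoff d k) p * ψ p := by
    have e1 := dirDeriv_smul (((contDiff_timeCutoff T k).mul (contDiff_spaceCutoff (d := d) k))) hψ.1 i
    have e2 := dirDeriv_smul (contDiff_timeCutoff T k) (contDiff_spaceCutoff (d := d) k) i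
    simp only [smul_eq_mul] at e1 e2
    rw [e1, e2, dirDeriv_timeCutoff]
    funext p
    simp
  have hb1 : IsBump fun p => (timeCutoff d T k p * spaceCutoff d k p) * dirDeriv i ψ p :=
    (isTest_cutoff_mul T k (hψ.dir i)).isBump
  have hb2 : IsBump fun p => timeCutoff d T k p * dirDeriv i (spaceCutoff d k) p * ψ p :=
    ⟨((contDiff_timeCutoff T k).mul (contDiff_dirDeriv (contDiff_spaceCutoff k) i)).mul hψ.1,
      hψ.2.mul_left⟩
  rw [hder] at he
  simp only [Pi.add_apply, add_smul] at he
  rw [integral_add (hb1.integrable_smul hv) (hb2.integrable_smul hv)] at he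
  rw [← he]
  abel

/-- The boundary cutoff depends on x₁ only, so the error term is identically zero and no trace is
needed. -/
theorem integral_dirDeriv_tangential {i : Fin d} (hi : i ≠ 0)
    (hv : MemLp v 2 (volume.restrict (halfCyl d T)))
    (hw : MemLp w 2 (volume.restrict (halfCyl d T)))
    (h : HasWeakDx (halfCyl d T) (Pi.single i 1) v w) {ψ : SpaceTime d → ℝ} (hψ : IsBump ψ) :
    ∫ p in halfCyl d T, dirDeriv i ψ p • v p = -∫ p in halfCyl d T, ψ p • w p := by
  refine integral_dirDeriv_of_tendsto hv hw h hψ ?_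
  simp [dirDeriv_spaceCutoff, hi]

/-- On the layer 1 ≤ k x₁ ≤ 2 the derivative of the cutoff is O(k) while |ψ| ≤ L x₁ = O(1/k). The
product is bounded uniformly in k and tends to zero pointwise, so dominated convergence applies
without any trace condition on v. -/
theorem integral_dirDeriv_of_eq_zero (hv : MemLp v 2 (volume.restrict (halfCyl d T)))
    (hw : MemLp w 2 (volume.restrict (halfCyl d T)))
    (h : HasWeakDx (halfCyl d T) (Pi.single 0 1) v w) {ψ : SpaceTime d → ℝ} (hψ : IsBump ψ)
    (h0 : ∀ p : SpaceTime d, p.2 0 = 0 → ψ p = 0) :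
    ∫ p in halfCyl d T, dirDeriv 0 ψ p • v p = -∫ p in halfCyl d T, ψ p • w p := by
  refine integral_dirDeriv_of_tendsto hv hw h hψ ?_
  obtain ⟨C, hC0, hC⟩ := exists_deriv_smoothTransition_le
  obtain ⟨L, hL⟩ := hψ.1.lipschitzWith_of_hasCompactSupport hψ.2 (by simp)
  have hψL : ∀ p : SpaceTime d, |ψ p| ≤ L * |p.2 0| := by
    intro p
    have h1 := hL.dist_le_mul p (p - p.2 0 • spaceDir 0)
    have h2 : ψ (p - p.2 0 • spaceDir 0) = 0 := h0 _ (by simp [spaceDir])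
    rw [h2, Real.dist_eq, sub_zero, dist_eq_norm, sub_sub_cancel, norm_smul] at h1
    simpa [spaceDir, Prod.norm_def] using h1
  have hder : ∀ (k : ℕ) (p : SpaceTime d), dirDeriv 0 (spaceCutoff d k) p =
      k * deriv Real.smoothTransition (k * p.2 0 - 1) := fun k p => by
    simp [dirDeriv_spaceCutoff]
  have hbd : ∀ (k : ℕ) (p : SpaceTime d),
      |dirDeriv 0 (spaceCutoff d k) p * ψ p| ≤ 2 * C * L := by
    intro k p
    rw [hder]
    by_cases hx : (k * p.2 0 - 1) ∈ Set.Icc (0 : ℝ) 1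
    · rw [abs_mul, abs_mul, abs_of_nonneg (deriv_smoothTransition_nonneg _), Nat.abs_cast]
      have h1 : 0 ≤ p.2 0 := by
        by_contra! hneg
        have : (k : ℝ) * p.2 0 ≤ 0 := mul_nonpos_of_nonneg_of_nonpos (Nat.cast_nonneg k) hneg.le
        linarith [hx.1]
      have h2 := hψL p
      rw [abs_of_nonneg h1] at h2
      calc (k : ℝ) * deriv Real.smoothTransition (k * p.2 0 - 1) * |ψ p|
          ≤ k * C * (L * p.2 0) := by
            gcongr
            exact hC _
        _ = (k * p.2 0) * (C * L) := by ring
        _ ≤ 2 * (C * L) := by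
            gcongr
            linarith [hx.2]
        _ = 2 * C * L := by ring
    · rw [deriv_smoothTransition_eq_zero hx]
      simp
      positivity
  have hK : IsCompact (tsupport ψ) := hψ.2
  have hvint : Integrable ((tsupport ψ).indicator fun p => 2 * C * L * ‖v p‖)
      (volume.restrict (halfCyl d T)) := by
    rw [integrable_indicator_iff (isClosed_tsupport ψ).measurableSet]
    exact ((hv.locallyIntegrable (by norm_num)).integrableOn_isCompact hK).norm.const_mul _
  rw [← integral_zero (SpaceTime d) (Cvec n)]
  refine tendsto_integral_of_dominated_convergence _ (fun k => ?_) hvint (fun k => ?_) ?_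
  · exact ((((contDiff_timeCutoff T k).mul (contDiff_dirDeriv (contDiff_spaceCutoff k) 0)).mul
      hψ.1).continuous.aestronglyMeasurable).smul hv.1
  · refine Eventually.of_forall fun p => ?_
    by_cases hp : p ∈ tsupport ψ
    · rw [Set.indicator_of_mem hp, norm_smul, mul_assoc, norm_mul,
        Real.norm_of_nonneg (timeCutoff_nonneg T k p)]
      refine mul_le_mul_of_nonneg_right ?_ (norm_nonneg _)
      exact (mul_le_of_le_one_left (norm_nonneg _) (timeCutoff_le_one T k p)).trans
        (show ‖dirDeriv 0 (spaceCutoff d k) p * ψ p‖ ≤ 2 * C * L from hbd k p)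
    · rw [image_eq_zero_of_notMem_tsupport hp, Set.indicator_of_notMem hp]
      simp
  · filter_upwards [ae_restrict_mem (measurableSet_halfCyl T)] with p hp
    have h1 : Tendsto (fun k : ℕ => (k : ℝ) * p.2 0 - 1) atTop atTop :=
      tendsto_atTop_add_const_right _ _ (tendsto_natCast_atTop_atTop.atTop_mul_const hp.2)
    refine tendsto_const_nhds.congr' ?_
    filter_upwards [h1.eventually_gt_atTop 1] with k hk
    rw [hder, deriv_smoothTransition_eq_zero (fun hx => absurd hx.2 (not_le.2 hk))]
    simp

/-- The derivative of the cutoff is at most C k and lives in a layer of width comparable to 1/k, so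
the integral is controlled by the mean of |v|² over that layer. -/
theorem tendsto_integral_cutoff_norm_sq (hv : MemLp v 2 (volume.restrict (halfCyl d T)))
    (htr : HasZeroTrace T v) :
    Tendsto (fun k : ℕ => ∫ p in halfCyl d T, dirDeriv 0 (spaceCutoff d k) p * ‖v p‖ ^ 2)
      atTop (𝓝 0) := by
  obtain ⟨C, hC0, hC⟩ := exists_deriv_smoothTransition_le
  have hder : ∀ (k : ℕ) (p : SpaceTime d), dirDeriv 0 (spaceCutoff d k) p =
      k * deriv Real.smoothTransition (k * p.2 0 - 1) := fun k p => by
    simp [dirDeriv_spaceCutoff]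
  have hnn : ∀ (k : ℕ) (p : SpaceTime d), 0 ≤ dirDeriv 0 (spaceCutoff d k) p := fun k p => by
    rw [hder]; exact mul_nonneg (Nat.cast_nonneg k) (deriv_smoothTransition_nonneg _)
  have hmeas : ∀ k : ℕ, AEStronglyMeasurable
      (fun p => dirDeriv 0 (spaceCutoff d k) p * ‖v p‖ ^ 2) (volume.restrict (halfCyl d T)) :=
    fun k => ((contDiff_dirDeriv (contDiff_spaceCutoff k) 0).continuous.aestronglyMeasurable).mul
      (hv.1.norm.pow 2)
  -- The derivative of the cutoff may live on the closed layer up to x₁ = 2/k; the value 3/k leaves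
  -- room for the strict inequality in the trace condition.
  have hseq : Tendsto (fun k : ℕ => 3 / (k : ℝ)) atTop (𝓝[>] 0) := by
    refine tendsto_nhdsWithin_iff.2 ⟨tendsto_const_div_atTop_nhds_zero_nat 3, ?_⟩
    filter_upwards [eventually_gt_atTop 0] with k hk
    have : (0 : ℝ) < k := Nat.cast_pos.2 hk
    exact div_pos (by norm_num) this
  have hlim := ENNReal.Tendsto.const_mul (a := ENNReal.ofReal (3 * C)) (htr.comp hseq)
    (Or.inr ENNReal.ofReal_ne_top)
  rw [mul_zero] at hlim
  have key : ∀ᶠ k : ℕ in atTop,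
      ∫⁻ p in halfCyl d T, ENNReal.ofReal (dirDeriv 0 (spaceCutoff d k) p * ‖v p‖ ^ 2) ≤
      ENNReal.ofReal (3 * C) * ((∫⁻ p in {p ∈ halfCyl d T | p.2 0 < 3 / (k : ℝ)}, ‖v p‖ₑ ^ 2) /
        ENNReal.ofReal (3 / (k : ℝ))) := by
    filter_upwards [eventually_gt_atTop 0] with k hk
    have hk' : (0 : ℝ) < k := Nat.cast_pos.2 hk
    have hSm : MeasurableSet {p : SpaceTime d | p.2 0 < 3 / (k : ℝ)} :=
      (isOpen_lt (contDiff_coord 0).continuous continuous_const).measurableSet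
    calc ∫⁻ p in halfCyl d T, ENNReal.ofReal (dirDeriv 0 (spaceCutoff d k) p * ‖v p‖ ^ 2)
        ≤ ∫⁻ p in halfCyl d T, {p : SpaceTime d | p.2 0 < 3 / (k : ℝ)}.indicator
            (fun p => ENNReal.ofReal (k * C) * ‖v p‖ₑ ^ 2) p := by
          refine lintegral_mono fun p => ?_
          by_cases hp : p.2 0 < 3 / (k : ℝ)
          · rw [Set.indicator_of_mem (show p ∈ {p : SpaceTime d | p.2 0 < 3 / (k : ℝ)} from hp),
              ENNReal.ofReal_mul (hnn k p), ENNReal.ofReal_pow (norm_nonneg _), ofReal_norm]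
            gcongr
            rw [hder]
            gcongr
            exact hC _
          · rw [hder, deriv_smoothTransition_eq_zero]
            · simp
            · intro hx
              have h1 := hx.2
              rw [not_lt, div_le_iff₀ hk'] at hp
              linarith
      _ = ENNReal.ofReal (k * C) *
          ∫⁻ p in {p ∈ halfCyl d T | p.2 0 < 3 / (k : ℝ)}, ‖v p‖ₑ ^ 2 := by
          rw [lintegral_indicator hSm, Measure.restrict_restrict hSm,
            lintegral_const_mul' _ _ ENNReal.ofReal_ne_top, Set.inter_comm]
          rfl
      _ = _ := by
          have h3 : ENNReal.ofReal (k * C) =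
              ENNReal.ofReal (3 * C) * (ENNReal.ofReal (3 / (k : ℝ)))⁻¹ := by
            rw [← ENNReal.ofReal_inv_of_pos (by positivity), ← ENNReal.ofReal_mul (by positivity)]
            congr 1
            field_simp
          rw [h3, ENNReal.div_eq_inv_mul, mul_assoc]
  have h0 : Tendsto (fun k : ℕ =>
      ∫⁻ p in halfCyl d T, ENNReal.ofReal (dirDeriv 0 (spaceCutoff d k) p * ‖v p‖ ^ 2))
      atTop (𝓝 0) :=
    tendsto_of_tendsto_of_tendsto_of_le_of_le' tendsto_const_nhds hlim
      (Eventually.of_forall fun _ => zero_le) key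
  have h1 := (ENNReal.tendsto_toReal ENNReal.zero_ne_top).comp h0
  refine h1.congr fun k => ?_
  rw [Function.comp_apply, integral_eq_lintegral_of_nonneg_ae
    (Eventually.of_forall fun p => mul_nonneg (hnn k p) (sq_nonneg _)) (hmeas k)]

/-- With ρ the boundary cutoff, Young's inequality splits the error into κ∫ρ'ψ² and κ⁻¹∫ρ'|v|². The
first integral is bounded uniformly in k and the second tends to zero by the trace condition, for
every fixed κ. -/
theorem integral_dirDeriv_of_hasZeroTrace (hv : MemLp v 2 (volume.restrict (halfCyl d T)))
    (hw : MemLp w 2 (volume.restrict (halfCyl d T)))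
    (h : HasWeakDx (halfCyl d T) (Pi.single 0 1) v w) (htr : HasZeroTrace T v)
    {ψ : SpaceTime d → ℝ} (hψ : IsBump ψ) :
    ∫ p in halfCyl d T, dirDeriv 0 ψ p • v p = -∫ p in halfCyl d T, ψ p • w p := by
  refine integral_dirDeriv_of_tendsto hv hw h hψ ?_
  have hnn : ∀ (k : ℕ) (p : SpaceTime d), 0 ≤ dirDeriv 0 (spaceCutoff d k) p := fun k p => by
    rw [dirDeriv_spaceCutoff, if_pos rfl]
    exact mul_nonneg (Nat.cast_nonneg k) (deriv_smoothTransition_nonneg _)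
  have hψ2 : IsBump fun p => ψ p ^ 2 := ⟨hψ.1.pow 2, by
    have : (fun p => ψ p ^ 2) = ψ * ψ := by funext p; simp [sq]
    rw [this]
    exact hψ.2.mul_left⟩
  -- The bound for ∫ρ'ψ²: on the whole space the derivative is moved from the cutoff, which is at
  -- most 1, to ψ².
  set B : ℝ := ∫ p, ‖dirDeriv 0 (fun p => ψ p ^ 2) p‖ with hB
  have hB0 : 0 ≤ B := integral_nonneg fun p => norm_nonneg _
  have hint : ∀ {φ : SpaceTime d → ℝ}, IsBump φ → Integrable φ volume := fun hφ =>
    hφ.1.continuous.integrable_of_hasCompactSupport hφ.2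
  have hσ : ∀ (k : ℕ) {φ : SpaceTime d → ℝ}, IsBump φ →
      IsBump fun p => spaceCutoff d k p * φ p := fun k φ hφ =>
    ⟨(contDiff_spaceCutoff k).mul hφ.1, hφ.2.mul_left⟩
  have hσ' : ∀ (k : ℕ) {φ : SpaceTime d → ℝ}, IsBump φ →
      IsBump fun p => dirDeriv 0 (spaceCutoff d k) p * φ p := fun k φ hφ =>
    ⟨(contDiff_dirDeriv (contDiff_spaceCutoff k) 0).mul hφ.1, hφ.2.mul_left⟩
  have hψint : ∀ k : ℕ, ∫ p in halfCyl d T, dirDeriv 0 (spaceCutoff d k) p * ψ p ^ 2 ≤ B := by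
    intro k
    have h1 : ∫ p in halfCyl d T, dirDeriv 0 (spaceCutoff d k) p * ψ p ^ 2 ≤
        ∫ p, dirDeriv 0 (spaceCutoff d k) p * ψ p ^ 2 :=
      setIntegral_le_integral (hint (hσ' k hψ2)) (Eventually.of_forall fun p =>
        mul_nonneg (hnn k p) (sq_nonneg _))
    refine h1.trans ?_
    have h2 := integral_mul_fderiv_eq_neg_fderiv_mul_of_integrable (μ := volume)
      (f := spaceCutoff d k) (g := fun p => ψ p ^ 2) (v := spaceDir 0) (hint (hσ' k hψ2))
      (hint (hσ k (hψ2.dir 0))) (hint (hσ k hψ2))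
      (fun p _ => (contDiff_spaceCutoff k).differentiable (by simp) p)
      (fun p _ => hψ2.1.differentiable (by simp) p)
    have h3 : ∫ p, dirDeriv 0 (spaceCutoff d k) p * ψ p ^ 2 =
        ∫ p, -(spaceCutoff d k p * dirDeriv 0 (fun p => ψ p ^ 2) p) := by
      rw [integral_neg]
      exact (neg_eq_iff_eq_neg.2 h2).symm
    rw [h3]
    refine integral_mono (hint (hσ k (hψ2.dir 0))).neg (hint (hψ2.dir 0)).norm fun p => ?_
    refine (le_abs_self _).trans ?_
    rw [abs_neg, abs_mul]
    exact mul_le_of_le_one_left (abs_nonneg _) (smoothTransition_mem _)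
  have hvint : ∀ k : ℕ, Integrable (fun p => dirDeriv 0 (spaceCutoff d k) p * ‖v p‖ ^ 2)
      (volume.restrict (halfCyl d T)) := by
    intro k
    obtain ⟨C, hC0, hC⟩ := exists_deriv_smoothTransition_le
    refine (hv.integrable_norm_pow (by norm_num : (2 : ℕ) ≠ 0)).bdd_mul (c := k * C)
      (contDiff_dirDeriv (contDiff_spaceCutoff k) 0).continuous.aestronglyMeasurable ?_
    refine Eventually.of_forall fun p => ?_
    rw [Real.norm_of_nonneg (hnn k p), dirDeriv_spaceCutoff, if_pos rfl]
    gcongr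
    exact hC _
  have hV := tendsto_integral_cutoff_norm_sq hv htr
  have hle : ∀ (κ : ℝ), 0 < κ → ∀ k : ℕ, ‖∫ p in halfCyl d T,
      (timeCutoff d T k p * dirDeriv 0 (spaceCutoff d k) p * ψ p) • v p‖ ≤ κ * B + κ⁻¹ *
        ∫ p in halfCyl d T, dirDeriv 0 (spaceCutoff d k) p * ‖v p‖ ^ 2 := by
    intro κ hκ k
    have hi1 : Integrable (fun p => κ * (dirDeriv 0 (spaceCutoff d k) p * ψ p ^ 2))
        (volume.restrict (halfCyl d T)) := (hint (hσ' k hψ2)).integrableOn.const_mul κ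
    calc ‖∫ p in halfCyl d T, (timeCutoff d T k p * dirDeriv 0 (spaceCutoff d k) p * ψ p) • v p‖
        ≤ ∫ p in halfCyl d T, (κ * (dirDeriv 0 (spaceCutoff d k) p * ψ p ^ 2) +
            κ⁻¹ * (dirDeriv 0 (spaceCutoff d k) p * ‖v p‖ ^ 2)) := by
          refine norm_integral_le_of_norm_le (hi1.add ((hvint k).const_mul _))
            (Eventually.of_forall fun p => ?_)
          rw [norm_smul, norm_mul, norm_mul, Real.norm_of_nonneg (hnn k p),
            Real.norm_of_nonneg (timeCutoff_nonneg T k p)]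
          have hyoung : ‖ψ p‖ * ‖v p‖ ≤ κ * ψ p ^ 2 + κ⁻¹ * ‖v p‖ ^ 2 := by
            have h1 : κ * ψ p ^ 2 + κ⁻¹ * ‖v p‖ ^ 2 - ‖ψ p‖ * ‖v p‖ =
                κ⁻¹ * ((κ * ‖ψ p‖ - ‖v p‖ / 2) ^ 2 + 3 / 4 * ‖v p‖ ^ 2) := by
              rw [Real.norm_eq_abs, ← sq_abs (ψ p)]
              field_simp
              ring
            have h2 : 0 ≤ κ⁻¹ * ((κ * ‖ψ p‖ - ‖v p‖ / 2) ^ 2 + 3 / 4 * ‖v p‖ ^ 2) := by positivity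
            linarith
          calc timeCutoff d T k p * dirDeriv 0 (spaceCutoff d k) p * ‖ψ p‖ * ‖v p‖
              = timeCutoff d T k p * (dirDeriv 0 (spaceCutoff d k) p * (‖ψ p‖ * ‖v p‖)) := by ring
            _ ≤ dirDeriv 0 (spaceCutoff d k) p * (‖ψ p‖ * ‖v p‖) :=
              mul_le_of_le_one_left (mul_nonneg (hnn k p) (by positivity))
                (timeCutoff_le_one T k p)
            _ ≤ dirDeriv 0 (spaceCutoff d k) p * (κ * ψ p ^ 2 + κ⁻¹ * ‖v p‖ ^ 2) :=
              mul_le_mul_of_nonneg_left hyoung (hnn k p)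
            _ = _ := by ring
      _ ≤ _ := by
          rw [integral_add hi1 ((hvint k).const_mul _), integral_const_mul, integral_const_mul]
          gcongr
          exact hψint k
  rw [tendsto_zero_iff_norm_tendsto_zero, Metric.tendsto_atTop]
  intro ε hε
  -- The choice makes κB ≤ ε/2, with B + 1 in place of B to avoid division by zero.
  have hκ : 0 < ε / (2 * (B + 1)) := by positivity
  set κ := ε / (2 * (B + 1)) with hκd
  have hev := (hV.const_mul κ⁻¹)
  rw [mul_zero] at hev
  obtain ⟨N, hN⟩ := (Metric.tendsto_atTop.1 hev) (ε / 2) (by positivity)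
  refine ⟨N, fun k hk => ?_⟩
  have h1 := hN k hk
  rw [Real.dist_eq, sub_zero] at h1
  rw [Real.dist_eq, sub_zero, abs_of_nonneg (norm_nonneg _)]
  refine (hle κ hκ k).trans_lt ?_
  have h2 : κ * B ≤ ε / 2 := by
    rw [hκd, div_mul_eq_mul_div, div_le_div_iff₀ (by positivity) (by norm_num)]
    nlinarith
  linarith [le_abs_self (κ⁻¹ * ∫ p in halfCyl d T, dirDeriv 0 (spaceCutoff d k) p * ‖v p‖ ^ 2)]

end BoundaryTests

/-! ### Jets on the half-space cylinder and their extension by zero. -/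

section WeakJets

variable {d n : ℕ}

theorem HasWeakDx.congr_univ {α : MultiIdx d} {u v u' v' : SpaceTime d → Cvec n}
    (h : HasWeakDx Set.univ α u v) (hu : u =ᵐ[volume] u') (hv : v =ᵐ[volume] v') :
    HasWeakDx Set.univ α u' v' := by
  have hloc : ∀ {f g : SpaceTime d → Cvec n}, LocallyIntegrableOn f Set.univ volume →
      f =ᵐ[volume] g → LocallyIntegrableOn g Set.univ volume := by
    intro f g hf hfg
    rw [locallyIntegrableOn_univ] at hf ⊢
    intro x
    obtain ⟨s, hs, hi⟩ := hf x
    exact ⟨s, hs, hi.congr (ae_restrict_of_ae hfg)⟩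
  refine ⟨hloc h.1 hu, hloc h.2 hv, fun φ hφ => ?_⟩
  have e := h.integral_eq φ hφ
  rw [Measure.restrict_univ] at e ⊢
  rw [← integral_congr_ae (hu.mono fun p hp => show classDx α φ p • u p = classDx α φ p • u' p by
    rw [hp]), ← integral_congr_ae (hv.mono fun p hp => show φ p • v p = φ p • v' p by rw [hp]), e]

theorem hasWeakDx_univ_of_forall {i : Fin d} {v w : SpaceTime d → Cvec n}
    (hv : MemLp v 2 volume) (hw : MemLp w 2 volume)
    (h : ∀ ψ : SpaceTime d → ℝ, IsBump ψ → ∫ p, dirDeriv i ψ p • v p = -∫ p, ψ p • w p) :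
    HasWeakDx Set.univ (Pi.single i 1) v w := by
  refine ⟨(hv.locallyIntegrable (by norm_num)).locallyIntegrableOn _,
    (hw.locallyIntegrable (by norm_num)).locallyIntegrableOn _, fun ψ hψ => ?_⟩
  rw [classDx_eq_multiDeriv, multiDeriv_single_one hψ.1, Measure.restrict_univ, h ψ hψ.isBump]
  simp

theorem sum_add_single (α : MultiIdx d) (i : Fin d) :
    ∑ j, (α + Pi.single i 1 : MultiIdx d) j = ∑ j, α j + 1 := by
  simp [Finset.sum_add_distrib]

theorem exists_add_single_of_sum_eq_succ {α : MultiIdx d} {k : ℕ} (h : ∑ i, α i = k + 1) :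
    ∃ (β : MultiIdx d) (i : Fin d), β + Pi.single i 1 = α ∧ ∑ j, β j = k := by
  obtain ⟨i, -, hi⟩ : ∃ i ∈ Finset.univ, α i ≠ 0 := by
    by_contra! h0
    rw [Finset.sum_eq_zero h0] at h
    omega
  have e : α - Pi.single i 1 + Pi.single i 1 = α := by
    funext j
    by_cases hj : j = i
    · subst hj; simp; omega
    · simp [hj]
  refine ⟨α - Pi.single i 1, i, e, ?_⟩
  rw [← e, sum_add_single] at h
  omega

variable [NeZero d]

/-- Families of iterated weak derivatives up to order `N` in the half-space cylinder, all of them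
in `L₂`. -/
structure WeakJet (N : ℕ) (T : WithTop ℝ) (U : MultiIdx d → SpaceTime d → Cvec n) : Prop where
  memLp : ∀ α : MultiIdx d, ∑ i, α i ≤ N → MemLp (U α) 2 (volume.restrict (halfCyl d T))
  step : ∀ (α : MultiIdx d) (i : Fin d), ∑ i, α i + 1 ≤ N →
    HasWeakDx (halfCyl d T) (Pi.single i 1) (U α) (U (α + Pi.single i 1))

/-- Extension by zero. -/
noncomputable def zeroExt (T : WithTop ℝ) (v : SpaceTime d → Cvec n) : SpaceTime d → Cvec n :=
  (halfCyl d T).indicator v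

theorem memLp_zeroExt_iff {T : WithTop ℝ} {v : SpaceTime d → Cvec n} :
    MemLp (zeroExt T v) 2 volume ↔ MemLp v 2 (volume.restrict (halfCyl d T)) :=
  memLp_indicator_iff_restrict (measurableSet_halfCyl T)

theorem integral_smul_zeroExt (T : WithTop ℝ) (φ : SpaceTime d → ℝ) (v : SpaceTime d → Cvec n) :
    ∫ p, φ p • zeroExt T v p = ∫ p in halfCyl d T, φ p • v p := by
  rw [← integral_indicator (measurableSet_halfCyl T)]
  congr 1
  funext p
  by_cases hp : p ∈ halfCyl d T <;> simp [zeroExt, hp]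

/-- A function whose normal derivatives of order less than `m` have zero trace has weak
derivatives in the whole space after extension by zero. -/
theorem WeakJet.hasWeakDx_zeroExt {N m : ℕ} {T : WithTop ℝ}
    {U : MultiIdx d → SpaceTime d → Cvec n} (hU : WeakJet N T U)
    (htr : ∀ j < m, HasZeroTrace T (U (Pi.single 0 j))) {α : MultiIdx d} (hα : ∑ i, α i ≤ N)
    (hα0 : α 0 ≤ m) : HasWeakDx Set.univ α (zeroExt T (U 0)) (zeroExt T (U α)) := by
  induction hk : ∑ i, α i generalizing α with
  | zero =>
    have : α = 0 := funext fun i => (Finset.sum_eq_zero_iff.mp hk) i (Finset.mem_univ i)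
    subst this
    exact .refl (((memLp_zeroExt_iff.2 (hU.memLp 0 hα)).locallyIntegrable
      (by norm_num)).locallyIntegrableOn _)
  | succ k ih =>
    have hstep : ∀ (β : MultiIdx d) (i : Fin d), β + Pi.single i 1 = α →
        (∀ ψ : SpaceTime d → ℝ, IsBump ψ →
          ∫ p in halfCyl d T, dirDeriv i ψ p • U β p = -∫ p in halfCyl d T, ψ p • U α p) →
        HasWeakDx Set.univ α (zeroExt T (U 0)) (zeroExt T (U α)) := by
      rintro β i rfl hψ
      rw [sum_add_single] at hα hk
      have h1 : β 0 ≤ m := le_trans (by simp) hα0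
      refine (ih (α := β) (by omega) h1 (by omega)).trans (hasWeakDx_univ_of_forall
        (memLp_zeroExt_iff.2 (hU.memLp β (by omega)))
        (memLp_zeroExt_iff.2 (hU.memLp _ (by rw [sum_add_single]; omega))) fun ψ hb => ?_)
      rw [integral_smul_zeroExt, integral_smul_zeroExt, hψ ψ hb]
    have hsub : ∀ i, α i ≠ 0 → α - Pi.single i 1 + Pi.single i 1 = α := by
      intro i hi
      funext j
      by_cases hj : j = i
      · subst hj; simp; omega
      · simp [hj]
    -- If α contains a tangential direction, that derivative is taken last and needs no trace.
    -- Otherwise α is a pure normal derivative, and the trace of D_1^{α₀ - 1}u is used; traces of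
    -- mixed derivatives never occur.
    by_cases htan : ∃ i, i ≠ 0 ∧ α i ≠ 0
    · obtain ⟨i, hi, hαi⟩ := htan
      obtain ⟨β, rfl⟩ : ∃ β : MultiIdx d, β + (Pi.single i 1 : MultiIdx d) = α :=
        ⟨_, hsub i hαi⟩
      rw [sum_add_single] at hα
      exact hstep β i rfl fun ψ hψ => integral_dirDeriv_tangential hi (hU.memLp β (by omega))
        (hU.memLp _ (by rw [sum_add_single]; omega)) (hU.step β i hα) hψ
    · push Not at htan
      have hα' : α = Pi.single 0 (α 0) := by
        funext j
        by_cases hj : j = 0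
        · subst hj; simp
        · simp [hj, htan j hj]
      have hpos : α 0 ≠ 0 := by
        intro h0
        rw [hα', h0] at hk
        simp at hk
      obtain ⟨j, hj⟩ := Nat.exists_eq_succ_of_ne_zero hpos
      have hβ : (Pi.single 0 j : MultiIdx d) + Pi.single 0 1 = α := by
        rw [hα', hj, ← Pi.single_add]
      rw [← hβ, sum_add_single] at hα
      refine hstep (Pi.single 0 j) 0 hβ fun ψ hψ => ?_
      have h1 := hU.step (Pi.single 0 j) 0 hα
      rw [hβ] at h1
      exact integral_dirDeriv_of_hasZeroTrace (hU.memLp _ (by omega))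
        (hU.memLp _ (by rw [← hβ, sum_add_single]; omega)) h1 (htr j (by omega)) hψ

/-- The class in `L₂` of the extension by zero. -/
noncomputable def WeakJet.toL2 {N : ℕ} {T : WithTop ℝ} {U : MultiIdx d → SpaceTime d → Cvec n}
    (hU : WeakJet N T U) (α : MultiIdx d) : L2X d n :=
  if h : ∑ i, α i ≤ N then (memLp_zeroExt_iff.2 (hU.memLp α h)).toLp _ else 0

theorem WeakJet.coeFn_toL2 {N : ℕ} {T : WithTop ℝ} {U : MultiIdx d → SpaceTime d → Cvec n}
    (hU : WeakJet N T U) {α : MultiIdx d} (h : ∑ i, α i ≤ N) :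
    hU.toL2 α =ᵐ[volume] zeroExt T (U α) := by
  rw [WeakJet.toL2, dif_pos h]
  exact MemLp.coeFn_toLp _

theorem finite_setOf_sum_le (d N : ℕ) : {α : MultiIdx d | ∑ i, α i ≤ N}.Finite := by
  refine (Set.finite_Iic (fun _ : Fin d => N)).subset fun α hα i => ?_
  exact (Finset.single_le_sum (fun j _ => Nat.zero_le (α j)) (Finset.mem_univ i)).trans hα

theorem isLowerSet_setOf_sum_le (d N : ℕ) : IsLowerSet {α : MultiIdx d | ∑ i, α i ≤ N} :=
  fun _ _ hle hα => (Finset.sum_le_sum fun i _ => hle i).trans hα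

/-- The restriction to at most m normal derivatives is essential: D_1^m u may jump across x₁ = 0. -/
theorem WeakJet.isLimitJet_toL2 {N m : ℕ} {T : WithTop ℝ}
    {U : MultiIdx d → SpaceTime d → Cvec n} (hU : WeakJet N T U)
    (htr : ∀ j < m, HasZeroTrace T (U (Pi.single 0 j))) :
    IsLimitJet {α | ∑ i, α i ≤ N ∧ α 0 ≤ m} hU.toL2 := by
  refine isLimitJet_of_hasWeakDx ?_ ((finite_setOf_sum_le d N).subset fun α hα => hα.1)
    fun α hα => ?_
  · intro α β hle hα
    exact ⟨isLowerSet_setOf_sum_le d N hle hα.1, (hle 0).trans hα.2⟩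
  · exact (hU.hasWeakDx_zeroExt htr hα.1 hα.2).congr_univ (hU.coeFn_toL2 (by simp)).symm
      (hU.coeFn_toL2 hα.1).symm

end WeakJets

/-! ### Dilations of the normal coordinate. -/

section Reflection

variable {d n : ℕ} [NeZero d]

/-- Scaling of the coordinate `x₁` by `s`. -/
noncomputable def scaleFst (d : ℕ) [NeZero d] (s : ℝ) : SpaceTime d →L[ℝ] SpaceTime d :=
  ContinuousLinearMap.id ℝ _ + (((s - 1) • (EuclideanSpace.proj (𝕜 := ℝ) 0 :
    EuclideanSpace ℝ (Fin d) →L[ℝ] ℝ)).comp (ContinuousLinearMap.snd ℝ ℝ _)).smulRight (spaceDir 0)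

theorem scaleFst_apply (s : ℝ) (p : SpaceTime d) :
    scaleFst d s p = p + ((s - 1) * p.2 0) • spaceDir 0 := by
  simp [scaleFst]

theorem scaleFst_fst (s : ℝ) (p : SpaceTime d) : (scaleFst d s p).1 = p.1 := by
  simp [scaleFst_apply, spaceDir]

theorem scaleFst_snd_zero (s : ℝ) (p : SpaceTime d) : (scaleFst d s p).2 0 = s * p.2 0 := by
  simp [scaleFst_apply, spaceDir]
  ring

theorem scaleFst_scaleFst (s t : ℝ) (p : SpaceTime d) :
    scaleFst d s (scaleFst d t p) = scaleFst d (s * t) p := by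
  rw [scaleFst_apply s, scaleFst_snd_zero, scaleFst_apply t, scaleFst_apply (s * t), add_assoc,
    ← add_smul]
  congr 2
  ring

theorem scaleFst_one (p : SpaceTime d) : scaleFst d 1 p = p := by
  simp [scaleFst_apply]

theorem scaleFst_of_eq_zero (s : ℝ) {p : SpaceTime d} (hp : p.2 0 = 0) : scaleFst d s p = p := by
  simp [scaleFst_apply, hp]

theorem scaleFst_spaceDir (s : ℝ) (i : Fin d) :
    scaleFst d s (spaceDir i) = (if i = 0 then s else 1) • spaceDir i := by
  rw [scaleFst_apply]
  by_cases hi : i = 0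
  · subst hi
    simp only [spaceDir, if_true]
    rw [← one_smul ℝ ((0, EuclideanSpace.single 0 1) : SpaceTime d), smul_smul, ← add_smul]
    simp
  · simp [spaceDir, hi, Ne.symm hi]

/-- The factor in the change of variables by `scaleFst`. -/
noncomputable def scaleFactor (d : ℕ) [NeZero d] (s : ℝ) : ℝ :=
  |(LinearMap.det (scaleFst d s : SpaceTime d →ₗ[ℝ] SpaceTime d))⁻¹|

theorem det_scaleFst_ne_zero {s : ℝ} (hs : s ≠ 0) :
    LinearMap.det (scaleFst d s : SpaceTime d →ₗ[ℝ] SpaceTime d) ≠ 0 := by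
  have h : (scaleFst d s⁻¹ : SpaceTime d →ₗ[ℝ] SpaceTime d) ∘ₗ
      (scaleFst d s : SpaceTime d →ₗ[ℝ] SpaceTime d) = LinearMap.id := by
    refine LinearMap.ext fun p => ?_
    change scaleFst d s⁻¹ (scaleFst d s p) = p
    rw [scaleFst_scaleFst, inv_mul_cancel₀ hs, scaleFst_one]
  intro h0
  have := congrArg LinearMap.det h
  rw [LinearMap.det_comp, h0, mul_zero, LinearMap.det_id] at this
  exact zero_ne_one this

theorem scaleFactor_pos {s : ℝ} (hs : s ≠ 0) : 0 < scaleFactor d s :=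
  abs_pos.2 (inv_ne_zero (det_scaleFst_ne_zero hs))

theorem map_scaleFst {s : ℝ} (hs : s ≠ 0) :
    Measure.map (scaleFst d s) (volume : Measure (SpaceTime d)) =
      ENNReal.ofReal (scaleFactor d s) • volume :=
  Measure.map_linearMap_addHaar_eq_smul_addHaar volume (det_scaleFst_ne_zero hs)

/-- `scaleFst` as a homeomorphism. -/
noncomputable def scaleHomeo (d : ℕ) [NeZero d] {s : ℝ} (hs : s ≠ 0) :
    SpaceTime d ≃ₜ SpaceTime d where
  toFun := scaleFst d s
  invFun := scaleFst d s⁻¹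
  left_inv p := by rw [scaleFst_scaleFst, inv_mul_cancel₀ hs, scaleFst_one]
  right_inv p := by rw [scaleFst_scaleFst, mul_inv_cancel₀ hs, scaleFst_one]
  continuous_toFun := (scaleFst d s).continuous
  continuous_invFun := (scaleFst d s⁻¹).continuous

theorem integral_comp_scaleFst {s : ℝ} (hs : s ≠ 0) (f : SpaceTime d → Cvec n) :
    ∫ p, f (scaleFst d s p) = scaleFactor d s • ∫ p, f p := by
  have h := (scaleHomeo d hs).measurableEmbedding.integral_map (μ := volume) f
  have h2 : Measure.map (scaleHomeo d hs) (volume : Measure (SpaceTime d)) =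
    ENNReal.ofReal (scaleFactor d s) • volume := map_scaleFst hs
  rw [h2, integral_smul_measure, ENNReal.toReal_ofReal (scaleFactor_pos hs).le] at h
  exact h.symm

theorem eLpNorm_comp_scaleFst {s : ℝ} (hs : s ≠ 0) (f : SpaceTime d → Cvec n) :
    eLpNorm (fun p => f (scaleFst d s p)) 2 volume =
      ENNReal.ofReal (scaleFactor d s) ^ (1 / 2 : ℝ) * eLpNorm f 2 volume := by
  have h := (scaleHomeo d hs).measurableEmbedding.eLpNorm_map_measure (μ := volume) (p := 2) (g := f)
  have h2 : Measure.map (scaleHomeo d hs) (volume : Measure (SpaceTime d)) =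
    ENNReal.ofReal (scaleFactor d s) • volume := map_scaleFst hs
  rw [h2, eLpNorm_smul_measure_of_ne_top (by norm_num)] at h
  rw [show (fun p => f (scaleFst d s p)) = f ∘ (scaleHomeo d hs) from rfl, ← h]
  simp

theorem memLp_comp_scaleFst {s : ℝ} (hs : s ≠ 0) {f : SpaceTime d → Cvec n}
    (hf : MemLp f 2 volume) : MemLp (fun p => f (scaleFst d s p)) 2 volume := by
  refine ⟨?_, ?_⟩
  · have hq : Measure.QuasiMeasurePreserving (scaleFst d s)
        (volume : Measure (SpaceTime d)) volume := by
      refine ⟨(scaleFst d s).continuous.measurable, ?_⟩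
      rw [map_scaleFst hs]
      exact Measure.smul_absolutelyContinuous
    exact hf.1.comp_quasiMeasurePreserving hq
  · rw [eLpNorm_comp_scaleFst hs]
    exact ENNReal.mul_lt_top (ENNReal.rpow_lt_top_of_nonneg (by norm_num) ENNReal.ofReal_ne_top)
      hf.2

theorem IsBump.comp_scaleFst {φ : SpaceTime d → ℝ} (hφ : IsBump φ) {s : ℝ} (hs : s ≠ 0) :
    IsBump fun p => φ (scaleFst d s p) :=
  ⟨hφ.1.comp (scaleFst d s).contDiff, hφ.2.comp_homeomorph (scaleHomeo d hs)⟩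

theorem dirDeriv_comp_scaleFst {φ : SpaceTime d → ℝ} (hφ : ContDiff ℝ ∞ φ) (s : ℝ) (i : Fin d)
    (p : SpaceTime d) :
    dirDeriv i (fun p => φ (scaleFst d s p)) p =
      (if i = 0 then s else 1) * dirDeriv i φ (scaleFst d s p) := by
  have h := ((hφ.differentiable (by simp)) (scaleFst d s p)).hasFDerivAt.comp p
    (scaleFst d s).hasFDerivAt
  unfold dirDeriv
  rw [show (fun p => φ (scaleFst d s p)) = φ ∘ scaleFst d s from rfl, h.fderiv]
  rw [ContinuousLinearMap.comp_apply, scaleFst_spaceDir, map_smul, smul_eq_mul]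

end Reflection

/-! ### Higher-order reflection across the boundary. -/

section ReflectionExtension

variable {d n : ℕ} [NeZero d]

/-- The scaling factors of the reflected copies. -/
noncomputable def reflNode (i : ℕ) : ℝ := -((i : ℝ) + 1)

theorem reflNode_neg (i : ℕ) : reflNode i < 0 := by
  unfold reflNode
  have : (0 : ℝ) ≤ i := Nat.cast_nonneg i
  linarith

theorem reflNode_ne_zero (i : ℕ) : reflNode i ≠ 0 := (reflNode_neg i).ne

/-- Lagrange interpolation at N nodes is exact on monomials of degree less than N; evaluation at 1
gives the weights. -/
theorem exists_interpolation_weights (N : ℕ) :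
    ∃ b : ℕ → ℝ, ∀ k < N, ∑ i ∈ Finset.range N, b i * reflNode i ^ k = 1 := by
  have hinj : Set.InjOn reflNode (Finset.range N : Set ℕ) := by
    intro i _ j _ hij
    simpa [reflNode] using hij
  refine ⟨fun i => (Lagrange.basis (Finset.range N) reflNode i).eval 1, fun k hk => ?_⟩
  have h := Lagrange.eq_interpolate (f := (Polynomial.X ^ k : Polynomial ℝ)) hinj
    (by simpa using hk)
  have h2 := congrArg (Polynomial.eval 1) h
  rw [Lagrange.interpolate_apply, Polynomial.eval_finsetSum] at h2
  simp only [Polynomial.eval_pow, Polynomial.eval_X, one_pow, Polynomial.eval_mul,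
    Polynomial.eval_C] at h2
  exact (Finset.sum_congr rfl fun i _ => mul_comm _ _).trans h2.symm

/-- These are the classical matching conditions at x₁ = 0, in the dual form needed for test
functions. Dividing the interpolation weights by the Jacobian factor and the node makes its explicit
value irrelevant. -/
theorem exists_reflWeights (d : ℕ) [NeZero d] (N : ℕ) :
    ∃ c : ℕ → ℝ, ∀ k < N,
      1 + ∑ i ∈ Finset.range N, c i * scaleFactor d (reflNode i) * reflNode i ^ (k + 1) = 0 := by
  obtain ⟨b, hb⟩ := exists_interpolation_weights N
  refine ⟨fun i => -b i / (scaleFactor d (reflNode i) * reflNode i), fun k hk => ?_⟩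
  rw [← hb k hk, ← Finset.sum_add_distrib]
  refine Finset.sum_eq_zero fun i _ => ?_
  have h1 := (scaleFactor_pos (d := d) (reflNode_ne_zero i)).ne'
  have h2 := reflNode_ne_zero i
  field_simp
  ring

/-- The extension of a function on the half-space cylinder by a combination of reflected and
scaled copies with weights `c`. -/
noncomputable def reflExt (T : WithTop ℝ) (N : ℕ) (c : ℕ → ℝ) (v : SpaceTime d → Cvec n) :
    SpaceTime d → Cvec n :=
  fun p => zeroExt T v p + ∑ i ∈ Finset.range N, c i • zeroExt T v (scaleFst d (reflNode i) p)

theorem memLp_reflExt {T : WithTop ℝ} (N : ℕ) (c : ℕ → ℝ) {v : SpaceTime d → Cvec n}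
    (hv : MemLp v 2 (volume.restrict (halfCyl d T))) : MemLp (reflExt T N c v) 2 volume := by
  have h := memLp_zeroExt_iff.2 hv
  exact h.add (memLp_finsetSum _ fun i _ =>
    (memLp_comp_scaleFst (reflNode_ne_zero i) h).const_smul (c i))

theorem eLpNorm_reflExt_le {T : WithTop ℝ} (N : ℕ) (c : ℕ → ℝ) {v : SpaceTime d → Cvec n}
    (hv : MemLp v 2 (volume.restrict (halfCyl d T))) :
    eLpNorm (reflExt T N c v) 2 volume ≤ (1 + ∑ i ∈ Finset.range N,
      ‖c i‖ₑ * ENNReal.ofReal (scaleFactor d (reflNode i)) ^ (1 / 2 : ℝ)) *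
        eLpNorm (zeroExt T v) 2 volume := by
  have h := memLp_zeroExt_iff.2 hv
  have hi : ∀ i ∈ Finset.range N, AEStronglyMeasurable
      (fun p => c i • zeroExt T v (scaleFst d (reflNode i) p)) volume := fun i _ =>
    ((memLp_comp_scaleFst (reflNode_ne_zero i) h).const_smul (c i)).1
  have h1 : eLpNorm (reflExt T N c v) 2 volume ≤ eLpNorm (zeroExt T v) 2 volume +
      eLpNorm (∑ i ∈ Finset.range N, fun p => c i • zeroExt T v (scaleFst d (reflNode i) p))
        2 volume := by
    refine le_trans (le_of_eq ?_) (eLpNorm_add_le h.1 (Finset.aestronglyMeasurable_sum _ hi)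
      (by norm_num))
    congr 1
    funext p
    simp [reflExt]
  refine h1.trans ?_
  rw [add_mul, one_mul, Finset.sum_mul]
  gcongr
  refine (eLpNorm_sum_le hi (by norm_num)).trans (Finset.sum_le_sum fun i _ => le_of_eq ?_)
  rw [mul_assoc, ← eLpNorm_comp_scaleFst (reflNode_ne_zero i)]
  exact eLpNorm_const_smul (c i) _ _ _

/-- Changing variables in each reflected copy transfers the reflection from the function to the test
function, so that only an integral over the half-space cylinder remains. -/
theorem integral_smul_reflExt {T : WithTop ℝ} (N : ℕ) (c : ℕ → ℝ) {v : SpaceTime d → Cvec n}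
    (hv : MemLp v 2 (volume.restrict (halfCyl d T))) {φ : SpaceTime d → ℝ} (hφ : IsBump φ) :
    ∫ p, φ p • reflExt T N c v p = ∫ p in halfCyl d T, (φ p + ∑ i ∈ Finset.range N,
      c i * scaleFactor d (reflNode i) * φ (scaleFst d (reflNode i)⁻¹ p)) • v p := by
  have h := memLp_zeroExt_iff.2 hv
  have hb : ∀ i, IsBump fun p => φ (scaleFst d (reflNode i)⁻¹ p) := fun i =>
    hφ.comp_scaleFst (inv_ne_zero (reflNode_ne_zero i))
  simp_rw [reflExt, add_smul, smul_add, Finset.smul_sum, Finset.sum_smul]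
  have hi1 : ∀ i ∈ Finset.range N, Integrable
      (fun p => φ p • c i • zeroExt T v (scaleFst d (reflNode i) p)) volume := fun i _ =>
    hφ.integrable_smul ((memLp_comp_scaleFst (reflNode_ne_zero i) h).const_smul (c i))
  have hi2 : ∀ i ∈ Finset.range N, Integrable (fun p => (c i * scaleFactor d (reflNode i) *
      φ (scaleFst d (reflNode i)⁻¹ p)) • v p) (volume.restrict (halfCyl d T)) := fun i _ => by
    simp_rw [mul_smul _ (φ _)]
    exact ((hb i).integrable_smul hv).smul (c i * scaleFactor d (reflNode i))
  rw [integral_add (hφ.integrable_smul h) (integrable_finsetSum _ hi1), integral_finsetSum _ hi1,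
    integral_add (hφ.integrable_smul hv) (integrable_finsetSum _ hi2), integral_finsetSum _ hi2,
    integral_smul_zeroExt]
  congr 1
  refine Finset.sum_congr rfl fun i _ => ?_
  simp_rw [mul_smul _ (φ _)]
  rw [integral_smul, ← integral_smul_zeroExt, mul_smul, ← integral_comp_scaleFst
    (reflNode_ne_zero i), ← integral_smul]
  congr 1
  funext p
  rw [scaleFst_scaleFst, inv_mul_cancel₀ (reflNode_ne_zero i), scaleFst_one, smul_comm]

/-- The transferred test function ψ vanishes on x₁ = 0 exactly because of the matching condition, so
v needs no boundary condition. Tangential derivatives need no matching either. -/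
theorem hasWeakDx_reflExt {T : WithTop ℝ} {N : ℕ} {c : ℕ → ℝ} {v w : SpaceTime d → Cvec n}
    (hv : MemLp v 2 (volume.restrict (halfCyl d T)))
    (hw : MemLp w 2 (volume.restrict (halfCyl d T))) {j : Fin d}
    (h : HasWeakDx (halfCyl d T) (Pi.single j 1) v w)
    (hc : j = 0 → 1 + ∑ i ∈ Finset.range N, c i * scaleFactor d (reflNode i) * reflNode i = 0) :
    HasWeakDx Set.univ (Pi.single j 1) (reflExt T N c v)
      (reflExt T N (fun i => c i * if j = 0 then reflNode i else 1) w) := by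
  refine hasWeakDx_univ_of_forall (memLp_reflExt _ _ hv) (memLp_reflExt _ _ hw) fun φ hφ => ?_
  rw [integral_smul_reflExt _ _ hv (hφ.dir j), integral_smul_reflExt _ _ hw hφ]
  -- By the chain rule a normal derivative of a reflected copy gains its node as a factor.
  set e : ℕ → ℝ := fun i => if j = 0 then reflNode i else 1 with he
  set ψ : SpaceTime d → ℝ := fun p => φ p + ∑ i ∈ Finset.range N,
    c i * e i * scaleFactor d (reflNode i) * φ (scaleFst d (reflNode i)⁻¹ p) with hψd
  have hb : ∀ i, IsBump fun p => φ (scaleFst d (reflNode i)⁻¹ p) := fun i =>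
    hφ.comp_scaleFst (inv_ne_zero (reflNode_ne_zero i))
  have hψ : IsBump ψ := by
    refine ⟨hφ.1.add (ContDiff.sum fun i _ => contDiff_const.mul (hb i).1), ?_⟩
    refine hφ.2.add ?_
    have : ∀ s : Finset ℕ, HasCompactSupport (fun p : SpaceTime d => ∑ i ∈ s,
        c i * e i * scaleFactor d (reflNode i) * φ (scaleFst d (reflNode i)⁻¹ p)) := by
      intro s
      induction s using Finset.induction_on with
      | empty => simp only [Finset.sum_empty]; exact HasCompactSupport.zero
      | insert i s hi ih =>
        simp_rw [Finset.sum_insert hi]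
        exact ((hb i).2.mul_left).add ih
    exact this _
  have hder : ∀ p, dirDeriv j ψ p = dirDeriv j φ p + ∑ i ∈ Finset.range N,
      c i * scaleFactor d (reflNode i) * dirDeriv j φ (scaleFst d (reflNode i)⁻¹ p) := by
    intro p
    have hd : ∀ i, HasFDerivAt (fun p => φ (scaleFst d (reflNode i)⁻¹ p))
        (fderiv ℝ (fun p => φ (scaleFst d (reflNode i)⁻¹ p)) p) p := fun i =>
      ((hb i).1.differentiable (by simp) p).hasFDerivAt
    have hψ' := (hφ.1.differentiable (by simp) p).hasFDerivAt.add
      (HasFDerivAt.fun_sum (u := Finset.range N) fun i _ =>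
        (hd i).const_mul (c i * e i * scaleFactor d (reflNode i)))
    have h1 : dirDeriv j ψ p = dirDeriv j φ p + ∑ i ∈ Finset.range N,
        c i * e i * scaleFactor d (reflNode i) *
          dirDeriv j (fun p => φ (scaleFst d (reflNode i)⁻¹ p)) p := by
      unfold dirDeriv
      have h2 := hψ'.fderiv
      change fderiv ℝ ψ p = _ at h2
      rw [h2]
      simp
    rw [h1]
    congr 1
    refine Finset.sum_congr rfl fun i _ => ?_
    rw [dirDeriv_comp_scaleFst hφ.1]
    have h3 : e i * (if j = 0 then (reflNode i)⁻¹ else 1) = 1 := by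
      simp only [he]; split_ifs
      · exact mul_inv_cancel₀ (reflNode_ne_zero i)
      · simp
    linear_combination (c i * scaleFactor d (reflNode i) *
      dirDeriv j φ (scaleFst d (reflNode i)⁻¹ p)) * h3
  simp_rw [← hder]
  change _ = -∫ p in halfCyl d T, ψ p • w p
  by_cases hj : j = 0
  · subst hj
    refine integral_dirDeriv_of_eq_zero hv hw h hψ fun p hp => ?_
    simp only [hψd, scaleFst_of_eq_zero _ hp, he, if_true]
    rw [← Finset.sum_mul]
    have h4 : ∑ i ∈ Finset.range N, c i * reflNode i * scaleFactor d (reflNode i) =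
        ∑ i ∈ Finset.range N, c i * scaleFactor d (reflNode i) * reflNode i :=
      Finset.sum_congr rfl fun i _ => by ring
    rw [h4]
    linear_combination φ p * hc rfl
  · exact integral_dirDeriv_tangential hj hv hw h hψ

/-- The weak derivatives of the reflection extension. -/
noncomputable def WeakJet.reflL2 {N : ℕ} {T : WithTop ℝ} {U : MultiIdx d → SpaceTime d → Cvec n}
    (hU : WeakJet N T U) (c : ℕ → ℝ) (α : MultiIdx d) : L2X d n :=
  if h : ∑ i, α i ≤ N then
    (memLp_reflExt N (fun i => c i * reflNode i ^ α 0) (hU.memLp α h)).toLp _ else 0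

theorem WeakJet.coeFn_reflL2 {N : ℕ} {T : WithTop ℝ} {U : MultiIdx d → SpaceTime d → Cvec n}
    (hU : WeakJet N T U) (c : ℕ → ℝ) {α : MultiIdx d} (h : ∑ i, α i ≤ N) :
    hU.reflL2 c α =ᵐ[volume] reflExt T N (fun i => c i * reflNode i ^ α 0) (U α) := by
  rw [WeakJet.reflL2, dif_pos h]
  exact MemLp.coeFn_toLp _

theorem WeakJet.hasWeakDx_reflL2 {N : ℕ} {T : WithTop ℝ}
    {U : MultiIdx d → SpaceTime d → Cvec n} (hU : WeakJet N T U) {c : ℕ → ℝ}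
    (hc : ∀ k < N,
      1 + ∑ i ∈ Finset.range N, c i * scaleFactor d (reflNode i) * reflNode i ^ (k + 1) = 0)
    {α : MultiIdx d} (hα : ∑ i, α i ≤ N) :
    HasWeakDx Set.univ α (reflExt T N (fun i => c i * reflNode i ^ (0 : MultiIdx d) 0) (U 0))
      (reflExt T N (fun i => c i * reflNode i ^ α 0) (U α)) := by
  induction hk : ∑ i, α i generalizing α with
  | zero =>
    have : α = 0 := funext fun i => (Finset.sum_eq_zero_iff.mp hk) i (Finset.mem_univ i)
    subst this
    exact .refl (((memLp_reflExt _ _ (hU.memLp 0 hα)).locallyIntegrable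
      (by norm_num)).locallyIntegrableOn _)
  | succ k ih =>
    obtain ⟨β, j, rfl, hβ⟩ := exists_add_single_of_sum_eq_succ hk
    rw [sum_add_single] at hα
    refine (ih (α := β) (by omega) hβ).trans ?_
    have h := hasWeakDx_reflExt (N := N) (c := fun i => c i * reflNode i ^ β 0)
      (hU.memLp β (by omega)) (hU.memLp (β + Pi.single j 1) (by rw [sum_add_single]; omega))
      (hU.step β j hα) (fun hj => by
        subst hj
        -- One more normal derivative on top of β uses the matching condition with exponent β₀ + 1,
        -- which is available as |β| < N.
        have hlt : β 0 < N := (Finset.single_le_sum (fun i _ => Nat.zero_le (β i))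
          (Finset.mem_univ 0)).trans_lt hα
        rw [← hc _ hlt]
        congr 1
        exact Finset.sum_congr rfl fun i _ => by ring)
    convert h using 3 with i
    by_cases hj : j = 0
    · subst hj; simp [pow_succ, mul_assoc]
    · simp [hj, Ne.symm hj]

theorem reflExt_of_mem {T : WithTop ℝ} (N : ℕ) (c : ℕ → ℝ) (v : SpaceTime d → Cvec n)
    {p : SpaceTime d} (hp : p ∈ halfCyl d T) : reflExt T N c v p = zeroExt T v p := by
  have h : ∀ i, zeroExt T v (scaleFst d (reflNode i) p) = 0 := fun i => by
    refine Set.indicator_of_notMem (fun h => ?_) _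
    have h2 := h.2
    rw [scaleFst_snd_zero] at h2
    exact (mul_neg_of_neg_of_pos (reflNode_neg i) hp.2).not_gt h2
  simp [reflExt, h]

theorem reflExt_of_not_lt {T : WithTop ℝ} (N : ℕ) (c : ℕ → ℝ) (v : SpaceTime d → Cvec n)
    {p : SpaceTime d} (hp : ¬ (p.1 : WithTop ℝ) < T) : reflExt T N c v p = 0 := by
  have h : ∀ q : SpaceTime d, q.1 = p.1 → zeroExt T v q = 0 := fun q hq =>
    Set.indicator_of_notMem (fun h => hp (hq ▸ h.1)) _
  simp [reflExt, h p rfl, h _ (scaleFst_fst _ p)]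

/-- The reflection extension is bounded in all orders up to `N`. -/
theorem exists_reflection_jet (d n N : ℕ) [NeZero d] : ∃ C : ℝ, 0 ≤ C ∧ ∀ (T : WithTop ℝ)
    (U : MultiIdx d → SpaceTime d → Cvec n) (hU : WeakJet N T U), ∃ a : MultiIdx d → L2X d n,
      IsLimitJet {α | ∑ i, α i ≤ N} a ∧ (∀ α : MultiIdx d, ∑ i, α i ≤ N →
        ‖a α‖ ≤ C * ‖hU.toL2 α‖ ∧ (∀ᵐ p, p ∈ halfCyl d T → a α p = hU.toL2 α p) ∧
          ∀ᵐ p, ¬ (p.1 : WithTop ℝ) < T → a α p = 0) := by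
  obtain ⟨c, hc⟩ := exists_reflWeights d N
  set K : ℕ → ℝ≥0∞ := fun k => 1 + ∑ i ∈ Finset.range N,
    ‖c i * reflNode i ^ k‖ₑ * ENNReal.ofReal (scaleFactor d (reflNode i)) ^ (1 / 2 : ℝ) with hK
  have hKt : ∀ k, K k ≠ ⊤ := fun k => by
    refine ENNReal.add_ne_top.2 ⟨by simp, (ENNReal.sum_lt_top.2 fun i _ => ?_).ne⟩
    exact ENNReal.mul_lt_top enorm_lt_top
      (ENNReal.rpow_lt_top_of_nonneg (by norm_num) ENNReal.ofReal_ne_top)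
  -- The norm of the extension of D^αu depends on α only through its normal order; the sum dominates
  -- all the resulting constants.
  refine ⟨∑ k ∈ Finset.range (N + 1), (K k).toReal,
    Finset.sum_nonneg fun _ _ => ENNReal.toReal_nonneg, fun T U hU => ⟨hU.reflL2 c, ?_, ?_⟩⟩
  · refine isLimitJet_of_hasWeakDx (isLowerSet_setOf_sum_le d N) (finite_setOf_sum_le d N)
      fun α hα => ?_
    exact (hU.hasWeakDx_reflL2 hc hα).congr_univ (hU.coeFn_reflL2 c (by simp)).symm
      (hU.coeFn_reflL2 c hα).symm
  · intro α hα
    refine ⟨?_, ?_, ?_⟩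
    · have h0 : α 0 ∈ Finset.range (N + 1) := by
        have := (Finset.single_le_sum (fun i _ => Nat.zero_le (α i)) (Finset.mem_univ 0)).trans hα
        simpa using Nat.lt_succ_of_le this
      have h1 : ‖hU.reflL2 c α‖ ≤ (K (α 0)).toReal * ‖hU.toL2 α‖ := by
        rw [Lp.norm_def, Lp.norm_def, ← ENNReal.toReal_mul,
          eLpNorm_congr_ae (hU.coeFn_reflL2 c hα), eLpNorm_congr_ae (hU.coeFn_toL2 hα)]
        exact ENNReal.toReal_mono
          (ENNReal.mul_ne_top (hKt _) (memLp_zeroExt_iff.2 (hU.memLp α hα)).eLpNorm_ne_top)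
          (eLpNorm_reflExt_le N _ (hU.memLp α hα))
      refine h1.trans (mul_le_mul_of_nonneg_right ?_ (norm_nonneg _))
      exact Finset.single_le_sum (f := fun k => (K k).toReal)
        (fun _ _ => ENNReal.toReal_nonneg) h0
    · filter_upwards [hU.coeFn_reflL2 c hα, hU.coeFn_toL2 hα] with p h1 h2 hp
      rw [h1, h2, reflExt_of_mem N _ _ hp]
    · filter_upwards [hU.coeFn_reflL2 c hα] with p h1 hp
      rw [h1, reflExt_of_not_lt N _ _ hp]

end ReflectionExtension

/-! ### Time translations and the sign of the time derivative. -/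

section TimeDerivative

open scoped InnerProductSpace

variable {d n : ℕ}

theorem classDt_comp_add_right (φ : SpaceTime d → ℝ) (q p : SpaceTime d) :
    classDt (fun p => φ (p + q)) p = classDt φ (p + q) := by
  simp [classDt, fderiv_comp_add_right]

theorem hasDerivAt_integral_time_shift {φ : SpaceTime d → ℝ} (hφ : IsBump φ)
    {f : SpaceTime d → Cvec n} (hf : MemLp f 2 volume) (s : ℝ) :
    HasDerivAt (fun s : ℝ => ∫ p, φ (p + (s, 0)) • f p)
      (∫ p, classDt φ (p + (s, 0)) • f p) s := by
  have hc : Continuous (classDt φ) := (hφ.1.continuous_fderiv (by simp)).clm_apply continuous_const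
  have hcs : HasCompactSupport (classDt φ) := hφ.2.fderiv_apply ℝ _
  obtain ⟨C, hC⟩ := hcs.exists_bound_of_continuous hc
  have hfl : LocallyIntegrable f volume := hf.locallyIntegrable (by norm_num)
  -- The union of the supports for all shifts within distance 1 of s; it is compact, which gives an
  -- integrable majorant.
  set K : Set (SpaceTime d) :=
    (fun q : SpaceTime d × ℝ => q.1 - (q.2, 0)) '' (tsupport (classDt φ) ×ˢ Metric.closedBall s 1)
  have hK : IsCompact K := (hcs.isCompact.prod (isCompact_closedBall s 1)).image (by fun_prop)
  have hbd : Integrable (K.indicator fun p => C * ‖f p‖) volume :=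
    (integrable_indicator_iff hK.measurableSet).2
      (((hfl.integrableOn_isCompact hK).norm).const_mul C)
  refine (hasDerivAt_integral_of_dominated_loc_of_deriv_le (Metric.ball_mem_nhds s one_pos)
    (F := fun s p => φ (p + (s, 0)) • f p) (F' := fun s p => classDt φ (p + (s, 0)) • f p)
    (Eventually.of_forall fun r => ?_) ?_ ?_ (Eventually.of_forall fun p r hr => ?_) hbd
    (Eventually.of_forall fun p r _ => ?_)).2
  · exact (hφ.1.continuous.comp (by fun_prop)).aestronglyMeasurable.smul hf.1
  · have hb : IsBump fun p : SpaceTime d => φ (p + (s, 0)) :=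
      ⟨hφ.1.comp (by fun_prop), hφ.2.comp_homeomorph (Homeomorph.addRight _)⟩
    exact hb.integrable_smul hf
  · exact (hc.comp (by fun_prop)).aestronglyMeasurable.smul hf.1
  · by_cases hp : p ∈ K
    · rw [Set.indicator_of_mem hp, norm_smul]
      exact mul_le_mul_of_nonneg_right (hC _) (norm_nonneg _)
    · rw [Set.indicator_of_notMem hp, 
        image_eq_zero_of_notMem_tsupport (f := classDt φ) fun h =>
          hp ⟨(p + (r, 0), r), ⟨h, Metric.ball_subset_closedBall hr⟩, by simp⟩,
        zero_smul, norm_zero]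
  · have h1 : HasDerivAt (fun r : ℝ => p + ((r, 0) : SpaceTime d)) (1, 0) r := by
      simpa using ((hasDerivAt_id r).prodMk (hasDerivAt_const r (0 : EuclideanSpace ℝ (Fin d)))
        |>.const_add p)
    exact ((hφ.1.differentiable (by simp) _).hasFDerivAt.comp_hasDerivAt r h1).smul_const (f p)

/-- Integration against a test function, as a map on `L₂`. -/
noncomputable def bumpPairing {φ : SpaceTime d → ℝ} (hφ : IsBump φ) : L2X d n →L[ℝ] Cvec n :=
  (ContinuousLinearMap.lsmul ℝ ℝ).lpPairing volume 2 2
    ((hφ.1.continuous.memLp_of_hasCompactSupport hφ.2).toLp φ)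

theorem bumpPairing_apply {φ : SpaceTime d → ℝ} (hφ : IsBump φ) (f : L2X d n) :
    bumpPairing hφ f = ∫ p, φ p • f p := by
  rw [bumpPairing, ContinuousLinearMap.lpPairing_eq_integral]
  refine integral_congr_ae ?_
  filter_upwards [MemLp.coeFn_toLp (hφ.1.continuous.memLp_of_hasCompactSupport hφ.2 (p := 2)
    (μ := (volume : Measure (SpaceTime d))))] with p hp
  rw [hp]; rfl

theorem bumpPairing_translateL2 {φ : SpaceTime d → ℝ} (hφ : IsBump φ) (q : SpaceTime d)
    (f : L2X d n) : bumpPairing hφ (translateL2 q f) = ∫ p, φ (p + q) • f p := by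
  rw [bumpPairing_apply, ← integral_add_right_eq_self _ q]
  refine integral_congr_ae ?_
  filter_upwards [(measurePreserving_add_right volume q).quasiMeasurePreserving.ae
    (coeFn_translateL2 q f)] with p hp
  rw [hp]; simp

theorem IsBump.coeFn_jet {φ : SpaceTime d → Cvec n} (h : IsBump φ) (α : MultiIdx d) :
    h.jet α =ᵐ[volume] multiDeriv α φ :=
  ((h.multi α).memLp 2).coeFn_toLp

/-- Cauchy-Schwarz and the isometry of translations; this replaces ½ d/dt ‖f‖² and requires no
regularity in time. -/
theorem re_inner_sub_translateL2_nonneg (q : SpaceTime d) (f : L2X d n) :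
    0 ≤ (⟪f, f - translateL2 q f⟫_ℂ).re := by
  rw [inner_sub_right, Complex.sub_re, sub_nonneg]
  calc (⟪f, translateL2 q f⟫_ℂ).re ≤ ‖⟪f, translateL2 q f⟫_ℂ‖ := Complex.re_le_norm _
    _ ≤ ‖f‖ * ‖translateL2 q f‖ := norm_inner_le_norm _ _
    _ = ‖f‖ * ‖f‖ := by rw [LinearIsometry.norm_map]
    _ = (⟪f, f⟫_ℂ).re := (inner_self_eq_norm_mul_norm (𝕜 := ℂ) f).symm

theorem IsLimitJet.translateL2 {I : Set (MultiIdx d)} {a : MultiIdx d → L2X d n}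
    (ha : IsLimitJet I a) (q : SpaceTime d) : IsLimitJet I fun α => translateL2 q (a α) := by
  obtain ⟨φ, hφ, hl⟩ := ha
  have hb : ∀ k, IsBump fun p => φ k (p - q) := fun k =>
    ⟨(hφ k).1.comp (by fun_prop), (hφ k).2.comp_homeomorph (Homeomorph.subRight q)⟩
  refine ⟨fun k p => φ k (p - q), hb, fun α hα => ?_⟩
  refine (((_root_.translateL2 q).continuous.tendsto _).comp (hl α hα)).congr fun k => ?_
  refine Lp.ext ((coeFn_translateL2 q _).trans ?_)
  filter_upwards [(hb k).coeFn_jet α, (measurePreserving_sub_right volume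
    q).quasiMeasurePreserving.ae ((hφ k).coeFn_jet α)] with p h1 h2
  rw [h1, h2, multiDeriv_comp_sub (hφ k).1]

theorem bddCoeff_id (n : ℕ) : BddCoeff fun _ : ℝ => ContinuousLinearMap.id ℂ (Cvec n) :=
  ⟨aestronglyMeasurable_const, ⟨_, fun _ => le_rfl⟩⟩

theorem bddCoeff_id_op (f : L2X d n) : (bddCoeff_id n).op d f = f :=
  Lp.ext ((bddCoeff_id n).coeFn_op f)

/-- Integration by parts for two limit jets. -/
theorem IsLimitJet.inner_eq {I J : Set (MultiIdx d)} {a b : MultiIdx d → L2X d n}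
    (ha : IsLimitJet I a) (hb : IsLimitJet J b)
    {α β γ κ : MultiIdx d} (hα : α ∈ I) (hγ : γ ∈ I) (hβ : β ∈ J) (hκ : κ ∈ J)
    (he : α + β = γ + κ) :
    ⟪a α, b β⟫_ℂ = (-1) ^ (∑ i, α i + ∑ i, γ i) * ⟪a γ, b κ⟫_ℂ := by
  simpa only [bddCoeff_id_op] using ha.inner_op_eq hb (bddCoeff_id n) hα hγ hβ hκ he

theorem L2X.inner_congr_left {f g v : L2X d n}
    (h : ∀ᵐ p, f p = g p ∨ v p = 0) : ⟪f, v⟫_ℂ = ⟪g, v⟫_ℂ := by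
  rw [L2.inner_def, L2.inner_def]
  refine integral_congr_ae (h.mono fun p hp => ?_)
  rcases hp with hp | hp
  · simp only [hp]
  · simp only [hp, inner_zero_right]

variable [NeZero d] {T : WithTop ℝ}

/-- The shift moves the support to earlier times, hence stays in the cylinder. This is why backward
differences are used. -/
theorem IsTest.comp_time_shift {φ : SpaceTime d → ℝ} (hφ : IsTest (halfCyl d T) φ) {s : ℝ}
    (hs : 0 ≤ s) : IsTest (halfCyl d T) fun p => φ (p + (s, 0)) := by
  refine ⟨hφ.1.comp (by fun_prop), hφ.2.comp_homeomorph (Homeomorph.addRight _), fun p hp => ?_⟩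
  have h := hφ.3 (tsupport_comp_subset_preimage φ (f := fun p : SpaceTime d => p + (s, 0))
    (by fun_prop) hp)
  refine ⟨lt_of_le_of_lt ?_ h.1, by simpa using h.2⟩
  exact_mod_cast (by simpa using hs : p.1 ≤ p.1 + s)

/-- The difference quotient in time is the average of the translates of the weak derivative. -/
theorem ae_translate_sub_eq_integral {u w : SpaceTime d → Cvec n}
    (hu : MemLp u 2 (volume.restrict (halfCyl d T)))
    (hw : MemLp w 2 (volume.restrict (halfCyl d T))) (h : HasWeakDt (halfCyl d T) u w)
    {r : ℝ} (hr : 0 ≤ r) :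
    ∀ᵐ p, p ∈ halfCyl d T → ((memLp_zeroExt_iff.2 hu).toLp _ -
      translateL2 (r, 0) ((memLp_zeroExt_iff.2 hu).toLp _) -
      ∫ s in (0 : ℝ)..r, translateL2 (s, 0) ((memLp_zeroExt_iff.2 hw).toLp _) : L2X d n) p = 0 := by
  set U : L2X d n := (memLp_zeroExt_iff.2 hu).toLp _ with hU
  set W : L2X d n := (memLp_zeroExt_iff.2 hw).toLp _ with hW
  have hcont : Continuous fun s : ℝ => translateL2 ((s, 0) : SpaceTime d) W :=
    (continuous_translateL2 W).comp (by fun_prop)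
  refine (isOpen_halfCyl T).ae_eq_zero_of_integral_contDiff_smul_eq_zero
    ((((Lp.memLp _).locallyIntegrable (by norm_num)).locallyIntegrableOn _)) fun φ h1 h2 h3 => ?_
  have hφ : IsTest (halfCyl d T) φ := ⟨h1, h2, h3⟩
  have hb : IsBump φ := ⟨h1, h2⟩
  have hae : ∀ {v : SpaceTime d → Cvec n} (hv : MemLp v 2 (volume.restrict (halfCyl d T)))
      (ψ : SpaceTime d → ℝ), ∫ p, ψ p • ((memLp_zeroExt_iff.2 hv).toLp _ : L2X d n) p =
        ∫ p in halfCyl d T, ψ p • v p := by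
    intro v hv ψ
    rw [← integral_smul_zeroExt]
    refine integral_congr_ae ?_
    filter_upwards [MemLp.coeFn_toLp (memLp_zeroExt_iff.2 hv)] with p hp
    rw [hp]
  -- The translation is moved to the test function, whose classical time derivative is then paired
  -- with u by the definition of u_t.
  have hder : ∀ s : ℝ, 0 ≤ s → HasDerivAt (fun s => bumpPairing hb (translateL2 (s, 0) U))
      (-bumpPairing hb (translateL2 (s, 0) W)) s := by
    intro s hs
    simp_rw [bumpPairing_translateL2]
    convert hasDerivAt_integral_time_shift hb (Lp.memLp U) s using 1
    have e := h.integral_eq _ (hφ.comp_time_shift hs)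
    rw [hae hw, hae hu, ← e]
    simp_rw [classDt_comp_add_right]
  have hint := intervalIntegral.integral_eq_sub_of_hasDerivAt (a := 0) (b := r)
    (fun s hs => hder s (by rw [Set.uIcc_of_le hr] at hs; exact hs.1))
    ((((bumpPairing hb).continuous.comp hcont).neg).intervalIntegrable _ _)
  rw [← bumpPairing_apply hb, map_sub, map_sub,
    ← (bumpPairing hb).intervalIntegral_comp_comm (hcont.intervalIntegrable _ _)]
  rw [intervalIntegral.integral_neg] at hint
  have h0 : translateL2 ((0, 0) : SpaceTime d) U = U := by
    refine Lp.ext ((coeFn_translateL2 _ U).trans (Eventually.of_forall fun p => ?_))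
    simp [show ((0, 0) : SpaceTime d) = 0 from rfl]
  rw [h0] at hint
  rw [neg_eq_iff_eq_neg.1 hint]
  abel

/-- Backward difference quotients in time converge weakly to the weak time derivative. -/
theorem tendsto_inner_translate_sub {u w : SpaceTime d → Cvec n}
    (hu : MemLp u 2 (volume.restrict (halfCyl d T)))
    (hw : MemLp w 2 (volume.restrict (halfCyl d T))) (h : HasWeakDt (halfCyl d T) u w)
    {g : L2X d n} (hg : ∀ᵐ p, p ∉ halfCyl d T → g p = 0) :
    Tendsto (fun r : ℝ => (r⁻¹ : ℂ) * ⟪g, (memLp_zeroExt_iff.2 hu).toLp _ -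
      translateL2 (r, 0) ((memLp_zeroExt_iff.2 hu).toLp _)⟫_ℂ) (𝓝[>] 0)
      (𝓝 ⟪g, (memLp_zeroExt_iff.2 hw).toLp _⟫_ℂ) := by
  set U : L2X d n := (memLp_zeroExt_iff.2 hu).toLp _ with hU
  set W : L2X d n := (memLp_zeroExt_iff.2 hw).toLp _ with hW
  have hcont : Continuous fun s : ℝ => translateL2 ((s, 0) : SpaceTime d) W :=
    (continuous_translateL2 W).comp (by fun_prop)
  have h0 : translateL2 ((0, 0) : SpaceTime d) W = W := by
    refine Lp.ext ((coeFn_translateL2 _ W).trans (Eventually.of_forall fun p => ?_))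
    simp [show ((0, 0) : SpaceTime d) = 0 from rfl]
  -- Strong continuity of translations makes the averages (1/r)∫₀^r τ_s W ds converge to W in L₂.
  have hlim := (intervalIntegral.integral_hasDerivAt_right (hcont.intervalIntegrable 0 0)
    hcont.stronglyMeasurable.stronglyMeasurableAtFilter hcont.continuousAt).tendsto_slope
  rw [h0] at hlim
  have hlim2 := (tendsto_const_nhds (x := g)).inner (𝕜 := ℂ)
    (hlim.mono_left (nhdsWithin_mono 0 fun x (hx : 0 < x) => hx.ne'))
  refine hlim2.congr' ?_
  filter_upwards [self_mem_nhdsWithin] with r hr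
  have hr : 0 < r := hr
  rw [slope_def_module, intervalIntegral.integral_same, sub_zero, sub_zero,
    inner_smul_right_eq_smul, Complex.real_smul, Complex.ofReal_inv]
  congr 1
  -- The difference quotient equals this average only inside the cylinder; elsewhere g vanishes.
  rw [eq_comm, ← sub_eq_zero, ← inner_sub_right, L2.inner_def]
  refine integral_eq_zero_of_ae ?_
  filter_upwards [hg, ae_translate_sub_eq_integral hu hw h hr.le] with p h1 h2
  by_cases hp : p ∈ halfCyl d T
  · rw [h2 hp, inner_zero_right]; rfl
  · rw [h1 hp, inner_zero_left]; rfl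

theorem re_inner_weakDt_nonneg_of_forall {u w : SpaceTime d → Cvec n}
    (hu : MemLp u 2 (volume.restrict (halfCyl d T)))
    (hw : MemLp w 2 (volume.restrict (halfCyl d T))) (h : HasWeakDt (halfCyl d T) u w)
    {g : L2X d n} (hg : ∀ᵐ p, p ∉ halfCyl d T → g p = 0)
    (hr : ∀ r : ℝ, 0 < r → 0 ≤ (⟪g, (memLp_zeroExt_iff.2 hu).toLp _ -
      translateL2 (r, 0) ((memLp_zeroExt_iff.2 hu).toLp _)⟫_ℂ).re) :
    0 ≤ (⟪g, (memLp_zeroExt_iff.2 hw).toLp _⟫_ℂ).re := by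
  refine ge_of_tendsto ((Complex.continuous_re.tendsto _).comp
    (tendsto_inner_translate_sub hu hw h hg)) ?_
  filter_upwards [self_mem_nhdsWithin] with r h0
  have h0 : 0 < r := h0
  rw [Function.comp_apply, ← Complex.ofReal_inv, Complex.re_ofReal_mul]
  exact mul_nonneg (inv_nonneg.2 h0.le) (hr r h0)

theorem WeakJet.ae_toL2_eq_zero {N : ℕ} {U : MultiIdx d → SpaceTime d → Cvec n}
    (hU : WeakJet N T U) (α : MultiIdx d) : ∀ᵐ p, p ∉ halfCyl d T → hU.toL2 α p = 0 := by
  by_cases hα : ∑ i, α i ≤ N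
  · filter_upwards [hU.coeFn_toL2 hα] with p h1 hp
    rw [h1, zeroExt, Set.indicator_of_notMem hp]
  · rw [WeakJet.toL2, dif_neg hα]
    filter_upwards [Lp.coeFn_zero (Cvec n) 2 (volume : Measure (SpaceTime d))] with p h1 _
    rw [h1]; rfl

theorem WeakJet.toL2_zero {N : ℕ} {U : MultiIdx d → SpaceTime d → Cvec n}
    (hU : WeakJet N T U) (h0 : MemLp (U 0) 2 (volume.restrict (halfCyl d T))) :
    hU.toL2 0 = (memLp_zeroExt_iff.2 h0).toLp _ := by
  rw [WeakJet.toL2, dif_pos (by simp)]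

theorem WeakJet.re_inner_weakDt_nonneg {N : ℕ} {U : MultiIdx d → SpaceTime d → Cvec n}
    (hU : WeakJet N T U) {w : SpaceTime d → Cvec n}
    (hw : MemLp w 2 (volume.restrict (halfCyl d T))) (h : HasWeakDt (halfCyl d T) (U 0) w) :
    0 ≤ (⟪hU.toL2 0, (memLp_zeroExt_iff.2 hw).toLp _⟫_ℂ).re := by
  have h0 := hU.memLp 0 (by simp)
  refine re_inner_weakDt_nonneg_of_forall h0 hw h (hU.ae_toL2_eq_zero 0) fun r _ => ?_
  rw [hU.toL2_zero h0]
  exact re_inner_sub_translateL2_nonneg _ _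

/-- Moving m derivatives across turns the pairing with a backward difference into ⟨v, v - τv⟩ for v
= D_j^m u, with the sign (-1)^m compensated by the one in the statement. This includes the normal
direction. -/
theorem WeakJet.re_inner_single_weakDt_nonneg {m : ℕ} {U : MultiIdx d → SpaceTime d → Cvec n}
    (hU : WeakJet (2 * m) T U) (htr : ∀ j < m, HasZeroTrace T (U (Pi.single 0 j)))
    {w : SpaceTime d → Cvec n} (hw : MemLp w 2 (volume.restrict (halfCyl d T)))
    (h : HasWeakDt (halfCyl d T) (U 0) w) (j : Fin d) :
    0 ≤ (⟪((-1 : ℂ) ^ m) • hU.toL2 (Pi.single j (2 * m)),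
      (memLp_zeroExt_iff.2 hw).toLp _⟫_ℂ).re := by
  have h0 := hU.memLp 0 (by simp)
  obtain ⟨C, -, hC⟩ := exists_reflection_jet d n (2 * m)
  obtain ⟨a, ha, haU⟩ := hC T U hU
  have hb := hU.isLimitJet_toL2 htr
  refine re_inner_weakDt_nonneg_of_forall h0 hw h ?_ fun r hr => ?_
  · filter_upwards [hU.ae_toL2_eq_zero (Pi.single j (2 * m)),
      Lp.coeFn_smul ((-1 : ℂ) ^ m) (hU.toL2 (Pi.single j (2 * m)))] with p h1 h2 hp
    rw [h2, Pi.smul_apply, h1 hp, smul_zero]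
  rw [← hU.toL2_zero h0]
  set q : SpaceTime d := (r, 0) with hq
  -- The zero extension of D^αu may be replaced by the reflected one. They agree in the cylinder;
  -- for t < T and x₁ ≤ 0 the difference v - τv vanishes, since the translation is in time; for t ≥
  -- T both extensions vanish.
  have key : ∀ α κ : MultiIdx d, ∑ i, α i ≤ 2 * m →
      ⟪hU.toL2 α, hU.toL2 κ - translateL2 q (hU.toL2 κ)⟫_ℂ =
        ⟪a α, hU.toL2 κ - translateL2 q (hU.toL2 κ)⟫_ℂ := by
    intro α κ hα
    refine L2X.inner_congr_left ?_
    filter_upwards [(haU α hα).2.1, (haU α hα).2.2, hU.ae_toL2_eq_zero α, hU.ae_toL2_eq_zero κ,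
      (measurePreserving_sub_right volume q).quasiMeasurePreserving.ae (hU.ae_toL2_eq_zero κ),
      coeFn_translateL2 q (hU.toL2 κ),
      Lp.coeFn_sub (hU.toL2 κ) (translateL2 q (hU.toL2 κ))] with p h1 h2 h3 h4 h5 h6 h7
    by_cases hp : p ∈ halfCyl d T
    · exact Or.inl (h1 hp).symm
    by_cases ht : (p.1 : WithTop ℝ) < T
    · have hx : ¬ 0 < p.2 0 := fun hx => hp ⟨ht, hx⟩
      right
      rw [h7, Pi.sub_apply, h6, h4 hp, h5 fun hm => hx (by simpa [hq] using hm.2), sub_zero]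
    · left
      rw [h2 ht, h3 hp]
  have hI : (0 : MultiIdx d) ∈ {α : MultiIdx d | ∑ i, α i ≤ 2 * m ∧ α 0 ≤ m} := by simp
  have hI2 : (Pi.single j m : MultiIdx d) ∈ {α : MultiIdx d | ∑ i, α i ≤ 2 * m ∧ α 0 ≤ m} := by
    refine ⟨by simp; omega, ?_⟩
    by_cases hj : 0 = j
    · subst hj; simp
    · simp [hj]
  have hJ : (Pi.single j (2 * m) : MultiIdx d) ∈ {α : MultiIdx d | ∑ i, α i ≤ 2 * m} := by simp
  have hadd : (Pi.single j (2 * m) + 0 : MultiIdx d) = Pi.single j m + Pi.single j m := by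
    rw [add_zero, ← Pi.single_add, two_mul]
  have e1 := ha.inner_eq hb hJ hI2.1 hI hI2 hadd
  have e2 := ha.inner_eq (hb.translateL2 q) hJ hI2.1 hI hI2 hadd
  have hs : ((-1 : ℂ) ^ m) * (-1) ^ (∑ i, (Pi.single j (2 * m) : MultiIdx d) i +
      ∑ i, (Pi.single j m : MultiIdx d) i) = 1 := by
    simp [← pow_add]
    rw [show m + (2 * m + m) = 2 * (2 * m) by ring, pow_mul]
    simp
  have e3 : ⟪((-1 : ℂ) ^ m) • hU.toL2 (Pi.single j (2 * m)),
      hU.toL2 0 - translateL2 q (hU.toL2 0)⟫_ℂ = ⟪hU.toL2 (Pi.single j m),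
        hU.toL2 (Pi.single j m) - translateL2 q (hU.toL2 (Pi.single j m))⟫_ℂ := by
    rw [inner_smul_left, key _ _ hJ, key _ _ hI2.1, inner_sub_right, inner_sub_right, e1, e2]
    simp only [map_pow, map_neg, map_one]
    linear_combination (⟪a (Pi.single j m), hU.toL2 (Pi.single j m)⟫_ℂ -
      ⟪a (Pi.single j m), translateL2 q (hU.toL2 (Pi.single j m))⟫_ℂ) * hs
  rw [e3]
  exact re_inner_sub_translateL2_nonneg _ _

end TimeDerivative

/-! ### Interpolation inequalities via Fourier symbols. -/

section Interpolation

open scoped InnerProductSpace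

variable {d n : ℕ}

theorem IsLimitJet.shift {I : Set (MultiIdx d)} {a : MultiIdx d → L2X d n}
    (ha : IsLimitJet I a) (κ : MultiIdx d) :
    IsLimitJet {α | κ + α ∈ I} fun α => a (κ + α) := by
  obtain ⟨φ, hφ, hl⟩ := ha
  refine ⟨fun k => multiDeriv κ (φ k), fun k => (hφ k).multi κ, fun α hα => ?_⟩
  refine (hl _ hα).congr fun k => Lp.ext ?_
  filter_upwards [(hφ k).coeFn_jet (κ + α), ((hφ k).multi κ).coeFn_jet α] with p h1 h2
  rw [h1, h2, add_comm, multiDeriv_add (hφ k).1]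

theorem norm_fourierSymbol_sq (α : MultiIdx d) (ξ : EuclideanSpace ℝ (Fin d)) :
    ‖fourierSymbol α ξ‖ ^ 2 = ∏ i, ((2 * Real.pi * ξ i) ^ 2) ^ α i := by
  rw [fourierSymbol, norm_prod, ← Finset.prod_pow]
  refine Finset.prod_congr rfl fun i _ => ?_
  rw [norm_pow, pow_right_comm]
  congr 1
  simp only [norm_mul, Complex.norm_real, Complex.norm_I, Complex.norm_ofNat, mul_one, mul_pow,
    Real.norm_eq_abs, sq_abs]

theorem norm_fourierSymbol_single_sq (j : Fin d) (k : ℕ) (ξ : EuclideanSpace ℝ (Fin d)) :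
    ‖fourierSymbol (Pi.single j k) ξ‖ ^ 2 = ((2 * Real.pi * ξ j) ^ 2) ^ k := by
  rw [norm_fourierSymbol_sq, Finset.prod_eq_single j]
  · simp
  · intro i _ hi; simp [hi]
  · simp

theorem prod_pow_le_pow_sum {ι : Type*} {s : Finset ι} {y : ι → ℝ} (hy : ∀ i ∈ s, 0 ≤ y i) {Y : ℝ}
    (hY : ∀ i ∈ s, y i ≤ Y) (α : ι → ℕ) : ∏ i ∈ s, y i ^ α i ≤ Y ^ ∑ i ∈ s, α i := by
  rw [← Finset.prod_pow_eq_pow_sum]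
  exact Finset.prod_le_prod (fun i hi => pow_nonneg (hy i hi) _)
    fun i hi => pow_le_pow_left₀ (hy i hi) (hY i hi) _

theorem pow_mul_pow_sub_le_add {a b : ℝ} (ha : 0 ≤ a) (hb : 0 ≤ b) {k l : ℕ} (hl : l ≤ k) :
    a ^ (k - l) * b ^ l ≤ a ^ k + b ^ k := by
  rcases le_total a b with h | h
  · calc a ^ (k - l) * b ^ l ≤ b ^ (k - l) * b ^ l := by gcongr
      _ = b ^ k := by rw [← pow_add, Nat.sub_add_cancel hl]
      _ ≤ _ := le_add_of_nonneg_left (by positivity)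
  · calc a ^ (k - l) * b ^ l ≤ a ^ (k - l) * a ^ l := by gcongr
      _ = a ^ k := by rw [← pow_add, Nat.sub_add_cancel hl]
      _ ≤ _ := le_add_of_nonneg_right (by positivity)

variable [NeZero d]

/-- Replacing every y_i by the largest reduces this to two numbers. It is applied with y_i =
(2πξ_i)². -/
theorem mul_prod_pow_le {y : Fin d → ℝ} (hy : ∀ i, 0 ≤ y i) {μ : ℝ} (hμ : 0 ≤ μ) {k : ℕ}
    {α : MultiIdx d} (hα : ∑ i, α i ≤ k) :
    μ ^ (k - ∑ i, α i) * ∏ i, y i ^ α i ≤ μ ^ k + ∑ j, y j ^ k := by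
  obtain ⟨j, -, hj⟩ := Finset.exists_max_image Finset.univ y ⟨0, Finset.mem_univ _⟩
  calc μ ^ (k - ∑ i, α i) * ∏ i, y i ^ α i ≤ μ ^ (k - ∑ i, α i) * y j ^ ∑ i, α i := by
        gcongr
        exact prod_pow_le_pow_sum (fun i _ => hy i) (fun i _ => hj i (Finset.mem_univ i)) α
    _ ≤ μ ^ k + y j ^ k := pow_mul_pow_sub_le_add hμ (hy j) hα
    _ ≤ _ := by
        gcongr
        exact Finset.single_le_sum (f := fun j => y j ^ k) (fun i _ => pow_nonneg (hy i) k)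
          (Finset.mem_univ j)

/-- The index γ contains at least one tangential factor. If the largest tangential y_j is small
relative to y₀, that factor gains ε; otherwise y₀ itself is controlled by y_j. -/
theorem prod_pow_le_eps {y : Fin d → ℝ} (hy : ∀ i, 0 ≤ y i) {ε : ℝ} (hε : 0 < ε) (hε1 : ε ≤ 1)
    {k : ℕ} {γ : MultiIdx d} (hγ : ∑ i, γ i = k) (hne : γ ≠ Pi.single 0 k) :
    ∏ i, y i ^ γ i ≤ ε * y 0 ^ k + (ε ^ k)⁻¹ * ∑ j ∈ Finset.univ.erase 0, y j ^ k := by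
  have hsum : γ 0 + ∑ i ∈ Finset.univ.erase 0, γ i = k := by
    rw [Finset.add_sum_erase _ _ (Finset.mem_univ 0), hγ]
  have hpos : ∑ i ∈ Finset.univ.erase 0, γ i ≠ 0 := by
    intro h0
    refine hne (funext fun i => ?_)
    by_cases hi : i = 0
    · subst hi; simp; omega
    · rw [Pi.single_eq_of_ne hi]
      exact Finset.sum_eq_zero_iff.1 h0 i (by simp [hi])
  obtain ⟨i0, hi0, -⟩ := Finset.exists_ne_zero_of_sum_ne_zero hpos
  obtain ⟨j, hj, hmax⟩ := Finset.exists_max_image (Finset.univ.erase 0) y ⟨i0, hi0⟩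
  set l := ∑ i ∈ Finset.univ.erase 0, γ i with hl
  have h1 : ∏ i, y i ^ γ i ≤ y 0 ^ γ 0 * y j ^ l := by
    rw [← Finset.mul_prod_erase _ _ (Finset.mem_univ 0)]
    gcongr
    · exact pow_nonneg (hy 0) _
    · exact prod_pow_le_pow_sum (fun i _ => hy i) hmax γ
  have h2 : y j ^ k ≤ ∑ j ∈ Finset.univ.erase 0, y j ^ k :=
    Finset.single_le_sum (f := fun j => y j ^ k) (fun i _ => pow_nonneg (hy i) k) hj
  have hyj := hy j
  have hy0 := hy 0
  refine h1.trans ?_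
  rcases le_total (y j) (ε * y 0) with h | h
  · calc y 0 ^ γ 0 * y j ^ l ≤ y 0 ^ γ 0 * (ε * y 0) ^ l := by gcongr
      _ = ε ^ l * y 0 ^ k := by rw [mul_pow, ← hsum, pow_add]; ring
      _ ≤ ε * y 0 ^ k := by
          gcongr
          exact pow_le_of_le_one hε.le hε1 hpos
      _ ≤ _ := le_add_of_nonneg_right (mul_nonneg (by positivity)
          (Finset.sum_nonneg fun i _ => pow_nonneg (hy i) k))
  · have h3 : y 0 ≤ ε⁻¹ * y j := by rwa [inv_mul_eq_div, le_div_iff₀ hε, mul_comm]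
    calc y 0 ^ γ 0 * y j ^ l ≤ (ε⁻¹ * y j) ^ γ 0 * (ε⁻¹ * y j) ^ l := by
          gcongr
          exact le_mul_of_one_le_left hyj ((one_le_inv₀ hε).2 hε1)
      _ = (ε ^ k)⁻¹ * y j ^ k := by rw [← pow_add, hsum, mul_pow, inv_pow]
      _ ≤ (ε ^ k)⁻¹ * ∑ j ∈ Finset.univ.erase 0, y j ^ k := by gcongr
      _ ≤ _ := le_add_of_nonneg_left (by positivity)

/-- All derivatives up to order k are controlled by the function and the pure derivatives of order
k. The parameter μ, later λ^{1/m}, carries the scaling in λ. -/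
theorem IsLimitJet.mul_norm_sq_le {I : Set (MultiIdx d)} {a : MultiIdx d → L2X d n} {k : ℕ}
    (ha : IsLimitJet I a) (hI : ∀ α : MultiIdx d, ∑ i, α i ≤ k → α ∈ I) {μ : ℝ} (hμ : 0 ≤ μ)
    {α : MultiIdx d} (hα : ∑ i, α i ≤ k) :
    μ ^ (k - ∑ i, α i) * ‖a α‖ ^ 2 ≤ μ ^ k * ‖a 0‖ ^ 2 + ∑ j, ‖a (Pi.single j k)‖ ^ 2 := by
  rcases (pow_nonneg hμ (k - ∑ i, α i)).eq_or_lt with h0 | h0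
  · rw [← h0, zero_mul]; positivity
  have hsplit : ∀ F : Option (Fin d) → ℝ, ∑ o : Option (Fin d),
      ((μ ^ (k - ∑ i, α i))⁻¹ * o.elim (μ ^ k) fun _ => 1) * F o =
        (μ ^ (k - ∑ i, α i))⁻¹ * (μ ^ k * F none + ∑ j, F (some j)) := by
    intro F
    rw [Fintype.sum_option, mul_add, Finset.mul_sum]
    simp [mul_assoc]
  have h := ha.norm_sq_le (hI α hα) (Finset.univ : Finset (Option (Fin d)))
    (fun o => (μ ^ (k - ∑ i, α i))⁻¹ * o.elim (μ ^ k) fun _ => 1)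
    (fun o => o.elim 0 fun j => Pi.single j k)
    (fun o _ => hI _ (by cases o <;> simp)) (fun ξ => by
      rw [hsplit, le_inv_mul_iff₀ h0]
      simp only [Option.elim_none, Option.elim_some, norm_fourierSymbol_single_sq]
      rw [norm_fourierSymbol_sq, norm_fourierSymbol_sq]
      have := mul_prod_pow_le (fun i => sq_nonneg (2 * Real.pi * ξ i)) hμ hα
      simpa only [Pi.zero_apply, pow_zero, Finset.prod_const_one, mul_one] using this)
  rw [hsplit fun o => ‖a (o.elim 0 fun j => Pi.single j k)‖ ^ 2, le_inv_mul_iff₀ h0] at h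
  exact h

/-- Among the derivatives of top order only the pure normal one is not small relative to itself plus
tangential ones; this is what permits its absorption later. -/
theorem IsLimitJet.norm_sq_le_eps {I : Set (MultiIdx d)} {a : MultiIdx d → L2X d n} {k : ℕ}
    (ha : IsLimitJet I a) (hI : ∀ α : MultiIdx d, ∑ i, α i ≤ k → α ∈ I) {ε : ℝ} (hε : 0 < ε)
    (hε1 : ε ≤ 1) {γ : MultiIdx d} (hγ : ∑ i, γ i = k) (hne : γ ≠ Pi.single 0 k) :
    ‖a γ‖ ^ 2 ≤ ε * ‖a (Pi.single 0 k)‖ ^ 2 +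
      (ε ^ k)⁻¹ * ∑ j ∈ Finset.univ.erase 0, ‖a (Pi.single j k)‖ ^ 2 := by
  have hsplit : ∀ F : Fin d → ℝ, ∑ j, (if j = 0 then ε else (ε ^ k)⁻¹) * F j =
      ε * F 0 + (ε ^ k)⁻¹ * ∑ j ∈ Finset.univ.erase 0, F j := by
    intro F
    rw [← Finset.add_sum_erase _ _ (Finset.mem_univ 0), if_pos rfl, Finset.mul_sum]
    congr 1
    exact Finset.sum_congr rfl fun j hj => by rw [if_neg (Finset.ne_of_mem_erase hj)]
  rw [← hsplit fun j => ‖a (Pi.single j k)‖ ^ 2]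
  refine ha.norm_sq_le (hI γ hγ.le) _ _ _ (fun j _ => hI _ (by simp)) fun ξ => ?_
  rw [hsplit fun j => ‖fourierSymbol (Pi.single j k) ξ‖ ^ 2]
  simp only [norm_fourierSymbol_single_sq]
  rw [norm_fourierSymbol_sq]
  exact prod_pow_le_eps (fun i => sq_nonneg (2 * Real.pi * ξ i)) hε hε1 hγ hne

end Interpolation

/-! ### Coercivity of the leading operator and the sign of the zero-order term. -/

section Estimates

open scoped InnerProductSpace

variable {d n m : ℕ} {M : MultiIdx d → MultiIdx d → ℝ → Cvec n →L[ℂ] Cvec n}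

/-- The leading operator applied to a family of derivatives. -/
noncomputable def leadingOp (m : ℕ) (hM : ∀ α β, BddCoeff (M α β)) (b : MultiIdx d → L2X d n) :
    L2X d n :=
  ∑ α ∈ multiIdx d m, ∑ β ∈ multiIdx d m, (hM α β).op d (b (α + β))

theorem sum_add_of_mem_multiIdx {α β : MultiIdx d} (hα : α ∈ multiIdx d m)
    (hβ : β ∈ multiIdx d m) : ∑ i, (α + β : MultiIdx d) i = 2 * m := by
  rw [mem_multiIdx] at hα hβ
  simp only [Pi.add_apply, Finset.sum_add_distrib]
  omega

theorem apply_le_of_mem_multiIdx {α : MultiIdx d} (hα : α ∈ multiIdx d m) (i : Fin d) :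
    α i ≤ m :=
  (Finset.single_le_sum (fun i _ => Nat.zero_le (α i)) (Finset.mem_univ i)).trans
    (mem_multiIdx.1 hα).le

theorem norm_leadingOp_le {hM : ∀ α β, BddCoeff (M α β)} {C : ℝ} (hC : ∀ α β t, ‖M α β t‖ ≤ C)
    {b : MultiIdx d → L2X d n} {R : ℝ} (hR : ∀ γ : MultiIdx d, ∑ i, γ i = 2 * m → ‖b γ‖ ≤ R) :
    ‖leadingOp m hM b‖ ≤ ((multiIdx d m).card ^ 2 * C) * R := by
  have hC0 : ∀ α β : MultiIdx d, 0 ≤ C := fun α β => (norm_nonneg _).trans (hC α β 0)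
  calc ‖leadingOp m hM b‖ ≤ ∑ α ∈ multiIdx d m, ∑ β ∈ multiIdx d m, C * R := by
        refine (norm_sum_le _ _).trans (Finset.sum_le_sum fun α hα => (norm_sum_le _ _).trans
          (Finset.sum_le_sum fun β hβ => ((hM α β).norm_op_le (hC α β) _).trans ?_))
        exact mul_le_mul_of_nonneg_left (hR _ (sum_add_of_mem_multiIdx hα hβ)) (hC0 α β)
    _ = _ := by simp only [Finset.sum_const, nsmul_eq_mul]; ring

/-- Ellipticity in the normal direction. -/
theorem le_re_inner_op_single {δ : ℝ} (hM : ∀ α β, BddCoeff (M α β))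
    (hLH : ∀ (t : ℝ) (ξ : EuclideanSpace ℝ (Fin d)) (θ : Cvec n),
      δ * ‖ξ‖ ^ (2 * m) * ‖θ‖ ^ 2 ≤ (∑ α ∈ multiIdx d m, ∑ β ∈ multiIdx d m,
        (((∏ i, ξ i ^ α i) * (∏ i, ξ i ^ β i) : ℝ) : ℂ) * ⟪θ, M α β t θ⟫_ℂ).re)
    (j : Fin d) (g : L2X d n) :
    δ * ‖g‖ ^ 2 ≤ (⟪g, (hM (Pi.single j m) (Pi.single j m)).op d g⟫_ℂ).re := by
  have hprod : ∀ α ∈ multiIdx d m, α ≠ Pi.single j m →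
      ∏ i, (EuclideanSpace.single j (1 : ℝ) : EuclideanSpace ℝ (Fin d)) i ^ α i = 0 := by
    intro α hα hne
    obtain ⟨i, hi, hi0⟩ : ∃ i, i ≠ j ∧ α i ≠ 0 := by
      by_contra! h
      refine hne (funext fun i => ?_)
      by_cases hi : i = j
      · subst hi
        rw [Pi.single_eq_same, ← mem_multiIdx.1 hα]
        exact (Finset.sum_eq_single i (fun k _ hk => h k hk) (by simp)).symm
      · rw [h i hi, Pi.single_eq_of_ne hi]
    exact Finset.prod_eq_zero (Finset.mem_univ i) (by simp [hi, hi0])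
  have hone : ∏ i, (EuclideanSpace.single j (1 : ℝ) : EuclideanSpace ℝ (Fin d)) i ^
      (Pi.single j m : MultiIdx d) i = 1 := by
    refine Finset.prod_eq_one fun i _ => ?_
    by_cases hi : i = j
    · subst hi; simp
    · simp [hi]
  have hj : (Pi.single j m : MultiIdx d) ∈ multiIdx d m := by simp [mem_multiIdx]
  have hpt : ∀ (t : ℝ) (θ : Cvec n),
      δ * ‖θ‖ ^ 2 ≤ (⟪θ, M (Pi.single j m) (Pi.single j m) t θ⟫_ℂ).re := by
    intro t θ
    -- At ξ = e_j all monomials vanish except those with α = β = m e_j.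
    have h := hLH t (EuclideanSpace.single j 1) θ
    rw [Finset.sum_eq_single_of_mem _ hj, Finset.sum_eq_single_of_mem _ hj, hone] at h
    · simpa using h
    · intro β hβ hne
      rw [hprod β hβ hne]; simp
    · intro α hα hne
      refine Finset.sum_eq_zero fun β _ => ?_
      rw [hprod α hα hne]; simp
  have h1 : ‖g‖ ^ 2 = ∫ p, ‖g p‖ ^ 2 := by
    have := L2.inner_def (𝕜 := ℂ) g g
    rw [inner_self_eq_norm_sq_to_K] at this
    simp only [inner_self_eq_norm_sq_to_K] at this
    have h2 := congrArg Complex.re this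
    norm_cast at h2
  have h2 := L2.inner_def (𝕜 := ℂ) g ((hM (Pi.single j m) (Pi.single j m)).op d g)
  have h3 := L2.integrable_inner (𝕜 := ℂ) g ((hM (Pi.single j m) (Pi.single j m)).op d g)
  rw [h1, h2, ← integral_const_mul]
  have h4 : (∫ p, ⟪g p, ((hM (Pi.single j m) (Pi.single j m)).op d g) p⟫_ℂ).re =
    ∫ p, (⟪g p, ((hM (Pi.single j m) (Pi.single j m)).op d g) p⟫_ℂ).re :=
    (integral_re h3).symm
  rw [h4]
  refine integral_mono_ae (((Lp.memLp g).integrable_norm_pow (by norm_num)).const_mul δ) h3.re ?_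
  filter_upwards [(hM (Pi.single j m) (Pi.single j m)).coeFn_op g] with p hp
  rw [hp]
  exact hpt p.1 (g p)

variable [NeZero d] {T : WithTop ℝ} {U : MultiIdx d → SpaceTime d → Cvec n}

theorem WeakJet.inner_op_congr {N : ℕ} (hU : WeakJet N T U) {A : ℝ → Cvec n →L[ℂ] Cvec n}
    (hA : BddCoeff A) {f g : L2X d n} (h : ∀ᵐ p, p ∈ halfCyl d T → f p = g p) (κ : MultiIdx d) :
    ⟪hU.toL2 κ, hA.op d f⟫_ℂ = ⟪hU.toL2 κ, hA.op d g⟫_ℂ := by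
  rw [L2.inner_def, L2.inner_def]
  refine integral_congr_ae ?_
  filter_upwards [h, hU.ae_toL2_eq_zero κ, hA.coeFn_op f, hA.coeFn_op g] with p h1 h2 h3 h4
  by_cases hp : p ∈ halfCyl d T
  · simp only [h3, h4, h1 hp]
  · simp only [h2 hp, inner_zero_left]

theorem WeakJet.inner_congr_right {N : ℕ} (hU : WeakJet N T U) {f g : L2X d n}
    (h : ∀ᵐ p, p ∈ halfCyl d T → f p = g p) (κ : MultiIdx d) :
    ⟪hU.toL2 κ, f⟫_ℂ = ⟪hU.toL2 κ, g⟫_ℂ := by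
  simpa only [bddCoeff_id_op] using hU.inner_op_congr (bddCoeff_id n) h κ

theorem WeakJet.norm_le_of_ae_eq {N : ℕ} (hU : WeakJet N T U) {f : L2X d n} {κ : MultiIdx d}
    (h : ∀ᵐ p, p ∈ halfCyl d T → f p = hU.toL2 κ p) : ‖hU.toL2 κ‖ ≤ ‖f‖ := by
  refine Lp.norm_le_norm_of_ae_le ?_
  filter_upwards [h, hU.ae_toL2_eq_zero κ] with p h1 h2
  by_cases hp : p ∈ halfCyl d T
  · rw [h1 hp]
  · rw [h2 hp, norm_zero]; exact norm_nonneg _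

/-- Coercivity of the leading operator, tested with an even tangential derivative. -/
theorem WeakJet.le_re_inner_leadingOp (hU : WeakJet (2 * m) T U)
    (htr : ∀ j < m, HasZeroTrace T (U (Pi.single 0 j))) {δ : ℝ} (hδ : 0 ≤ δ)
    (hM : ∀ α β, BddCoeff (M α β))
    (hLH : ∀ (t : ℝ) (ξ : EuclideanSpace ℝ (Fin d)) (θ : Cvec n),
      δ * ‖ξ‖ ^ (2 * m) * ‖θ‖ ^ 2 ≤ (∑ α ∈ multiIdx d m, ∑ β ∈ multiIdx d m,
        (((∏ i, ξ i ^ α i) * (∏ i, ξ i ^ β i) : ℝ) : ℂ) * ⟪θ, M α β t θ⟫_ℂ).re)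
    {κ : MultiIdx d} (hκ : ∑ i, κ i ≤ m) (hκ0 : κ 0 = 0) (j : Fin d) :
    δ * ‖hU.toL2 (κ + Pi.single j m)‖ ^ 2 ≤
      ((-1 : ℂ) ^ (∑ i, κ i + m) * ⟪hU.toL2 (κ + κ), leadingOp m hM hU.toL2⟫_ℂ).re := by
  obtain ⟨C, -, hC⟩ := exists_reflection_jet d n (2 * m)
  obtain ⟨a, ha, haU⟩ := hC T U hU
  have hu := hU.isLimitJet_toL2 htr
  -- Gårding is applied to the zero extension of D^κu. As κ is tangential, κ + α still has normal
  -- order at most m, so these derivatives do not jump at the boundary.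
  have hG := (hu.shift κ).garding hδ hM hLH (fun α hα => by
    have h1 := apply_le_of_mem_multiIdx hα 0
    rw [mem_multiIdx] at hα
    refine ⟨?_, ?_⟩
    · simp only [Pi.add_apply, Finset.sum_add_distrib]; omega
    · simpa [hκ0] using h1) j
  refine hG.trans (le_of_eq (congrArg Complex.re ?_))
  rw [leadingOp, inner_sum, Finset.mul_sum]
  refine Finset.sum_congr rfl fun α hα => ?_
  rw [inner_sum, Finset.mul_sum]
  refine Finset.sum_congr rfl fun β hβ => ?_
  have hα0 := apply_le_of_mem_multiIdx hα 0
  have hα1 := mem_multiIdx.1 hα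
  have hβ1 := mem_multiIdx.1 hβ
  have hs : ∀ α β : MultiIdx d, ∑ i, (α + β : MultiIdx d) i = ∑ i, α i + ∑ i, β i :=
    fun α β => by simp [Finset.sum_add_distrib]
  have h1 : ∑ i, (α + β : MultiIdx d) i ≤ 2 * m := by rw [hs]; omega
  have h2 : ∑ i, (κ + β : MultiIdx d) i ≤ 2 * m := by rw [hs]; omega
  -- The left factor is extended by zero, hence the limit on its normal order; the right factor, of
  -- normal order up to 2m, is the reflected one. The passage from (2κ, α + β) to (κ + α, κ + β) has
  -- sign (-1)^{|κ| + m}.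
  have e := hu.inner_op_eq ha (hM α β) (α := κ + κ) (γ := κ + α) (β := α + β) (κ := κ + β)
    ⟨by rw [hs]; omega, by simp [hκ0]⟩ ⟨by rw [hs]; omega, by simpa [hκ0] using hα0⟩ h1 h2
    (by abel)
  rw [hU.inner_op_congr (hM α β) (haU _ h1).2.1, hU.inner_op_congr (hM α β) (haU _ h2).2.1] at e
  rw [e, ← mul_assoc, ← pow_add, hs, hs, hα1,
    show ∑ i, κ i + m + (∑ i, κ i + ∑ i, κ i + (∑ i, κ i + m)) = 2 * (2 * ∑ i, κ i + m) by ring,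
    pow_mul]
  simp

/-- Moving m derivatives across gives ‖D_j^m u‖², by zero extension of u on one side and reflection
on the other. -/
theorem WeakJet.re_inner_single_zero_nonneg (hU : WeakJet (2 * m) T U)
    (htr : ∀ j < m, HasZeroTrace T (U (Pi.single 0 j))) (j : Fin d) :
    0 ≤ (⟪((-1 : ℂ) ^ m) • hU.toL2 (Pi.single j (2 * m)), hU.toL2 0⟫_ℂ).re := by
  obtain ⟨C, -, hC⟩ := exists_reflection_jet d n (2 * m)
  obtain ⟨a, ha, haU⟩ := hC T U hU
  have hu := hU.isLimitJet_toL2 htr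
  have hm : ∑ i, (Pi.single j m : MultiIdx d) i ≤ 2 * m := by simp; omega
  have h2m : ∑ i, (Pi.single j (2 * m) : MultiIdx d) i ≤ 2 * m := by simp
  have e := hu.inner_eq ha (α := 0) (γ := Pi.single j m) (β := Pi.single j (2 * m))
    (κ := Pi.single j m) (by simp) ⟨hm, by
      by_cases hj : 0 = j
      · subst hj; simp
      · simp [hj]⟩ h2m hm
    (by rw [zero_add, ← Pi.single_add, two_mul])
  rw [hU.inner_congr_right (haU _ h2m).2.1, hU.inner_congr_right (haU _ hm).2.1] at e
  have h1 : (⟪((-1 : ℂ) ^ m) • hU.toL2 (Pi.single j (2 * m)), hU.toL2 0⟫_ℂ).re =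
      (⟪hU.toL2 0, ((-1 : ℂ) ^ m) • hU.toL2 (Pi.single j (2 * m))⟫_ℂ).re :=
    inner_re_symm (𝕜 := ℂ) _ _
  rw [h1, inner_smul_right, e, ← mul_assoc, ← pow_add]
  have h3 : m + (∑ i, (0 : MultiIdx d) i + ∑ i, (Pi.single j m : MultiIdx d) i) = 2 * m := by
    simp; omega
  rw [h3, pow_mul]
  simpa using inner_self_nonneg (𝕜 := ℂ) (x := hU.toL2 (Pi.single j m))

end Estimates

/-! ### The a priori estimate. -/

section MainEstimate

open scoped InnerProductSpace

variable {d n m : ℕ} {M : MultiIdx d → MultiIdx d → ℝ → Cvec n →L[ℂ] Cvec n}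

theorem eq_single_of_add_eq_single {α β : MultiIdx d} (hα : α ∈ multiIdx d m) {j : Fin d} {k : ℕ}
    (h : α + β = Pi.single j k) : α = Pi.single j m := by
  have h0 : ∀ i, i ≠ j → α i = 0 := fun i hi => by
    have := congrFun h i
    rw [Pi.single_eq_of_ne hi, Pi.add_apply] at this
    omega
  funext i
  by_cases hi : i = j
  · subst hi
    rw [Pi.single_eq_same, ← mem_multiIdx.1 hα]
    exact (Finset.sum_eq_single i (fun k _ hk => h0 k hk) (by simp)).symm
  · rw [h0 i hi, Pi.single_eq_of_ne hi]

/-- The index 2m e_j arises from |α| = |β| = m only for α = β = m e_j, so a single coefficient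
multiplies the pure derivative. -/
theorem leadingOp_eq_add (hM : ∀ α β, BddCoeff (M α β)) (b : MultiIdx d → L2X d n) (j : Fin d) :
    leadingOp m hM b = (hM (Pi.single j m) (Pi.single j m)).op d (b (Pi.single j (2 * m))) +
      leadingOp m hM fun γ => if γ = Pi.single j (2 * m) then 0 else b γ := by
  have hj : (Pi.single j m : MultiIdx d) ∈ multiIdx d m := by simp [mem_multiIdx]
  have hjj : (Pi.single j m + Pi.single j m : MultiIdx d) = Pi.single j (2 * m) := by
    rw [← Pi.single_add, two_mul]
  rw [← sub_eq_iff_eq_add, leadingOp, leadingOp, ← Finset.sum_sub_distrib]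
  simp_rw [← Finset.sum_sub_distrib, ← map_sub]
  rw [Finset.sum_eq_single_of_mem _ hj, Finset.sum_eq_single_of_mem _ hj, hjj, if_pos rfl, sub_zero]
  · intro β hβ hne
    rw [if_neg, sub_self, map_zero]
    exact fun h => hne (eq_single_of_add_eq_single hβ (by rwa [add_comm] at h))
  · intro α hα hne
    refine Finset.sum_eq_zero fun β _ => ?_
    rw [if_neg, sub_self, map_zero]
    exact fun h => hne (eq_single_of_add_eq_single hα h)

theorem mul_le_of_mul_sq_le {c x F : ℝ} (hx : 0 ≤ x) (hF : 0 ≤ F) (h : c * x ^ 2 ≤ x * F) :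
    c * x ≤ F := by
  rcases hx.eq_or_lt with h0 | h0
  · rw [← h0, mul_zero]; exact hF
  · refine le_of_mul_le_mul_left ?_ h0
    linarith [h, show x * (c * x) = c * x ^ 2 by ring]

theorem sq_add_sq_le_sq_add {x y : ℝ} (hx : 0 ≤ x) (hy : 0 ≤ y) : x ^ 2 + y ^ 2 ≤ (x + y) ^ 2 := by
  nlinarith [mul_nonneg hx hy]

theorem sum_sq_le_sq_card_mul {ι : Type*} {s : Finset ι} {x : ι → ℝ} {R : ℝ}
    (hx : ∀ i ∈ s, 0 ≤ x i) (hR : ∀ i ∈ s, x i ≤ R) :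
    ∑ i ∈ s, x i ^ 2 ≤ (s.card * R) ^ 2 := by
  calc ∑ i ∈ s, x i ^ 2 ≤ (∑ i ∈ s, x i) ^ 2 := Finset.sum_sq_le_sq_sum_of_nonneg hx
    _ ≤ _ := by
      refine pow_le_pow_left₀ (Finset.sum_nonneg hx) ?_ 2
      simpa using Finset.sum_le_card_nsmul s x R hR

/-- The a priori estimate for the derivatives of highest order in the normal direction. -/
theorem exists_normal_bound (d n m : ℕ) [NeZero d] {δ C : ℝ} (hδ : 0 < δ) (hC0 : 0 ≤ C) :
    ∃ K : ℝ, 0 ≤ K ∧ ∀ (T : WithTop ℝ) (U : MultiIdx d → SpaceTime d → Cvec n)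
      (hU : WeakJet (2 * m) T U) (M : MultiIdx d → MultiIdx d → ℝ → Cvec n →L[ℂ] Cvec n)
      (hM : ∀ α β, BddCoeff (M α β)) (_ : ∀ α β t, ‖M α β t‖ ≤ C) (F : ℝ),
      (∀ t (ξ : EuclideanSpace ℝ (Fin d)) (θ : Cvec n),
        δ * ‖ξ‖ ^ (2 * m) * ‖θ‖ ^ 2 ≤ (∑ α ∈ multiIdx d m, ∑ β ∈ multiIdx d m,
          (((∏ i, ξ i ^ α i) * (∏ i, ξ i ^ β i) : ℝ) : ℂ) * ⟪θ, M α β t θ⟫_ℂ).re) →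
      (∀ j, j ≠ 0 → δ * ‖hU.toL2 (Pi.single j (2 * m))‖ ≤ F) → 0 ≤ F →
      (⟪hU.toL2 (Pi.single 0 (2 * m)), leadingOp m hM hU.toL2⟫_ℂ).re ≤
        ‖hU.toL2 (Pi.single 0 (2 * m))‖ * F →
      ‖hU.toL2 (Pi.single 0 (2 * m))‖ ≤ K * F := by
  obtain ⟨Cr, hCr0, hCr⟩ := exists_reflection_jet d n (2 * m)
  set P : ℝ := ((multiIdx d m).card : ℝ) ^ 2 * C with hP
  have hP0 : 0 ≤ P := by positivity
  -- P bounds the rest of the leading operator and Cr the reflection; this η makes the normal part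
  -- of the rest at most (δ/2)‖D_1^{2m}u‖.
  set η : ℝ := min 1 (δ / (2 * (P * Cr + 1))) with hη
  have hη0 : 0 < η := lt_min one_pos (by positivity)
  have hη1 : η ≤ 1 := min_le_left _ _
  have hηP : P * (η * Cr) ≤ δ / 2 := by
    have h1 : η * (2 * (P * Cr + 1)) ≤ δ := by
      rw [← le_div_iff₀ (by positivity)]; exact min_le_right _ _
    nlinarith
  set D : ℝ := (η ^ (2 * m))⁻¹ * (d * (Cr / δ)) with hD
  have hD0 : 0 ≤ D := by positivity
  refine ⟨2 / δ * (1 + P * D), by positivity, fun T U hU M hM hC F hLH htan hF hre => ?_⟩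
  obtain ⟨a, ha, haU⟩ := hCr T U hU
  set S := ‖hU.toL2 (Pi.single 0 (2 * m))‖ with hS
  have hS0 : 0 ≤ S := norm_nonneg _
  have hj : ∀ j : Fin d, ∑ i, (Pi.single j (2 * m) : MultiIdx d) i ≤ 2 * m := by simp
  have hQ : ∀ γ : MultiIdx d, ∑ i, γ i = 2 * m → γ ≠ Pi.single 0 (2 * m) →
      ‖hU.toL2 γ‖ ≤ η * Cr * S + D * F := by
    intro γ hγ hne
    refine (hU.norm_le_of_ae_eq (haU γ hγ.le).2.1).trans ?_
    refine abs_le_of_sq_le_sq' ?_ (by positivity) |>.2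
    -- The inequality concerns squared norms, so η² is inserted to obtain η after the square root.
    have h1 := ha.norm_sq_le_eps (fun _ h => h) (pow_pos hη0 2) (pow_le_one₀ hη0.le hη1) hγ hne
    have h2 : ‖a (Pi.single 0 (2 * m))‖ ^ 2 ≤ (Cr * S) ^ 2 :=
      pow_le_pow_left₀ (norm_nonneg _) (haU _ (hj 0)).1 2
    have h3 : ∑ j ∈ Finset.univ.erase (0 : Fin d), ‖a (Pi.single j (2 * m))‖ ^ 2 ≤
        (d * (Cr / δ * F)) ^ 2 := by
      refine (sum_sq_le_sq_card_mul (R := Cr / δ * F) (fun _ _ => norm_nonneg _)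
        fun j hj0 => ?_).trans ?_
      · refine ((haU _ (hj j)).1).trans ?_
        have := htan j (Finset.ne_of_mem_erase hj0)
        rw [div_mul_eq_mul_div, mul_div_assoc]
        gcongr
        rwa [le_div_iff₀ hδ, mul_comm]
      · refine pow_le_pow_left₀ (by positivity) ?_ 2
        gcongr
        exact (Finset.card_erase_le).trans (by simp)
    calc ‖a γ‖ ^ 2 ≤ η ^ 2 * (Cr * S) ^ 2 + ((η ^ 2) ^ (2 * m))⁻¹ * (d * (Cr / δ * F)) ^ 2 := by
          refine h1.trans ?_
          gcongr
      _ = (η * Cr * S) ^ 2 + (D * F) ^ 2 := by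
          rw [hD, pow_right_comm η 2 (2 * m)]; ring
      _ ≤ (η * Cr * S + D * F) ^ 2 := by
          exact sq_add_sq_le_sq_add (by positivity) (mul_nonneg hD0 hF)
  have hrest := norm_leadingOp_le (m := m) (hM := hM) hC
    (b := fun γ => if γ = Pi.single 0 (2 * m) then 0 else hU.toL2 γ)
    (R := η * Cr * S + D * F) (fun γ hγ => by
      split_ifs with h
      · rw [norm_zero]; positivity
      · exact hQ γ hγ h)
  have hell := le_re_inner_op_single hM hLH 0 (hU.toL2 (Pi.single 0 (2 * m)))
  rw [leadingOp_eq_add hM _ 0, inner_add_right, Complex.add_re] at hre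
  have hlow := (Complex.abs_re_le_norm _).trans ((norm_inner_le_norm (𝕜 := ℂ)
    (hU.toL2 (Pi.single 0 (2 * m))) (leadingOp m hM fun γ => if γ = Pi.single 0 (2 * m) then 0
      else hU.toL2 γ)).trans (mul_le_mul_of_nonneg_left hrest hS0))
  have hlow2 := neg_le_of_abs_le hlow
  rw [← hP] at hlow2
  have h5 : δ * S ^ 2 ≤ S * (F + P * (η * Cr * S + D * F)) := by linarith
  have h6 := mul_le_of_mul_sq_le hS0 (by positivity) h5
  -- Absorption of the normal part into the ellipticity term.
  have h7 : δ / 2 * S ≤ (1 + P * D) * F := by nlinarith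
  calc S = 2 / δ * (δ / 2 * S) := by field_simp
    _ ≤ 2 / δ * ((1 + P * D) * F) := by gcongr
    _ = _ := by ring

/-- It converts the weights of the theorem into the integer powers of μ = λ^{1/m} used in the
interpolation inequality. -/
theorem rpow_interpolation_sq {lam : ℝ} (hlam : 0 ≤ lam) (hm : 0 < m) {k : ℕ} (hk : k ≤ 2 * m) :
    (lam ^ (1 - (k : ℝ) / (2 * (m : ℝ)))) ^ 2 = (lam ^ (1 / (m : ℝ))) ^ (2 * m - k) := by
  have hm' : (m : ℝ) ≠ 0 := by exact_mod_cast hm.ne'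
  rw [← Real.rpow_mul_natCast hlam, ← Real.rpow_mul_natCast hlam]
  congr 1
  push_cast [hk]
  field_simp

/-- The equation is tested with u: the time derivative and the leading part contribute
nonnegatively. -/
theorem WeakJet.mul_norm_zero_le [NeZero d] {T : WithTop ℝ}
    {U : MultiIdx d → SpaceTime d → Cvec n} (hU : WeakJet (2 * m) T U)
    (htr : ∀ j < m, HasZeroTrace T (U (Pi.single 0 j))) (hM : ∀ α β, BddCoeff (M α β))
    {w : SpaceTime d → Cvec n} (hw : MemLp w 2 (volume.restrict (halfCyl d T)))
    (hdt : HasWeakDt (halfCyl d T) (U 0) w) {lam : ℝ} {f : L2X d n}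
    (hf : f = (memLp_zeroExt_iff.2 hw).toLp _ + (-1 : ℂ) ^ m • leadingOp m hM hU.toL2 +
      (lam : ℂ) • hU.toL2 0)
    {δ : ℝ} (hδ : 0 ≤ δ)
    (hLH : ∀ (t : ℝ) (ξ : EuclideanSpace ℝ (Fin d)) (θ : Cvec n),
      δ * ‖ξ‖ ^ (2 * m) * ‖θ‖ ^ 2 ≤ (∑ α ∈ multiIdx d m, ∑ β ∈ multiIdx d m,
        (((∏ i, ξ i ^ α i) * (∏ i, ξ i ^ β i) : ℝ) : ℂ) * ⟪θ, M α β t θ⟫_ℂ).re) :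
    lam * ‖hU.toL2 0‖ ≤ ‖f‖ := by
  set W : L2X d n := (memLp_zeroExt_iff.2 hw).toLp _ with hW
  refine mul_le_of_mul_sq_le (norm_nonneg _) (norm_nonneg _) ?_
  have h1 := hU.re_inner_weakDt_nonneg hw hdt
  have h2 := hU.le_re_inner_leadingOp htr hδ hM hLH (κ := 0) (by simp) rfl 0
  have h3 : (⟪hU.toL2 0, f⟫_ℂ).re = (⟪hU.toL2 0, W⟫_ℂ).re +
      ((-1 : ℂ) ^ (∑ i, (0 : MultiIdx d) i + m) *
        ⟪hU.toL2 (0 + 0), leadingOp m hM hU.toL2⟫_ℂ).re + lam * ‖hU.toL2 0‖ ^ 2 := by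
    rw [hf, inner_add_right, inner_add_right, inner_smul_right, inner_smul_right,
      inner_self_eq_norm_sq_to_K, Complex.add_re, Complex.add_re]
    congr 1
    · simp
    · rw [Complex.re_ofReal_mul]
      congr 1
      norm_cast
  have h4 := (Complex.re_le_norm _).trans (norm_inner_le_norm (𝕜 := ℂ) (hU.toL2 0) f)
  have h5 : 0 ≤ δ * ‖hU.toL2 (0 + Pi.single 0 m)‖ ^ 2 := by positivity
  linarith

/-- The equation is tested with (-1)^m D_j^{2m}u. The terms u_t and λu contribute nonnegatively and
are dropped, and the two signs in front of the leading part cancel. -/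
theorem WeakJet.re_inner_single_leadingOp_le [NeZero d] {T : WithTop ℝ}
    {U : MultiIdx d → SpaceTime d → Cvec n} (hU : WeakJet (2 * m) T U)
    (htr : ∀ j < m, HasZeroTrace T (U (Pi.single 0 j))) (hM : ∀ α β, BddCoeff (M α β))
    {w : SpaceTime d → Cvec n} (hw : MemLp w 2 (volume.restrict (halfCyl d T)))
    (hdt : HasWeakDt (halfCyl d T) (U 0) w) {lam : ℝ} (hlam : 0 ≤ lam) {f : L2X d n}
    (hf : f = (memLp_zeroExt_iff.2 hw).toLp _ + (-1 : ℂ) ^ m • leadingOp m hM hU.toL2 +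
      (lam : ℂ) • hU.toL2 0) (j : Fin d) :
    (⟪hU.toL2 (Pi.single j (2 * m)), leadingOp m hM hU.toL2⟫_ℂ).re ≤
      ‖hU.toL2 (Pi.single j (2 * m))‖ * ‖f‖ := by
  set W : L2X d n := (memLp_zeroExt_iff.2 hw).toLp _ with hW
  have h1 := hU.re_inner_single_weakDt_nonneg htr hw hdt j
  have h2 := hU.re_inner_single_zero_nonneg htr j
  set g := (-1 : ℂ) ^ m • hU.toL2 (Pi.single j (2 * m)) with hg
  have hgn : ‖g‖ = ‖hU.toL2 (Pi.single j (2 * m))‖ := by rw [hg, norm_smul]; simp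
  have h3 : (⟪g, f⟫_ℂ).re = (⟪g, W⟫_ℂ).re +
      (⟪hU.toL2 (Pi.single j (2 * m)), leadingOp m hM hU.toL2⟫_ℂ).re +
        lam * (⟪g, hU.toL2 0⟫_ℂ).re := by
    rw [hf, inner_add_right, inner_add_right, inner_smul_right (r := (lam : ℂ)), Complex.add_re,
      Complex.add_re, Complex.re_ofReal_mul]
    congr 3
    rw [hg, inner_smul_left, inner_smul_right, ← mul_assoc]
    simp [← mul_pow]
  have h4 := (Complex.re_le_norm _).trans (norm_inner_le_norm (𝕜 := ℂ) g f)
  rw [hgn] at h4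
  have h5 := mul_nonneg hlam h2
  linarith

theorem exists_main_bound (d n m : ℕ) [NeZero d] (hm : 0 < m) {δ C : ℝ} (hδ : 0 < δ)
    (hC0 : 0 ≤ C) :
    ∃ N : ℝ, 0 ≤ N ∧ ∀ (T : WithTop ℝ) (U : MultiIdx d → SpaceTime d → Cvec n)
      (hU : WeakJet (2 * m) T U) (_ : ∀ j < m, HasZeroTrace T (U (Pi.single 0 j)))
      (M : MultiIdx d → MultiIdx d → ℝ → Cvec n →L[ℂ] Cvec n)
      (hM : ∀ α β, BddCoeff (M α β)) (_ : ∀ α β t, ‖M α β t‖ ≤ C)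
      (_ : ∀ t (ξ : EuclideanSpace ℝ (Fin d)) (θ : Cvec n),
        δ * ‖ξ‖ ^ (2 * m) * ‖θ‖ ^ 2 ≤ (∑ α ∈ multiIdx d m, ∑ β ∈ multiIdx d m,
          (((∏ i, ξ i ^ α i) * (∏ i, ξ i ^ β i) : ℝ) : ℂ) * ⟪θ, M α β t θ⟫_ℂ).re)
      (w : SpaceTime d → Cvec n) (hw : MemLp w 2 (volume.restrict (halfCyl d T)))
      (_ : HasWeakDt (halfCyl d T) (U 0) w) (lam : ℝ) (_ : 0 ≤ lam) (f : L2X d n)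
      (_ : f = (memLp_zeroExt_iff.2 hw).toLp _ + (-1 : ℂ) ^ m • leadingOp m hM hU.toL2 +
        (lam : ℂ) • hU.toL2 0),
      ‖(memLp_zeroExt_iff.2 hw).toLp _‖ ≤ N * ‖f‖ ∧ ∀ α : MultiIdx d, ∑ i, α i ≤ 2 * m →
        lam ^ (1 - ((∑ i, α i : ℕ) : ℝ) / (2 * (m : ℝ))) * ‖hU.toL2 α‖ ≤ N * ‖f‖ := by
  obtain ⟨K, hK0, hK⟩ := exists_normal_bound d n m hδ hC0
  obtain ⟨Cr, hCr0, hCr⟩ := exists_reflection_jet d n (2 * m)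
  set P : ℝ := ((multiIdx d m).card : ℝ) ^ 2 * C with hP
  have hP0 : 0 ≤ P := by positivity
  -- The 1 accounts for λ‖u‖ ≤ ‖f‖. Each of the d pure derivatives of order 2m is at most (K +
  -- 1/δ)‖f‖, whether normal or tangential, and Cr is the cost of the reflection.
  set Q : ℝ := Cr * (1 + d * (K + 1 / δ)) with hQ
  have hQ0 : 0 ≤ Q := by positivity
  refine ⟨2 + P * Q + Q, by positivity, fun T U hU htr M hM hC hLH w hw hdt lam hlam f hf => ?_⟩
  obtain ⟨a, ha, haU⟩ := hCr T U hU
  set W : L2X d n := (memLp_zeroExt_iff.2 hw).toLp _ with hW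
  set F := ‖f‖ with hF
  have hF0 : 0 ≤ F := norm_nonneg _
  have hj : ∀ j : Fin d, ∑ i, (Pi.single j (2 * m) : MultiIdx d) i ≤ 2 * m := by simp
  have hzero : lam * ‖hU.toL2 0‖ ≤ F := hU.mul_norm_zero_le htr hM hw hdt hf hδ.le hLH
  have htop := hU.re_inner_single_leadingOp_le htr hM hw hdt hlam hf
  have htan : ∀ j, j ≠ 0 → δ * ‖hU.toL2 (Pi.single j (2 * m))‖ ≤ F := by
    intro j hj0
    refine mul_le_of_mul_sq_le (norm_nonneg _) hF0 (le_trans ?_ (htop j))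
    -- For tangential j the choice κ = m e_j makes 2κ the index of the test function, and the sign
    -- is (-1)^{2m} = 1.
    have h1 := hU.le_re_inner_leadingOp htr hδ.le hM hLH (κ := Pi.single j m) (by simp)
      (by simp [hj0.symm]) j
    rw [← Pi.single_add, ← two_mul] at h1
    refine h1.trans (le_of_eq ?_)
    simp [← two_mul, pow_mul]
  have hnor := hK T U hU M hM hC F hLH htan hF0 (htop 0)
  have hall : ∀ j, ‖hU.toL2 (Pi.single j (2 * m))‖ ≤ (K + 1 / δ) * F := by
    intro j
    by_cases hj0 : j = 0
    · subst hj0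
      refine hnor.trans ?_
      gcongr
      exact le_add_of_nonneg_right (by positivity)
    · have h1 : ‖hU.toL2 (Pi.single j (2 * m))‖ ≤ 1 / δ * F := by
        rw [one_div, le_inv_mul_iff₀ hδ]; exact htan j hj0
      refine h1.trans ?_
      gcongr
      exact le_add_of_nonneg_left hK0
  have hder : ∀ α : MultiIdx d, ∑ i, α i ≤ 2 * m →
      lam ^ (1 - ((∑ i, α i : ℕ) : ℝ) / (2 * (m : ℝ))) * ‖hU.toL2 α‖ ≤ Q * F := by
    intro α hα
    have h1 := hU.norm_le_of_ae_eq (haU α hα).2.1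
    have hμ : 0 ≤ lam ^ (1 / (m : ℝ)) := Real.rpow_nonneg hlam _
    have h2 := ha.mul_norm_sq_le (fun _ h => h) hμ hα
    rw [← rpow_interpolation_sq hlam hm hα] at h2
    -- The case of order zero identifies μ^{2m} with λ².
    have h0 := rpow_interpolation_sq hlam hm (Nat.zero_le (2 * m))
    simp only [Nat.cast_zero, zero_div, sub_zero, tsub_zero, Real.rpow_one] at h0
    rw [← h0] at h2
    have h3 : ‖a 0‖ ≤ Cr * ‖hU.toL2 0‖ := (haU 0 (by simp)).1
    have hd0 : 0 ≤ d * (Cr * ((K + 1 / δ) * F)) := mul_nonneg (Nat.cast_nonneg d)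
      (mul_nonneg hCr0 (mul_nonneg (add_nonneg hK0 (one_div_nonneg.2 hδ.le)) hF0))
    have h4 : ∑ j : Fin d, ‖a (Pi.single j (2 * m))‖ ^ 2 ≤ (d * (Cr * ((K + 1 / δ) * F))) ^ 2 := by
      refine (sum_sq_le_sq_card_mul (R := Cr * ((K + 1 / δ) * F)) (fun _ _ => norm_nonneg _)
        fun j _ => ?_).trans (by simp)
      exact (haU _ (hj j)).1.trans (by gcongr; exact hall j)
    have h5 : lam * ‖a 0‖ ≤ Cr * F := by
      calc lam * ‖a 0‖ ≤ lam * (Cr * ‖hU.toL2 0‖) := by gcongr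
        _ = Cr * (lam * ‖hU.toL2 0‖) := by ring
        _ ≤ Cr * F := by gcongr
    have hpow := Real.rpow_nonneg hlam (1 - ((∑ i, α i : ℕ) : ℝ) / (2 * (m : ℝ)))
    refine (mul_le_mul_of_nonneg_left h1 hpow).trans ?_
    refine abs_le_of_sq_le_sq' ?_ (mul_nonneg hQ0 hF0) |>.2
    rw [mul_pow]
    calc _ ≤ lam ^ 2 * ‖a 0‖ ^ 2 + ∑ j : Fin d, ‖a (Pi.single j (2 * m))‖ ^ 2 := h2
      _ ≤ (Cr * F) ^ 2 + (d * (Cr * ((K + 1 / δ) * F))) ^ 2 := by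
          rw [← mul_pow]
          gcongr
      _ ≤ (Cr * F + d * (Cr * ((K + 1 / δ) * F))) ^ 2 := by
          exact sq_add_sq_le_sq_add (mul_nonneg hCr0 hF0) hd0
      _ = (Q * F) ^ 2 := by rw [hQ]; ring
  refine ⟨?_, fun α hα => (hder α hα).trans ?_⟩
  -- The bound on u_t is read off from the equation: f and λu give the constant 2, the leading part
  -- gives PQ.
  · have h1 : W = f - (-1 : ℂ) ^ m • leadingOp m hM hU.toL2 - (lam : ℂ) • hU.toL2 0 := by
      rw [hf]; abel
    have h2 : ‖leadingOp m hM hU.toL2‖ ≤ P * (Q * F) := norm_leadingOp_le hC fun γ hγ => by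
      have := hder γ hγ.le
      have hm' : (m : ℝ) ≠ 0 := by exact_mod_cast hm.ne'
      -- At order 2m the exponent of λ is zero and λ⁰ = 1 also for λ = 0, so the weighted bound is a
      -- bound for the derivative itself.
      rw [hγ] at this
      push_cast at this
      rwa [div_self (by positivity), sub_self, Real.rpow_zero, one_mul] at this
    calc ‖W‖ ≤ ‖f‖ + ‖(-1 : ℂ) ^ m • leadingOp m hM hU.toL2‖ + ‖(lam : ℂ) • hU.toL2 0‖ := by
          rw [h1]
          exact (norm_sub_le _ _).trans (by gcongr; exact norm_sub_le _ _)
      _ = F + ‖leadingOp m hM hU.toL2‖ + lam * ‖hU.toL2 0‖ := by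
          rw [norm_smul, norm_smul]
          simp [abs_of_nonneg hlam, hF]
      _ ≤ F + P * (Q * F) + F := by gcongr
      _ ≤ (2 + P * Q + Q) * F := by linarith [mul_nonneg hQ0 hF0]
  · gcongr
    linarith [mul_nonneg hP0 hQ0]

end MainEstimate

/-! ### Matrix coefficients as operators on ℂⁿ. -/

section Coefficients

open scoped InnerProductSpace

variable {d n m : ℕ} {δ : ℝ} {A : Coeff d n}

open Classical in
/-- The leading coefficients as operators, extended by zero to all indices. -/
noncomputable def coeffOp (m : ℕ) (A : Coeff d n) (α β : MultiIdx d) (t : ℝ) :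
    Cvec n →L[ℂ] Cvec n :=
  if α ∈ multiIdx d m ∧ β ∈ multiIdx d m then Matrix.toEuclideanCLM (𝕜 := ℂ) (A α β t) else 0

/-- Expansion in matrix units reduces measurability and boundedness of the operators to those of the
entries. -/
theorem toEuclideanCLM_eq_sum (B : Matrix (Fin n) (Fin n) ℂ) :
    Matrix.toEuclideanCLM (𝕜 := ℂ) B =
      ∑ i, ∑ j, B i j • Matrix.toEuclideanCLM (𝕜 := ℂ) (Matrix.single i j (1 : ℂ)) := by
  conv_lhs => rw [Matrix.matrix_eq_sum_single B]
  simp only [map_sum, ← map_smul, Matrix.smul_single, smul_eq_mul, mul_one]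

theorem coeffOp_apply {α β : MultiIdx d} (hα : α ∈ multiIdx d m) (hβ : β ∈ multiIdx d m) (t : ℝ)
    (v : Cvec n) : coeffOp m A α β t v = WithLp.toLp 2 (A α β t *ᵥ v.ofLp) := by
  rw [coeffOp, if_pos ⟨hα, hβ⟩]
  rfl

/-- A bound for operators on `ℂⁿ` whose matrix entries are bounded by `δ⁻¹`. -/
noncomputable def coeffBound (n : ℕ) (δ : ℝ) : ℝ :=
  ∑ i : Fin n, ∑ j : Fin n, δ⁻¹ * ‖Matrix.toEuclideanCLM (𝕜 := ℂ) (Matrix.single i j (1 : ℂ))‖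

theorem coeffBound_nonneg (n : ℕ) {δ : ℝ} (hδ : 0 < δ) : 0 ≤ coeffBound n δ :=
  Finset.sum_nonneg fun _ _ => Finset.sum_nonneg fun _ _ =>
    mul_nonneg (inv_nonneg.2 hδ.le) (norm_nonneg _)

theorem LegendreHadamard.norm_coeffOp_le (hA : LegendreHadamard m δ A) (hδ : 0 < δ)
    (α β : MultiIdx d) (t : ℝ) : ‖coeffOp m A α β t‖ ≤ coeffBound n δ := by
  unfold coeffOp
  split_ifs with h
  · rw [toEuclideanCLM_eq_sum]
    refine (norm_sum_le _ _).trans (Finset.sum_le_sum fun i _ => (norm_sum_le _ _).trans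
      (Finset.sum_le_sum fun j _ => ?_))
    rw [norm_smul]
    gcongr
    exact hA.bounded α h.1 β h.2 t i j
  · rw [norm_zero]; exact coeffBound_nonneg n hδ

theorem LegendreHadamard.bddCoeff (hA : LegendreHadamard m δ A) (hδ : 0 < δ) (α β : MultiIdx d) :
    BddCoeff (coeffOp m A α β) := by
  refine ⟨?_, ⟨_, hA.norm_coeffOp_le hδ α β⟩⟩
  unfold coeffOp
  split_ifs with h
  · simp_rw [toEuclideanCLM_eq_sum (A α β _)]
    exact Finset.aestronglyMeasurable_fun_sum _ fun i _ => Finset.aestronglyMeasurable_fun_sum _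
      fun j _ => (hA.measurable α h.1 β h.2 i j).aestronglyMeasurable.smul_const _
  · exact aestronglyMeasurable_const

theorem LegendreHadamard.le_re_inner (hA : LegendreHadamard m δ A) (t : ℝ)
    (ξ : EuclideanSpace ℝ (Fin d)) (θ : Cvec n) :
    δ * ‖ξ‖ ^ (2 * m) * ‖θ‖ ^ 2 ≤ (∑ α ∈ multiIdx d m, ∑ β ∈ multiIdx d m,
      (((∏ i, ξ i ^ α i) * (∏ i, ξ i ^ β i) : ℝ) : ℂ) * ⟪θ, coeffOp m A α β t θ⟫_ℂ).re := by
  -- The hypothesis conjugates the right-hand vector and the inner product the left-hand one;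
  -- inserting the conjugate of θ reconciles them.
  have h := hA.elliptic t ξ (WithLp.toLp 2 (star θ.ofLp))
  have hn : ‖(WithLp.toLp 2 (star θ.ofLp) : Cvec n)‖ = ‖θ‖ := by
    simp [EuclideanSpace.norm_eq]
  rw [hn] at h
  refine h.trans (le_of_eq (congrArg Complex.re ?_))
  refine Finset.sum_congr rfl fun α hα => Finset.sum_congr rfl fun β hβ => ?_
  rw [coeffOp_apply hα hβ, EuclideanSpace.inner_eq_star_dotProduct]
  congr 1
  simp only [star_star]
  exact dotProduct_comm _ _

end Coefficients

/-! ### From the Sobolev class to jets, and the theorem. -/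

section Conclusion

variable {d n : ℕ} {u : SpaceTime d → Cvec n}

theorem MemW12.hasWeakDt {k : ℕ} {Ω : Set (SpaceTime d)} (hu : MemW12 k Ω u) :
    HasWeakDt Ω u (weakDt Ω u) := by
  rw [weakDt, dif_pos hu.exists_dt]
  exact hu.exists_dt.choose_spec

theorem MemW12.hasWeakDx {k : ℕ} {Ω : Set (SpaceTime d)} (hu : MemW12 k Ω u) {α : MultiIdx d}
    (hα : ∑ i, α i ≤ k) : HasWeakDx Ω α u (weakDx Ω α u) := by
  rw [weakDx, dif_pos (hu.exists_dx α hα)]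
  exact (hu.exists_dx α hα).choose_spec

variable [NeZero d] {T : WithTop ℝ}

theorem MemW12.weakJet {k : ℕ} (hu : MemW12 k (halfCyl d T) u) :
    WeakJet k T fun α => weakDx (halfCyl d T) α u := by
  refine ⟨hu.memLp_dx, fun α i hα => (hu.hasWeakDx (by omega)).of_add (hu.hasWeakDx ?_)⟩
  rwa [sum_add_single]

/-- The derivative of order zero is a chosen representative, hence equals u only almost everywhere
in the cylinder. -/
theorem MemW12.ae_weakDx_zero {k : ℕ} (hu : MemW12 k (halfCyl d T) u) :
    ∀ᵐ p, p ∈ halfCyl d T → weakDx (halfCyl d T) 0 u p = u p := by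
  have h := hu.hasWeakDx (α := 0) (by simp)
  have h0 := (isOpen_halfCyl T).ae_eq_zero_of_integral_contDiff_smul_eq_zero
    (f := fun p => weakDx (halfCyl d T) 0 u p - u p) (h.right_locInt.sub h.left_locInt)
    fun φ h1 h2 h3 => by
      have hb : IsBump φ := ⟨h1, h2⟩
      have e := h.integral_eq φ ⟨h1, h2, h3⟩
      simp only [classDx_eq_multiDeriv, multiDeriv_zero, Pi.zero_apply, Finset.sum_const_zero,
        pow_zero, one_smul] at e
      rw [← setIntegral_eq_integral_of_forall_compl_eq_zero (s := halfCyl d T) fun p hp => by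
        rw [image_eq_zero_of_notMem_tsupport fun h => hp (h3 h), zero_smul]]
      simp_rw [smul_sub]
      rw [integral_sub (hb.integrable_smul (hu.memLp_dx 0 (by simp)))
        (hb.integrable_smul hu.memLp), ← e, sub_self]
  filter_upwards [h0] with p hp hm
  exact sub_eq_zero.1 (hp hm)

theorem MemW12.hasWeakDt_weakDx_zero {k : ℕ} (hu : MemW12 k (halfCyl d T) u) :
    HasWeakDt (halfCyl d T) (weakDx (halfCyl d T) 0 u) (weakDt (halfCyl d T) u) := by
  have h := hu.hasWeakDt
  refine ⟨(hu.hasWeakDx (α := 0) (by simp)).right_locInt, h.right_locInt, fun φ hφ => ?_⟩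
  rw [← h.integral_eq φ hφ]
  refine setIntegral_congr_ae (measurableSet_halfCyl T) ?_
  filter_upwards [hu.ae_weakDx_zero] with p hp hm
  rw [hp hm]

theorem normL2_eq_of_ae_eq {f : L2X d n} {v : SpaceTime d → Cvec n}
    (h : f =ᵐ[volume] zeroExt T v) : normL2 (halfCyl d T) v = ENNReal.ofReal ‖f‖ := by
  rw [ofReal_norm, Lp.enorm_def, eLpNorm_congr_ae h, zeroExt,
    eLpNorm_indicator_eq_eLpNorm_restrict (measurableSet_halfCyl T), normL2]

theorem coeFn_equation {m : ℕ} {δ : ℝ} {A : Coeff d n} (hA : LegendreHadamard m δ A) (hδ : 0 < δ)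
    (hu : MemW12 (2 * m) (halfCyl d T) u) (lam : ℝ) :
    ((memLp_zeroExt_iff.2 hu.memLp_dt).toLp _ +
      (-1 : ℂ) ^ m • leadingOp m (hA.bddCoeff hδ) hu.weakJet.toL2 +
        (lam : ℂ) • hu.weakJet.toL2 0 : L2X d n) =ᵐ[volume]
      zeroExt T (opP m A lam (halfCyl d T) u) := by
  set L : L2X d n := leadingOp m (hA.bddCoeff hδ) hu.weakJet.toL2 with hL
  have hLp : L =ᵐ[volume] zeroExt T (opL0 m A (halfCyl d T) u) := by
    have h1 : ∀ᵐ p, ∀ α ∈ multiIdx d m, ∀ β ∈ multiIdx d m,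
        ((hA.bddCoeff hδ α β).op d (hu.weakJet.toL2 (α + β)) : L2X d n) p =
          coeffOp m A α β p.1 (zeroExt T (weakDx (halfCyl d T) (α + β) u) p) := by
      refine (ae_ball_iff (multiIdx d m).countable_toSet).2 fun α hα =>
        (ae_ball_iff (multiIdx d m).countable_toSet).2 fun β hβ => ?_
      filter_upwards [(hA.bddCoeff hδ α β).coeFn_op (hu.weakJet.toL2 (α + β)),
        hu.weakJet.coeFn_toL2 (sum_add_of_mem_multiIdx hα hβ).le] with p h1 h2
      rw [h1, h2]
    have h2 : ∀ᵐ p, ∀ α ∈ multiIdx d m, (∑ β ∈ multiIdx d m,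
        (hA.bddCoeff hδ α β).op d (hu.weakJet.toL2 (α + β)) : L2X d n) p = ∑ β ∈ multiIdx d m,
          ((hA.bddCoeff hδ α β).op d (hu.weakJet.toL2 (α + β)) : L2X d n) p :=
      (ae_ball_iff (multiIdx d m).countable_toSet).2 fun α _ => by
        filter_upwards [Lp.coeFn_finsetSum (multiIdx d m) fun β =>
          (hA.bddCoeff hδ α β).op d (hu.weakJet.toL2 (α + β))] with p hp
        rw [hp, Finset.sum_apply]
    filter_upwards [h1, h2, Lp.coeFn_finsetSum (multiIdx d m) fun α => ∑ β ∈ multiIdx d m,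
      (hA.bddCoeff hδ α β).op d (hu.weakJet.toL2 (α + β))] with p h1 h2 h3
    rw [hL, leadingOp, h3, Finset.sum_apply]
    have h4 : ∀ α ∈ multiIdx d m, (∑ β ∈ multiIdx d m,
        (hA.bddCoeff hδ α β).op d (hu.weakJet.toL2 (α + β)) : L2X d n) p = ∑ β ∈ multiIdx d m,
          coeffOp m A α β p.1 (zeroExt T (weakDx (halfCyl d T) (α + β) u) p) := fun α hα => by
      rw [h2 α hα]
      exact Finset.sum_congr rfl fun β hβ => h1 α hα β hβ
    rw [Finset.sum_congr rfl h4]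
    by_cases hp : p ∈ halfCyl d T
    · simp only [zeroExt, Set.indicator_of_mem hp, opL0]
      exact Finset.sum_congr rfl fun α hα => Finset.sum_congr rfl fun β hβ =>
        coeffOp_apply hα hβ _ _
    · simp [zeroExt, Set.indicator_of_notMem hp]
  filter_upwards [hLp, hu.weakJet.coeFn_toL2 (α := 0) (by simp), hu.ae_weakDx_zero,
    MemLp.coeFn_toLp (memLp_zeroExt_iff.2 hu.memLp_dt),
    Lp.coeFn_add ((memLp_zeroExt_iff.2 hu.memLp_dt).toLp _ + (-1 : ℂ) ^ m • L)
      ((lam : ℂ) • hu.weakJet.toL2 0),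
    Lp.coeFn_add ((memLp_zeroExt_iff.2 hu.memLp_dt).toLp _) ((-1 : ℂ) ^ m • L),
    Lp.coeFn_smul ((-1 : ℂ) ^ m) L,
    Lp.coeFn_smul (lam : ℂ) (hu.weakJet.toL2 0)] with p h1 h2 h3 h4 h5 h6 h7 h8
  rw [h5, Pi.add_apply, h6, Pi.add_apply, h7, h8, Pi.smul_apply, Pi.smul_apply, h1, h2, h4]
  by_cases hp : p ∈ halfCyl d T
  · simp only [zeroExt, Set.indicator_of_mem hp, opP, h3 hp]
    congr 1
    congr 1
    rw [← Complex.coe_smul]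
    simp
  · simp [zeroExt, Set.indicator_of_notMem hp]

end Conclusion

theorem theorem6p6 (d n m : ℕ) [NeZero d] (hm : 0 < m) (δ : ℝ) (hδ : 0 < δ) :
    ∃ N : ℝ≥0, ∀ (T : WithTop ℝ) (A : Coeff d n), LegendreHadamard m δ A →
      ∀ lam : ℝ, 0 ≤ lam → ∀ u : SpaceTime d → Cvec n,
        MemW12 (2 * m) (halfCyl d T) u → ZeroDirichlet m T u →
          normL2 (halfCyl d T) (weakDt (halfCyl d T) u) +
            ∑ k ∈ Finset.range (2 * m + 1), ∑ α ∈ multiIdx d k,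
              ENNReal.ofReal (lam ^ (1 - (k : ℝ) / (2 * (m : ℝ)))) *
                normL2 (halfCyl d T) (weakDx (halfCyl d T) α u)
            ≤ (N : ℝ≥0∞) * normL2 (halfCyl d T) (opP m A lam (halfCyl d T) u) := by
  obtain ⟨N, hN0, hN⟩ := exists_main_bound d n m hm hδ (coeffBound_nonneg n hδ)
  -- One copy of N for u_t and one for each multi-index in the sum on the left.
  refine ⟨N.toNNReal + ∑ k ∈ Finset.range (2 * m + 1), ∑ α ∈ multiIdx d k, N.toNNReal,
    fun T A hA lam hlam u hu htr => ?_⟩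
  obtain ⟨hW, hD⟩ := hN T _ hu.weakJet htr _ (hA.bddCoeff hδ) (hA.norm_coeffOp_le hδ)
    hA.le_re_inner _ hu.memLp_dt hu.hasWeakDt_weakDx_zero lam hlam _ rfl
  rw [normL2_eq_of_ae_eq (coeFn_equation hA hδ hu lam),
    normL2_eq_of_ae_eq (MemLp.coeFn_toLp (memLp_zeroExt_iff.2 hu.memLp_dt))]
  push_cast
  rw [add_mul, Finset.sum_mul]
  have hmul : ∀ x : ℝ, ENNReal.ofReal (N * x) = (N.toNNReal : ℝ≥0∞) * ENNReal.ofReal x :=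
    fun x => ENNReal.ofReal_mul hN0
  refine add_le_add ?_ (Finset.sum_le_sum fun k hk => ?_)
  · rw [← hmul]
    exact ENNReal.ofReal_le_ofReal hW
  rw [Finset.sum_mul]
  refine Finset.sum_le_sum fun α hα => ?_
  have hα' := mem_multiIdx.1 hα
  have hk' : ∑ i, α i ≤ 2 * m := by
    rw [hα']; exact Nat.lt_succ_iff.1 (Finset.mem_range.1 hk)
  rw [normL2_eq_of_ae_eq (hu.weakJet.coeFn_toL2 hk'), ← hmul,
    ← ENNReal.ofReal_mul (Real.rpow_nonneg hlam _)]
  refine ENNReal.ofReal_le_ofReal ?_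
  have := hD α hk'
  rwa [hα'] at this
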